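/- **Theorem (Convergence).** Let $0<\alpha<1$, $\lambda\in\mathbb R$, $a<b$, $T>0$. For $f$ on $[0,\infty)$ put $${}_0D_t^{\alpha,\lambda}f(t)=\Big(\frac{d}{dt}+\lambda\Big)\frac1{\Gamma(1-\alpha)}\int_0^t\frac{f(\xi)}{(t-\xi)^{\alpha}e^{\lambda(t-\xi)}}\,d\xi .$$ Let $F$ be continuous on $[a,b]\times[0,T]$ and let $u:[a,b]\times[0,\infty)\to\mathbb R$ satisfy $${}_0D_t^{\alpha,\lambda}u=\partial_x^2u+F\ \text{ on }(a,b)\times(0,T],\qquad u(x,0)=0\ (a<x<b),\qquad u(x,t)=\phi(x,t)\ (x\in\{a,b\},\ 0<t\le T).$$ Assume that $u\in C^{6,3}([a,b]\times[0,T])$, i.e. $\partial_x^iu$ $(i\le 6)$ and $\partial_t^ju$ $(j\le3)$ exist and are continuous on $[a,b]\times[0,T]$, and that for every $x\in(a,b)$ the extension $\tilde u(x,\cdot)$ of $u(x,\cdot)$ by zero to $t<0$ lies in $L^1(\mathbb R)$ and satisfies $\int_{\mathbb R}(1+|\omega|)^{2+\alpha}|\hat{\tilde u}(x,\omega)|\,d\omega<\infty$,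 where $\hat f(\omega)=\int_{\mathbb R} e^{i\omega t}f(t)\,dt$. For integers $M,N\ge1$ let $h=(b-a)/M$, $\tau=T/N$, $x_i=a+ih$, $t_n=n\tau$, $F_i^n=F(x_i,t_n)$, and $$\mathcal A_xv_i=\tfrac1{12}(v_{i-1}+10v_i+v_{i+1})\ (1\le i\le M-1),\quad \mathcal A_xv_i=v_i\ (i=0,M),\quad \delta_x^2v_i=\tfrac{v_{i-1}-2v_i+v_{i+1}}{h^2},$$ $$\mathcal A_t^\alpha v^n=(1-\tfrac\alpha2)v^n+\tfrac\alpha2v^{n-1},\quad \delta_t^{\alpha,\lambda}v^n=\tau^{-\alpha}\sum_{k=0}^ne^{-(k-\alpha/2)\lambda\tau}(-1)^k\tbinom{\alpha}{k}v^{n-k},\quad (v,w)=h\sum_{i=1}^{M-1}v_iw_i,\quad \|v\|=\sqrt{(v,v)} .$$ A solution $\{u_i^n\}$ of the compact scheme satisfies $\mathcal A_x\delta_t^{\alpha,\lambda}u_i^n-\mathcal A_t^\alpha\delta_x^2u_i^n=\mathcal A_t^\alpha\mathcal A_xF_i^n$ for $1\le i\le M-1$, $1\le n\le N$, with $u_i^0=0$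 $(0\le i\le M)$, $u_0^n=\phi(a,t_n)$ and $u_M^n=\phi(b,t_n)$ $(1\le n\le N)$. Let $e_i^n=u(x_i,t_n)-u_i^n$, and let $R_i^n=\mathcal A_x\delta_t^{\alpha,\lambda}U_i^n-\mathcal A_t^\alpha\delta_x^2U_i^n-\mathcal A_t^\alpha\mathcal A_xF_i^n$ with $U_i^n=u(x_i,t_n)$ be the truncation error. Call $C_\Omega>0$ admissible if $-(\delta_x^2v,v)\ge C_\Omega\|v\|^2$ for every $M\ge 1$ and every grid function $v$ with $v_0=v_M=0$. Consider the two estimates $$|R_i^n|\le c_1(\tau^2+h^4)\quad(1\le i\le M-1,\ 1\le n\le N),\tag{1}$$ $$\|e^n\|\le\sqrt{\frac{3\,\Gamma(1-\alpha)\,e^{2|\lambda|T}\,T^\alpha(b-a)}{C_\Omega}}\;c_1(\tau^2+h^4)\quad(1\le n\le N).\tag{2}$$ Then: (i) an admissible $C_\Omega$ exists; (ii) there is a constant $c_1>0$, independent of $M$ and $N$, such that for all $M,N\ge1$ both (1) and, for every solution of the scheme and every admissible $C_\Omega$, (2) hold; so the scheme is of second order in time and fourth order in space; (iii) if, on a given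 mesh, $2-\alpha-e^{\lambda\tau}\ge0$ and (1) holds with some $c_1\ge0$, then (2) holds with that same $c_1$, for every solution of the scheme and every admissible $C_\Omega$. -/

import Mathlib

open MeasureTheory Set

noncomputable section

namespace TFSDE

/-- The fractional substantial integral of order `γ > 0` with lower limit `a`:
`Γ(γ)⁻¹ ∫_a^t f(ξ) / ((t - ξ)^(1-γ) e^{lam (t - ξ)}) dξ`. -/
def substInt (γ lam a : ℝ) (f : ℝ → ℝ) (t : ℝ) : ℝ :=
  (Real.Gamma γ)⁻¹ * ∫ ξ in a..t, f ξ / ((t - ξ) ^ (1 - γ) * Real.exp (lam * (t - ξ)))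

/-- The fractional substantial derivative of order `α` with `n - 1 < α < n`, `n = ⌈α⌉`:
`(d/dt + lam)^n` applied to the fractional substantial integral of order `n - α`. -/
def substDeriv (α lam a : ℝ) (f : ℝ → ℝ) : ℝ → ℝ :=
  (fun (g : ℝ → ℝ) (t : ℝ) => deriv g t + lam * g t)^[⌈α⌉₊] (substInt ((⌈α⌉₊ : ℝ) - α) lam a f)

/-- The Fourier transform `∫ e^{iωt} f(t) dt` of a real-valued function. -/
def fourierHat (f : ℝ → ℝ) (ω : ℝ) : ℂ :=
  ∫ t : ℝ, Complex.exp (Complex.I * (ω : ℂ) * (t : ℂ)) * (f t : ℂ)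

/-- `f ∈ L¹(ℝ)` and `∫ (1 + |ω|)^β |f̂(ω)| dω < ∞`. -/
def MemFourierClass (β : ℝ) (f : ℝ → ℝ) : Prop :=
  Integrable f ∧ Integrable (fun ω : ℝ => (1 + |ω|) ^ β * ‖fourierHat f ω‖)

/-- The extension by zero to negative times. -/
def zeroExt (f : ℝ → ℝ) (t : ℝ) : ℝ := if 0 ≤ t then f t else 0

/-- `u ∈ C^{p,q}([a,b] × [0,T])`: the derivatives `∂_x^i u` (`i ≤ p`) and `∂_t^j u` (`j ≤ q`)
exist and are jointly continuous on `[a,b] × [0,T]` (one-sided derivatives at the ends). -/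
structure ClassC (p q : ℕ) (a b T : ℝ) (u : ℝ → ℝ → ℝ) : Prop where
  contDiff_x : ∀ t ∈ Icc 0 T, ContDiffOn ℝ p (fun x => u x t) (Icc a b)
  contDiff_t : ∀ x ∈ Icc a b, ContDiffOn ℝ q (u x) (Icc 0 T)
  cont_x : ∀ i ≤ p, ContinuousOn
    (fun z : ℝ × ℝ => iteratedDerivWithin i (fun x => u x z.2) (Icc a b) z.1)
    (Icc a b ×ˢ Icc 0 T)
  cont_t : ∀ j ≤ q, ContinuousOn
    (fun z : ℝ × ℝ => iteratedDerivWithin j (u z.1) (Icc 0 T) z.2)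
    (Icc a b ×ˢ Icc 0 T)

/-- `u` solves the time fractional substantial diffusion equation
`₀D_t^{α,lam} u = ∂_x² u + F` on `(a,b) × (0,T]`, with zero initial value and with boundary
values `φ` at `x = a` and `x = b`. -/
structure IsSolution (α lam a b T : ℝ) (F φ u : ℝ → ℝ → ℝ) : Prop where
  eqn : ∀ x ∈ Ioo a b, ∀ t ∈ Ioc 0 T,
    substDeriv α lam 0 (u x) t = iteratedDeriv 2 (fun y => u y t) x + F x t
  init : ∀ x ∈ Ioo a b, u x 0 = 0
  left : ∀ t ∈ Ioc 0 T, u a t = φ a t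
  right : ∀ t ∈ Ioc 0 T, u b t = φ b t

/-! Time grid functions are `v : ℕ → ℝ`, space grid functions are `w : ℕ → ℝ` and space-time
grid functions are `U : ℕ → ℕ → ℝ`, where `U n i` is the value at `(x_i, t_n)`. -/

/-- `g_k^α = (-1)^k binom(α, k)`. -/
def gCoeff (α : ℝ) (k : ℕ) : ℝ := (-1) ^ k * Ring.choose α k

/-- `g_k^{α,lam} = e^{-(k - α/2) lam τ} g_k^α`. -/
def gCoeffSubst (α lam τ : ℝ) (k : ℕ) : ℝ :=
  Real.exp (-((k : ℝ) - α / 2) * lam * τ) * gCoeff α k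

/-- The discrete substantial derivative `δ_t^{α,lam} v^n`. -/
def deltaT (α lam τ : ℝ) (v : ℕ → ℝ) (n : ℕ) : ℝ :=
  (τ ^ α)⁻¹ * ∑ k ∈ Finset.range (n + 1), gCoeffSubst α lam τ k * v (n - k)

/-- The average `A_t^α v^n = (1 - α/2) v^n + (α/2) v^{n-1}`, used for `n ≥ 1`. -/
def avgT (α : ℝ) (v : ℕ → ℝ) (n : ℕ) : ℝ := (1 - α / 2) * v n + α / 2 * v (n - 1)

/-- The compact average `A_x w_i` on the grid `0, …, M`. -/
def avgX (M : ℕ) (w : ℕ → ℝ) (i : ℕ) : ℝ :=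
  if 1 ≤ i ∧ i < M then (w (i - 1) + 10 * w i + w (i + 1)) / 12 else w i

/-- The central difference quotient `δ_x² w_i`, used for `1 ≤ i ≤ M - 1`. -/
def deltaX (h : ℝ) (w : ℕ → ℝ) (i : ℕ) : ℝ := (w (i - 1) - 2 * w i + w (i + 1)) / h ^ 2

/-- `(v, w) = h ∑_{i=1}^{M-1} v_i w_i`. -/
def gridInner (h : ℝ) (M : ℕ) (v w : ℕ → ℝ) : ℝ := h * ∑ i ∈ Finset.Ico 1 M, v i * w i

/-- `‖v‖ = √(v, v)`. -/
def gridNorm (h : ℝ) (M : ℕ) (v : ℕ → ℝ) : ℝ := Real.sqrt (gridInner h M v v)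

/-- The left-hand side `A_x δ_t^{α,lam} U_i^n - A_t^α δ_x² U_i^n` of the compact scheme. -/
def schemeLHS (α lam τ h : ℝ) (M : ℕ) (U : ℕ → ℕ → ℝ) (n i : ℕ) : ℝ :=
  avgX M (fun j => deltaT α lam τ (fun m => U m j) n) i
    - avgT α (fun m => deltaX h (U m) i) n

/-- The right-hand side `A_t^α A_x F_i^n` of the compact scheme. -/
def schemeRHS (α : ℝ) (M : ℕ) (G : ℕ → ℕ → ℝ) (n i : ℕ) : ℝ :=
  avgT α (fun m => avgX M (G m) i) n

/-- The restriction of `w` to the grid `x_i = a + i h`, `t_n = n τ`. -/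
def onGrid (a h τ : ℝ) (w : ℝ → ℝ → ℝ) (n i : ℕ) : ℝ := w (a + i * h) (n * τ)

/-- `U` solves the compact difference scheme with `M` space steps and `N` time steps. -/
structure IsSchemeSolution (α lam a b T : ℝ) (F φ : ℝ → ℝ → ℝ) (M N : ℕ)
    (U : ℕ → ℕ → ℝ) : Prop where
  eqn : ∀ n ∈ Finset.Icc 1 N, ∀ i ∈ Finset.Ico 1 M,
    schemeLHS α lam (T / N) ((b - a) / M) M U n i
      = schemeRHS α M (onGrid a ((b - a) / M) (T / N) F) n i
  init : ∀ i ≤ M, U 0 i = 0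
  left : ∀ n ∈ Finset.Icc 1 N, U n 0 = φ a (n * (T / N))
  right : ∀ n ∈ Finset.Icc 1 N, U n M = φ b (n * (T / N))

/-- The truncation error `R_i^n`: the residual of the exact solution in the compact scheme. -/
def truncErr (α lam a b T : ℝ) (F u : ℝ → ℝ → ℝ) (M N n i : ℕ) : ℝ :=
  schemeLHS α lam (T / N) ((b - a) / M) M (onGrid a ((b - a) / M) (T / N) u) n i
    - schemeRHS α M (onGrid a ((b - a) / M) (T / N) F) n i

/-- `|R_i^n| ≤ c (τ² + h⁴)` for all `1 ≤ i ≤ M - 1`, `1 ≤ n ≤ N`. -/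
def TruncBound (α lam a b T : ℝ) (F u : ℝ → ℝ → ℝ) (M N : ℕ) (c : ℝ) : Prop :=
  ∀ n ∈ Finset.Icc 1 N, ∀ i ∈ Finset.Ico 1 M,
    |truncErr α lam a b T F u M N n i| ≤ c * ((T / N) ^ 2 + ((b - a) / M) ^ 4)

/-- `C` is an admissible constant `C_Ω`: `-(δ_x² v, v) ≥ C ‖v‖²` for every mesh of `[a,b]` and
every grid function `v` that vanishes at both end points. -/
def IsMeshConst (a b C : ℝ) : Prop :=
  ∀ M : ℕ, 1 ≤ M → ∀ v : ℕ → ℝ, v 0 = 0 → v M = 0 →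
    C * gridNorm ((b - a) / M) M v ^ 2
      ≤ -gridInner ((b - a) / M) M (deltaX ((b - a) / M) v) v

/-- The error estimate
`‖e^n‖ ≤ √(3 Γ(1-α) e^{2|lam|T} T^α (b-a) / C) c (τ² + h⁴)`, `1 ≤ n ≤ N`,
for every solution of the scheme, where `e_i^n = u(x_i, t_n) - U_i^n`. -/
def ErrorBound (α lam a b T : ℝ) (F φ u : ℝ → ℝ → ℝ) (M N : ℕ) (C c : ℝ) : Prop :=
  ∀ U : ℕ → ℕ → ℝ, IsSchemeSolution α lam a b T F φ M N U → ∀ n ∈ Finset.Icc 1 N,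
    gridNorm ((b - a) / M) M (fun i => onGrid a ((b - a) / M) (T / N) u n i - U n i)
      ≤ Real.sqrt (3 * Real.Gamma (1 - α) * Real.exp (2 * |lam| * T) * T ^ α * (b - a) / C)
          * c * ((T / N) ^ 2 + ((b - a) / M) ^ 4)

end TFSDE

end

open MeasureTheory Set

noncomputable section

namespace TFSDE

/-! Consistency in time. Put `v(t) = e^{lam t} u(x,t)`, extended by zero to `t < 0`. The substantial
derivative of `u` is `e^{-lam t}` times the ordinary fractional derivative of `v`, and `deltaT` is,
up to exponential factors, the Grünwald sum of `v`. The Fourier hypothesis forces the zero extension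
to be C² across `t = 0`, so `v`, `v'`, `v''` vanish there, and `v` is the integral of `v'''` against
`(x - s)₊²/2`. Hence both the Grünwald sum at `t_n` and the average of the fractional derivative
over `t_n`, `t_{n-1}` are integrals of `v'''` against explicit kernels. The kernels differ by at
most `K τ² x^{-α}`, which is integrable because `α < 1` (`exists_abs_grunwald_sub_le`). By scaling
this is a statement about `τ = 1`, where a closed form (`sum_gCoeff_mul_sq`) and the midpoint
asymptotics of the partial sums (`gSum_mul_rpow_bounds`) settle it.

Consistency in space. The equation replaces the substantial derivative by `∂_x² u + F`, and the
compact average of `∂_x² u` agrees with the second difference to fourth order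
(`abs_compact_sub_le`).

Stability. The error equation is tested with the time average of the error. The compact average is a
sum of squares with nonnegative weights, so a scalar inequality for Grünwald convolutions suffices
(`gConv_mul_avg_ge`); its hypothesis is exactly `e^{lam τ} ≤ 2 - α`. The discrete Poincaré
inequality absorbs the truncation error, and a comparison principle (`le_of_gConv_le`) turns the
resulting bound on the convolution into a bound on the energy. This gives (iii).

For (ii) the step condition holds for all large `N`. The finitely many remaining `N` are handled by
induction over the time levels with a constant depending on `N` but not on `M`
(`exists_compactForm_le`), and `c₁` is enlarged accordingly. One `c₁` serves every admissible `C`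
because these are bounded above (`IsMeshConst.le`). -/

/-! ### Grünwald coefficients and the asymptotics of their partial sums. -/

theorem gCoeff_zero (α : ℝ) : gCoeff α 0 = 1 := by
  simp [gCoeff]

theorem choose_succ_mul (α : ℝ) (k : ℕ) :
    Ring.choose α (k + 1) * (k + 1) = Ring.choose α k * (α - k) := by
  rw [Ring.choose_eq_smul, Ring.choose_eq_smul, descPochhammer_succ_right]
  simp only [Polynomial.smeval_mul, Nat.factorial_succ, smul_eq_mul,
    Polynomial.smeval_sub, Polynomial.smeval_X, Polynomial.smeval_natCast]
  have : ((k : ℝ) + 1) ≠ 0 := by positivity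
  have : ((k.factorial : ℝ)) ≠ 0 := by positivity
  push_cast
  simp
  field_simp

theorem gCoeff_succ (α : ℝ) (k : ℕ) :
    gCoeff α (k + 1) = gCoeff α k * ((k - α) / (k + 1)) := by
  have h := choose_succ_mul α k
  have h1 : ((k : ℝ) + 1) ≠ 0 := by positivity
  have h2 : Ring.choose α (k + 1) = Ring.choose α k * (α - k) / (k + 1) := by
    rw [eq_div_iff h1, h]
  unfold gCoeff
  rw [h2, pow_succ]
  field_simp
  ring

/-- The partial sums of the Grünwald coefficients. -/
def gSum (α : ℝ) (n : ℕ) : ℝ := ∑ k ∈ Finset.range (n + 1), gCoeff α k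

theorem gSum_zero (α : ℝ) : gSum α 0 = 1 := by simp [gSum, gCoeff_zero]

/-- Reduces the sign of the later coefficients to the positivity of the partial sums, and makes the
partial sums a telescoping product. -/
theorem gCoeff_succ_eq_gSum (α : ℝ) (n : ℕ) :
    gCoeff α (n + 1) = -(α / (n + 1)) * gSum α n := by
  induction n with
  | zero => rw [gCoeff_succ, gSum_zero, gCoeff_zero]; simp
  | succ n ih =>
    have h1 : ((n : ℝ) + 1) ≠ 0 := by positivity
    have h2 : ((n : ℝ) + 1 + 1) ≠ 0 := by positivity
    have : gSum α (n + 1) = gSum α n + gCoeff α (n + 1) := by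
      simp [gSum, Finset.sum_range_succ _ (n + 1)]
    rw [gCoeff_succ, this, ih]
    push_cast
    field_simp
    ring

theorem gSum_succ (α : ℝ) (n : ℕ) :
    gSum α (n + 1) = gSum α n * ((n + 1 - α) / (n + 1)) := by
  have h1 : ((n : ℝ) + 1) ≠ 0 := by positivity
  have : gSum α (n + 1) = gSum α n + gCoeff α (n + 1) := by
    simp [gSum, Finset.sum_range_succ _ (n + 1)]
  rw [this, gCoeff_succ_eq_gSum]
  field_simp
  ring

theorem gSum_pos {α : ℝ} (h1 : α < 1) (n : ℕ) : 0 < gSum α n := by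
  induction n with
  | zero => simp [gSum_zero]
  | succ n ih =>
    rw [gSum_succ]
    have : (0 : ℝ) ≤ n := by positivity
    have : 0 < (n : ℝ) + 1 - α := by linarith
    positivity

theorem gCoeff_succ_nonpos {α : ℝ} (h0 : 0 < α) (h1 : α < 1) (k : ℕ) :
    gCoeff α (k + 1) ≤ 0 := by
  rw [gCoeff_succ_eq_gSum]
  have := gSum_pos h1 k
  have : 0 ≤ α / (k + 1) * gSum α k := by positivity
  linarith

theorem gSum_eq_Gamma {α : ℝ} (h1 : α < 1) (n : ℕ) :
    gSum α n = Real.Gamma (n + 1 - α) / (Real.Gamma (1 - α) * Real.Gamma (n + 1)) := by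
  have hG : Real.Gamma (1 - α) ≠ 0 := (Real.Gamma_pos_of_pos (by linarith)).ne'
  induction n with
  | zero => simp [gSum_zero, hG]
  | succ n ih =>
    have hn : (0 : ℝ) ≤ n := by positivity
    have e1 : Real.Gamma (((n + 1 : ℕ) : ℝ) + 1 - α) = (n + 1 - α) * Real.Gamma (n + 1 - α) := by
      rw [← Real.Gamma_add_one (by linarith)]
      congr 1; push_cast; ring
    have e2 : Real.Gamma (((n + 1 : ℕ) : ℝ) + 1) = (n + 1) * Real.Gamma (n + 1) := by
      rw [← Real.Gamma_add_one (by positivity)]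
      congr 1; push_cast; ring
    have h3 : Real.Gamma ((n : ℝ) + 1) ≠ 0 := (Real.Gamma_pos_of_pos (by positivity)).ne'
    rw [gSum_succ, ih, e1, e2]
    field_simp

/-- The second-order convolution of the Grünwald coefficients with a shifted square. -/
theorem sum_gCoeff_mul_sq {α : ℝ} (h1 : α < 1) (m : ℕ) (θ : ℝ) :
    ∑ k ∈ Finset.range (m + 1), gCoeff α k * ((m : ℝ) - k + θ) ^ 2 =
      gSum α m * (2 * (m + 1 - α) * (m + 2 - α) / ((1 - α) * (2 - α))
        + (2 * θ - 3) * (m + 1 - α) / (1 - α) + (θ - 1) ^ 2) := by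
  have a1 : (1 - α) ≠ 0 := by linarith
  have a2 : (2 - α) ≠ 0 := by linarith
  -- Passing from `m` to `m + 1` replaces `θ` by `θ + 1` in the old terms, and the new term
  -- contributes `θ²`.
  induction m generalizing θ with
  | zero =>
    simp [gSum_zero, gCoeff_zero]
    field_simp
    ring
  | succ m ih =>
    have hm : ((m : ℝ) + 1) ≠ 0 := by positivity
    rw [Finset.sum_range_succ, gCoeff_succ_eq_gSum, gSum_succ]
    have : ∀ k ∈ Finset.range (m + 1), gCoeff α k * (((m + 1 : ℕ) : ℝ) - k + θ) ^ 2
        = gCoeff α k * ((m : ℝ) - k + (θ + 1)) ^ 2 := by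
      intro k _; push_cast; ring
    rw [Finset.sum_congr rfl this, ih]
    push_cast
    field_simp
    ring

/-- Gautschi's inequality for the normalised partial sums. -/
theorem le_gSum {α : ℝ} (h0 : 0 < α) (h1 : α < 1) (n : ℕ) :
    ((n : ℝ) + 1 - α) ^ (-α) ≤ Real.Gamma (1 - α) * gSum α n := by
  have hn : (0 : ℝ) ≤ n := by positivity
  have hG : 0 < Real.Gamma (1 - α) := Real.Gamma_pos_of_pos (by linarith)
  have h3 : 0 < Real.Gamma ((n : ℝ) + 1) := Real.Gamma_pos_of_pos (by positivity)
  have hp : 0 < (n : ℝ) + 1 - α := by linarith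
  have h4 : 0 < Real.Gamma ((n : ℝ) + 1 - α) := Real.Gamma_pos_of_pos hp
  -- Log-convexity of Gamma at `n + 1 = (1 - α)(n + 1 - α) + α(n + 2 - α)`.
  have key := Real.Gamma_mul_add_mul_le_rpow_Gamma_mul_rpow_Gamma (s := (n : ℝ) + 1 - α)
    (t := (n : ℝ) + 1 - α + 1) (a := 1 - α) (b := α) hp (by linarith) (by linarith) h0 (by ring)
  rw [Real.Gamma_add_one hp.ne', Real.mul_rpow hp.le h4.le] at key
  have e : Real.Gamma ((n : ℝ) + 1 - α) ^ (1 - α) * (((n : ℝ) + 1 - α) ^ α *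
      Real.Gamma ((n : ℝ) + 1 - α) ^ α) = ((n : ℝ) + 1 - α) ^ α * Real.Gamma ((n : ℝ) + 1 - α) := by
    rw [mul_left_comm, ← Real.rpow_add h4]; simp
  rw [e, show (1 - α) * ((n : ℝ) + 1 - α) + α * ((n : ℝ) + 1 - α + 1) = n + 1 by ring] at key
  rw [gSum_eq_Gamma h1, Real.rpow_neg hp.le]
  have hpp : 0 < ((n : ℝ) + 1 - α) ^ α := by positivity
  rw [show Real.Gamma (1 - α) * (Real.Gamma (n + 1 - α) / (Real.Gamma (1 - α) * Real.Gamma (n + 1)))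
    = Real.Gamma (n + 1 - α) / Real.Gamma (n + 1) by field_simp, inv_eq_one_div,
    div_le_div_iff₀ hpp h3]
  linarith

/-- Log-convexity of Gamma at `n + 1 - α = (1 - α)(n + 1) + α n`. -/
theorem gSum_le {α : ℝ} (h0 : 0 < α) (h1 : α < 1) (n : ℕ) (hn : 1 ≤ n) :
    Real.Gamma (1 - α) * gSum α n ≤ (n : ℝ) ^ (-α) := by
  have hn : (0 : ℝ) < n := by positivity
  have hG : 0 < Real.Gamma (1 - α) := Real.Gamma_pos_of_pos (by linarith)
  have h3 : 0 < Real.Gamma ((n : ℝ)) := Real.Gamma_pos_of_pos (by positivity)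
  have key := Real.Gamma_mul_add_mul_le_rpow_Gamma_mul_rpow_Gamma (s := (n : ℝ) + 1)
    (t := (n : ℝ)) (a := 1 - α) (b := α) (by linarith) hn (by linarith) h0 (by ring)
  rw [Real.Gamma_add_one hn.ne', Real.mul_rpow hn.le h3.le] at key
  have e : (n : ℝ) ^ (1 - α) * Real.Gamma (n : ℝ) ^ (1 - α) * Real.Gamma (n : ℝ) ^ α
      = (n : ℝ) ^ (-α) * (n * Real.Gamma (n : ℝ)) := by
    rw [mul_assoc, ← Real.rpow_add h3, sub_eq_add_neg, Real.rpow_add hn]; simp; ring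
  rw [e, show (1 - α) * ((n : ℝ) + 1) + α * (n : ℝ) = n + 1 - α by ring] at key
  rw [gSum_eq_Gamma h1, Real.Gamma_add_one hn.ne']
  rw [show Real.Gamma (1 - α) * (Real.Gamma (n + 1 - α) / (Real.Gamma (1 - α) * (n * Real.Gamma n)))
    = Real.Gamma (n + 1 - α) / (n * Real.Gamma n) by field_simp, div_le_iff₀ (by positivity)]
  linarith

/-- The odd series `2 ∑ x^(2k+1)/(2k+1)` is dominated by the geometric value `2x/(1 - x²) = 2x +
2x³/(1 - x²)`, and `1/(1 - x²) ≤ 9/8` for `x ≤ 1/3`. -/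
theorem log_ratio_bounds {x : ℝ} (hx0 : 0 < x) (hx : x ≤ 1 / 3) :
    Real.log (1 + x) - Real.log (1 - x) ≤ 2 * x + 9 / 4 * x ^ 3 := by
  have h1 : |x| < 1 := by rw [abs_of_pos hx0]; linarith
  have hs := Real.hasSum_log_sub_log_of_abs_lt_one h1
  have hx2 : x ^ 2 ≤ 1 / 9 := by nlinarith
  have hg := (hasSum_geometric_of_lt_one (by positivity : 0 ≤ x ^ 2) (by linarith)).mul_left (2 * x)
  have hle : Real.log (1 + x) - Real.log (1 - x) ≤ 2 * x * (1 - x ^ 2)⁻¹ := by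
    refine hasSum_le (fun k => ?_) hs hg
    have : x ^ (2 * k + 1) = x * (x ^ 2) ^ k := by rw [pow_succ, pow_mul]; ring
    rw [this]
    have h2 : (1 : ℝ) / (2 * k + 1) ≤ 1 := by
      rw [div_le_one (by positivity)]
      have : (0 : ℝ) ≤ k := by positivity
      linarith
    have h3 : 0 ≤ x * (x ^ 2) ^ k := by positivity
    nlinarith
  refine hle.trans ?_
  rw [← div_eq_mul_inv, div_le_iff₀ (by linarith)]
  have : 0 < x ^ 3 := by positivity
  nlinarith

/-- Termwise in the odd power series, since `α^(2k+1) ≤ α`. -/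
theorem log_ratio_mul_le {α x : ℝ} (h0 : 0 < α) (h1 : α < 1) (hx0 : 0 < x) (hx : x < 1) :
    Real.log (1 + α * x) - Real.log (1 - α * x) ≤ α * (Real.log (1 + x) - Real.log (1 - x)) := by
  have hax : 0 < α * x := by positivity
  have hax1 : α * x < 1 := by nlinarith
  have hs := Real.hasSum_log_sub_log_of_abs_lt_one (show |x| < 1 by rwa [abs_of_pos hx0])
  have hs' := Real.hasSum_log_sub_log_of_abs_lt_one
    (show |α * x| < 1 by rwa [abs_of_pos hax])
  refine hasSum_le (fun k => ?_) hs' (hs.mul_left α)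
  have : (α * x) ^ (2 * k + 1) ≤ α * x ^ (2 * k + 1) := by
    rw [mul_pow]
    have : α ^ (2 * k + 1) ≤ α := pow_le_of_le_one h0.le h1.le (by omega)
    gcongr
  calc 2 * (1 / (2 * (k : ℝ) + 1)) * (α * x) ^ (2 * k + 1)
      ≤ 2 * (1 / (2 * (k : ℝ) + 1)) * (α * x ^ (2 * k + 1)) := by gcongr
    _ = _ := by ring

theorem two_mul_le_log_ratio {x : ℝ} (hx0 : 0 < x) (hx : x < 1) :
    2 * x ≤ Real.log (1 + x) - Real.log (1 - x) := by
  have hs := Real.hasSum_log_sub_log_of_abs_lt_one (show |x| < 1 by rwa [abs_of_pos hx0])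
  have := le_hasSum hs 0 (fun k _ => by positivity)
  simpa using this

/-- The normalised partial sum, compared with `(n + (1 - α) / 2)^(-α)`, on a logarithmic scale. -/
def logRatio (α : ℝ) (n : ℕ) : ℝ :=
  Real.log (Real.Gamma (1 - α) * gSum α n) + α * Real.log (n + (1 - α) / 2)

/-- The shift `(1 - α)/2` is chosen for symmetry: with `w = 2n + 2 - α`, the factors in the quotient
are `(w ± 1)/2` and `(w ± α)/2`. Only odd functions of `1/w` appear, and their first-order terms
cancel. -/
theorem logRatio_succ_sub {α : ℝ} (h1 : α < 1) (n : ℕ) :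
    logRatio α (n + 1) - logRatio α n =
      α * (Real.log (1 + 1 / (2 * n + 2 - α)) - Real.log (1 - 1 / (2 * n + 2 - α)))
      - (Real.log (1 + α * (1 / (2 * n + 2 - α))) - Real.log (1 - α * (1 / (2 * n + 2 - α)))) := by
  have hn : (0 : ℝ) ≤ n := by positivity
  have hG : 0 < Real.Gamma (1 - α) := Real.Gamma_pos_of_pos (by linarith)
  have hg := gSum_pos h1 n
  have hz : 0 < 2 * (n : ℝ) + 2 - α := by linarith
  have hz' := hz.ne'
  have hw : 1 / (2 * (n : ℝ) + 2 - α) * (2 * n + 2 - α) = 1 := one_div_mul_cancel hz'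
  have e1 : (1 : ℝ) + 1 / (2 * n + 2 - α) = 2 * ((n : ℝ) + 1 + (1 - α) / 2) / (2 * n + 2 - α) := by
    rw [eq_div_iff hz']; linear_combination hw
  have e2 : (1 : ℝ) - 1 / (2 * n + 2 - α) = 2 * ((n : ℝ) + (1 - α) / 2) / (2 * n + 2 - α) := by
    rw [eq_div_iff hz']; linear_combination -hw
  have e3 : (1 : ℝ) + α * (1 / (2 * n + 2 - α)) = 2 * ((n : ℝ) + 1) / (2 * n + 2 - α) := by
    rw [eq_div_iff hz']; linear_combination α * hw
  have e4 : (1 : ℝ) - α * (1 / (2 * n + 2 - α)) = 2 * ((n : ℝ) + 1 - α) / (2 * n + 2 - α) := by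
    rw [eq_div_iff hz']; linear_combination -α * hw
  have p1 : 0 < (n : ℝ) + (1 - α) / 2 := by linarith
  have p2 : 0 < (n : ℝ) + 1 + (1 - α) / 2 := by linarith
  have p3 : 0 < (n : ℝ) + 1 - α := by linarith
  have p4 : 0 < (n : ℝ) + 1 := by linarith
  rw [e1, e2, e3, e4, Real.log_div (by positivity) hz.ne', Real.log_div (by positivity) hz.ne',
    Real.log_div (by positivity) hz.ne', Real.log_div (by positivity) hz.ne',
    Real.log_mul (by positivity) p1.ne', Real.log_mul (by positivity) p2.ne',
    Real.log_mul (by positivity) p3.ne', Real.log_mul (by positivity) p4.ne']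
  unfold logRatio
  rw [gSum_succ, Real.log_mul hG.ne' (by positivity), Real.log_mul hg.ne' (by positivity),
    Real.log_div p3.ne' p4.ne', Real.log_mul hG.ne' hg.ne']
  push_cast
  ring

theorem monotone_logRatio {α : ℝ} (h0 : 0 < α) (h1 : α < 1) : Monotone (logRatio α) := by
  refine monotone_nat_of_le_succ fun n => ?_
  have hn : (0 : ℝ) ≤ n := by positivity
  have := logRatio_succ_sub h1 n
  have hx : 1 / (2 * (n : ℝ) + 2 - α) < 1 := by
    rw [div_lt_one (by linarith)]; linarith
  have hx0 : 0 < 1 / (2 * (n : ℝ) + 2 - α) := by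
    apply div_pos one_pos; linarith
  linarith [log_ratio_mul_le h0 h1 hx0 hx]

/-- The increment of `logRatio` is at most `(9/4) w⁻³`, with `w = 2n + 2 - α`, and the telescoping
difference of inverse squares is `16w/(w² - 1)²`, which is larger. -/
theorem logRatio_succ_sub_le {α : ℝ} (h0 : 0 < α) (h1 : α < 1) (n : ℕ) (hn1 : 1 ≤ n) :
    logRatio α (n + 1) + 1 / ((n : ℝ) + 1 + (1 - α) / 2) ^ 2
      ≤ logRatio α n + 1 / ((n : ℝ) + (1 - α) / 2) ^ 2 := by
  have hn : (1 : ℝ) ≤ n := by exact_mod_cast hn1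
  have := logRatio_succ_sub h1 n
  set w := 2 * (n : ℝ) + 2 - α with hw
  have hw3 : 3 ≤ w := by linarith
  have hx0 : 0 < 1 / w := by positivity
  have hx : 1 / w ≤ 1 / 3 := by gcongr
  have a1 := two_mul_le_log_ratio (x := α * (1 / w)) (by positivity) (by nlinarith)
  have a2 := log_ratio_bounds hx0 hx
  have a3 : α * (Real.log (1 + 1 / w) - Real.log (1 - 1 / w)) ≤
    α * (2 * (1 / w) + 9 / 4 * (1 / w) ^ 3) := by gcongr
  have a4 : α * (9 / 4 * (1 / w) ^ 3) ≤ 1 * (9 / 4 * (1 / w) ^ 3) := by gcongr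
  have e1 : (n : ℝ) + 1 + (1 - α) / 2 = (w + 1) / 2 := by rw [hw]; ring
  have e2 : (n : ℝ) + (1 - α) / 2 = (w - 1) / 2 := by rw [hw]; ring
  have a5 : 9 / 4 * (1 / w) ^ 3 ≤ 1 / ((w - 1) / 2) ^ 2 - 1 / ((w + 1) / 2) ^ 2 := by
    have q1 : (w - 1) ≠ 0 := by linarith
    have q2 : (w + 1) ≠ 0 := by linarith
    have q3 : 1 / ((w - 1) / 2) ^ 2 - 1 / ((w + 1) / 2) ^ 2 = 16 * w / (w ^ 2 - 1) ^ 2 := by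
      rw [show w ^ 2 - 1 = (w - 1) * (w + 1) by ring]
      field_simp; ring
    have q4 : 0 < w ^ 2 - 1 := by nlinarith
    rw [q3, div_pow, one_pow, mul_one_div, div_le_div_iff₀ (by positivity) (by positivity)]
    have q5 : (w ^ 2 - 1) ^ 2 ≤ w ^ 2 * w ^ 2 := by nlinarith
    nlinarith [sq_nonneg (w * w)]
  rw [e1, e2]
  linarith

/-- A crude first-order bound that serves only to identify the limit as zero; the second-order rate
comes from monotonicity. -/
theorem abs_logRatio_le {α : ℝ} (h0 : 0 < α) (h1 : α < 1) (n : ℕ) (hn1 : 1 ≤ n) :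
    |logRatio α n| ≤ 1 / n := by
  have hn : (1 : ℝ) ≤ n := by exact_mod_cast hn1
  have hG : 0 < Real.Gamma (1 - α) := Real.Gamma_pos_of_pos (by linarith)
  have hg := gSum_pos h1 n
  have p1 : 0 < (n : ℝ) + (1 - α) / 2 := by linarith
  have p3 : 0 < (n : ℝ) + 1 - α := by linarith
  have p4 : 0 < (n : ℝ) := by linarith
  have l1 := Real.log_le_log (by positivity) (le_gSum h0 h1 n)
  have l2 := Real.log_le_log (by positivity) (gSum_le h0 h1 n hn1)
  rw [Real.log_rpow p3] at l1
  rw [Real.log_rpow p4] at l2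
  have b1 : Real.log (((n : ℝ) + (1 - α) / 2) / n) ≤ ((n : ℝ) + (1 - α) / 2) / n - 1 :=
    Real.log_le_sub_one_of_pos (by positivity)
  have b2 : Real.log (((n : ℝ) + 1 - α) / (n + (1 - α) / 2)) ≤
      ((n : ℝ) + 1 - α) / (n + (1 - α) / 2) - 1 :=
    Real.log_le_sub_one_of_pos (by positivity)
  rw [Real.log_div p1.ne' p4.ne'] at b1
  rw [Real.log_div p3.ne' p1.ne'] at b2
  have c1 : ((n : ℝ) + (1 - α) / 2) / n - 1 ≤ 1 / n := by
    rw [div_sub_one p4.ne', div_le_div_iff_of_pos_right p4]; linarith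
  have c2 : ((n : ℝ) + 1 - α) / (n + (1 - α) / 2) - 1 ≤ 1 / n := by
    rw [div_sub_one p1.ne', div_le_div_iff₀ p1 p4]; nlinarith
  have c3 : 0 < 1 / (n : ℝ) := by positivity
  unfold logRatio
  rw [abs_le]
  constructor <;> nlinarith

theorem tendsto_logRatio {α : ℝ} (h0 : 0 < α) (h1 : α < 1) :
    Filter.Tendsto (logRatio α) Filter.atTop (nhds 0) := by
  rw [tendsto_zero_iff_abs_tendsto_zero]
  refine squeeze_zero' (Filter.Eventually.of_forall fun _ => abs_nonneg _) ?_
    tendsto_one_div_atTop_nhds_zero_nat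
  filter_upwards [Filter.eventually_ge_atTop 1] with n hn using abs_logRatio_le h0 h1 n hn

theorem logRatio_nonpos {α : ℝ} (h0 : 0 < α) (h1 : α < 1) (n : ℕ) : logRatio α n ≤ 0 :=
  (monotone_logRatio h0 h1).ge_of_tendsto (tendsto_logRatio h0 h1) n

/-- After adding the inverse square the sequence decreases to zero, hence it is nonnegative. -/
theorem le_logRatio {α : ℝ} (h0 : 0 < α) (h1 : α < 1) (n : ℕ) (hn1 : 1 ≤ n) :
    -(1 / ((n : ℝ) + (1 - α) / 2) ^ 2) ≤ logRatio α n := by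
  have hanti : Antitone fun m : ℕ => logRatio α (m + 1) + 1 / (((m + 1 : ℕ) : ℝ) + (1 - α) / 2) ^ 2 := by
    refine antitone_nat_of_succ_le fun m => ?_
    have := logRatio_succ_sub_le h0 h1 (m + 1) (by omega)
    push_cast at this ⊢
    exact this
  have hlim : Filter.Tendsto
      (fun m : ℕ => logRatio α (m + 1) + 1 / (((m + 1 : ℕ) : ℝ) + (1 - α) / 2) ^ 2)
      Filter.atTop (nhds (0 + 0)) := by
    refine ((tendsto_logRatio h0 h1).comp (Filter.tendsto_add_atTop_nat 1)).add ?_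
    refine Filter.Tendsto.div_atTop tendsto_const_nhds ?_
    refine (Filter.tendsto_pow_atTop two_ne_zero).comp ?_
    refine Filter.tendsto_atTop_add_const_right _ _ ?_
    exact tendsto_natCast_atTop_atTop.comp (Filter.tendsto_add_atTop_nat 1)
  have := hanti.le_of_tendsto hlim (n - 1)
  have e : n - 1 + 1 = n := by omega
  simp only [e, add_zero] at this
  linarith

/-- The midpoint asymptotics of the partial sums of the Grünwald coefficients, with relative error
of second order. -/
theorem gSum_mul_rpow_bounds {α : ℝ} (h0 : 0 < α) (h1 : α < 1) (n : ℕ) (hn1 : 1 ≤ n) :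
    ∃ ρ : ℝ, Real.Gamma (1 - α) * gSum α n = ρ * ((n : ℝ) + (1 - α) / 2) ^ (-α) ∧
      1 - 1 / ((n : ℝ) + (1 - α) / 2) ^ 2 ≤ ρ ∧ ρ ≤ 1 := by
  have hG : 0 < Real.Gamma (1 - α) := Real.Gamma_pos_of_pos (by linarith)
  have hg := gSum_pos h1 n
  have p1 : 0 < (n : ℝ) + (1 - α) / 2 := by
    have : (0 : ℝ) ≤ n := by positivity
    linarith
  refine ⟨Real.exp (logRatio α n), ?_, ?_, ?_⟩
  · unfold logRatio
    rw [Real.exp_add, Real.exp_log (by positivity), Real.rpow_def_of_pos p1, mul_assoc,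
      ← Real.exp_add]
    ring_nf
    simp
  · linarith [Real.add_one_le_exp (logRatio α n), le_logRatio h0 h1 n hn1]
  · exact Real.exp_le_one_iff.2 (logRatio_nonpos h0 h1 n)

/-- First-order expansion of a power with exponent between `1` and `2`. -/
theorem abs_rpow_add_sub_le {p y η : ℝ} (hp1 : 1 ≤ p) (hp2 : p ≤ 2) (hy : 0 < y) (hη : 0 ≤ y + η) :
    |(y + η) ^ p - (y ^ p + p * η * y ^ (p - 1))| ≤ η ^ 2 * y ^ (p - 2) := by
  set x := η / y with hx
  have hx1 : -1 ≤ x := by rw [hx, le_div_iff₀ hy]; linarith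
  have e0 : y + η = y * (1 + x) := by rw [hx]; field_simp
  have h1x : 0 ≤ 1 + x := by linarith
  have e1 : η = x * y := by rw [hx]; field_simp
  have lo := one_add_mul_self_le_rpow_one_add hx1 hp1
  -- Bernoulli for the exponent `p - 1 ∈ [0,1]`, multiplied by `1 + x ≥ 0`, gives `1 + p x + (p - 1)
  -- x²`.
  have up : (1 + x) ^ p ≤ 1 + p * x + x ^ 2 := by
    have h := rpow_one_add_le_one_add_mul_self hx1 (p := p - 1) (by linarith) (by linarith)
    have : (1 + x) ^ p = (1 + x) * (1 + x) ^ (p - 1) := by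
      rcases h1x.eq_or_lt with h | h
      · rw [← h, Real.zero_rpow (by linarith)]; simp
      · rw [← Real.rpow_one_add' h.le (by linarith)]; congr 1; ring
    rw [this]
    have := mul_le_mul_of_nonneg_left h h1x
    nlinarith [sq_nonneg x]
  have e2 : y ^ (p - 1) = y ^ (p - 2) * y := by
    rw [← Real.rpow_add_one hy.ne']; congr 1; ring
  have e3 : y ^ p = y ^ (p - 2) * y ^ 2 := by
    rw [← Real.rpow_natCast, ← Real.rpow_add hy]; congr 1; push_cast; ring
  rw [e0, Real.mul_rpow hy.le h1x, e2, e3]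
  have hc : 0 < y ^ (p - 2) := by positivity
  rw [show y ^ (p - 2) * y ^ 2 * (1 + x) ^ p - (y ^ (p - 2) * y ^ 2 + p * η * (y ^ (p - 2) * y))
    = y ^ (p - 2) * y ^ 2 * ((1 + x) ^ p - (1 + p * x)) by rw [e1]; ring, abs_mul,
    abs_of_pos (by positivity), abs_of_nonneg (by linarith)]
  calc y ^ (p - 2) * y ^ 2 * ((1 + x) ^ p - (1 + p * x)) ≤ y ^ (p - 2) * y ^ 2 * x ^ 2 := by
        gcongr; linarith
    _ = _ := by rw [e1]; ring

/-! ### The kernel estimate for unit time step. -/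

theorem Gamma_three_sub {α : ℝ} (h1 : α < 1) :
    Real.Gamma (3 - α) = (2 - α) * (1 - α) * Real.Gamma (1 - α) := by
  rw [show 3 - α = (1 - α + 1) + 1 by ring, Real.Gamma_add_one (by linarith),
    Real.Gamma_add_one (by linarith)]
  ring

/-- The truncated power vanishes for `k > ⌊r⌋`, which leaves the sum evaluated in
`sum_gCoeff_mul_sq`, with `θ` the fractional part of `r`. -/
theorem sum_gCoeff_floor {α r : ℝ} (hr : 0 ≤ r) (n : ℕ) (hrn : r ≤ n) :
    ∑ k ∈ Finset.range (n + 1), gCoeff α k * (max (r - k) 0) ^ 2 =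
      ∑ k ∈ Finset.range (⌊r⌋₊ + 1), gCoeff α k * ((⌊r⌋₊ : ℝ) - k + (r - ⌊r⌋₊)) ^ 2 := by
  have hm : ⌊r⌋₊ ≤ n := Nat.floor_le_of_le hrn
  symm
  rw [← Finset.sum_subset (Finset.range_subset_range.2 (by omega : ⌊r⌋₊ + 1 ≤ n + 1))]
  · refine Finset.sum_congr rfl fun k hk => ?_
    have hk' : (k : ℝ) ≤ ⌊r⌋₊ := by
      have := Finset.mem_range.1 hk
      exact_mod_cast (by omega : k ≤ ⌊r⌋₊)
    have := Nat.floor_le hr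
    rw [max_eq_left (by linarith)]
    ring
  · intro k _ hk
    have hk' : (⌊r⌋₊ : ℝ) + 1 ≤ k := by
      have : ⌊r⌋₊ + 1 ≤ k := by simpa using hk
      exact_mod_cast this
    have := Nat.lt_floor_add_one r
    rw [max_eq_right (by linarith)]
    simp

/-- This is the constant term of the quadratic polynomial that the closed form becomes in the
variable `y = m + (1 - α)/2`. -/
theorem abs_kernel_const_le {α θ : ℝ} (h0 : 0 < α) (h1 : α < 1) (hθ0 : 0 ≤ θ) (hθ1 : θ < 1) :
    |(1 - α) * (3 - α) / 4 + (θ - 3 / 2) * (2 - α) * ((1 - α) / 2)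
      + (θ - 1) ^ 2 * (1 - α) * (2 - α) / 2| ≤ 5 := by
  have b1 : |(1 - α) * (3 - α) / 4| ≤ 3 := by rw [abs_le]; constructor <;> nlinarith
  have b2 : |(2 - α) * (1 - α)| ≤ 2 := by rw [abs_le]; constructor <;> nlinarith
  have b3 : |(θ - 3 / 2 + (θ - 1) ^ 2) / 2| ≤ 1 := by rw [abs_le]; constructor <;> nlinarith
  have e : (1 - α) * (3 - α) / 4 + (θ - 3 / 2) * (2 - α) * ((1 - α) / 2)
      + (θ - 1) ^ 2 * (1 - α) * (2 - α) / 2 = (1 - α) * (3 - α) / 4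
        + ((2 - α) * (1 - α)) * ((θ - 3 / 2 + (θ - 1) ^ 2) / 2) := by ring
  rw [e]
  refine (abs_add_le _ _).trans ?_
  rw [abs_mul ((2 - α) * (1 - α))]
  have : |(2 - α) * (1 - α)| * |(θ - 3 / 2 + (θ - 1) ^ 2) / 2| ≤ 2 * 1 := by gcongr
  linarith

theorem abs_kernel_poly_le {α θ y q : ℝ} (h0 : 0 < α) (h1 : α < 1) (hθ0 : 0 ≤ θ) (hθ1 : θ < 1)
    (hy : 1 ≤ y) (hq : |q| ≤ 5) :
    |y ^ 2 + (2 - α) * (θ - 1 / 2) * y + q| ≤ 7 * y ^ 2 := by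
  have h : |(2 - α) * (θ - 1 / 2)| ≤ 1 := by
    rw [abs_mul, abs_of_pos (by linarith)]
    have : |θ - 1 / 2| ≤ 1 / 2 := by rw [abs_le]; constructor <;> linarith
    nlinarith [abs_nonneg (θ - 1 / 2)]
  have h2 : |(2 - α) * (θ - 1 / 2) * y| ≤ y := by
    rw [abs_mul, abs_of_pos (by linarith : 0 < y)]
    nlinarith
  have l := abs_le.1 h2
  have l' := abs_le.1 hq
  rw [abs_le]; constructor <;> nlinarith

/-- Both quantities equal `y^{-α} (y² + (2 - α)(θ - 1/2) y)` up to `O(y^{-α})`, where `m = ⌊r⌋`, `θ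
= r - m`, `y = m + (1 - α)/2`. The weights `1 - α/2` and `α/2` are those for which the linear terms
match: the mean offset of `r` and `r - 1` from `y` is `θ - 1/2`. The relative error `O(y⁻²)` of the
partial sum costs only `O(1)` against the quadratic. -/
theorem abs_kernel_le_of_one_le {α : ℝ} (h0 : 0 < α) (h1 : α < 1) (n : ℕ) {r : ℝ} (hr : 1 ≤ r)
    (hrn : r ≤ n) :
    |Real.Gamma (3 - α) * (∑ k ∈ Finset.range (n + 1), gCoeff α k * (max (r - k) 0) ^ 2) / 2
      - ((1 - α / 2) * r ^ (2 - α) + α / 2 * (max (r - 1) 0) ^ (2 - α))| ≤ 30 * r ^ (-α) := by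
  rw [sum_gCoeff_floor (by linarith) n hrn, sum_gCoeff_mul_sq h1]
  set m := ⌊r⌋₊ with hmdef
  have hm1 : 1 ≤ m := (Nat.one_le_floor_iff r).2 hr
  have hmR : (1 : ℝ) ≤ m := by exact_mod_cast hm1
  set θ := r - m with hθ
  have hθ0 : 0 ≤ θ := by have := Nat.floor_le (by linarith : 0 ≤ r); rw [hθ]; linarith
  have hθ1 : θ < 1 := by have := Nat.lt_floor_add_one r; rw [hθ]; linarith
  obtain ⟨ρ, hρ, hρl, hρu⟩ := gSum_mul_rpow_bounds h0 h1 m hm1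
  set y := (m : ℝ) + (1 - α) / 2 with hy
  have hy1 : 1 ≤ y := by linarith
  have hy0 : 0 < y := by linarith
  rw [Gamma_three_sub h1, max_eq_left (by linarith)]
  have a1 : (1 - α) ≠ 0 := by linarith
  have a2 : (2 - α) ≠ 0 := by linarith
  have T1 := abs_rpow_add_sub_le (p := 2 - α) (y := y) (η := θ - (1 - α) / 2) (by linarith)
    (by linarith) hy0 (by linarith)
  have T2 := abs_rpow_add_sub_le (p := 2 - α) (y := y) (η := θ - (1 - α) / 2 - 1) (by linarith)
    (by linarith) hy0 (by linarith)
  have r1 : y + (θ - (1 - α) / 2) = r := by rw [hy, hθ]; ring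
  have r2 : y + (θ - (1 - α) / 2 - 1) = r - 1 := by rw [hy, hθ]; ring
  rw [r1] at T1
  rw [r2] at T2
  have e1 : y ^ (2 - α - 1) = y ^ (-α) * y := by
    rw [← Real.rpow_add_one hy0.ne']; congr 1; ring
  have e2 : y ^ (2 - α) = y ^ (-α) * y ^ 2 := by
    rw [← Real.rpow_natCast, ← Real.rpow_add hy0]; congr 1; push_cast; ring
  have e3 : y ^ (2 - α - 2) = y ^ (-α) := by congr 1; ring
  rw [e1, e2, e3] at T1 T2
  set Y := y ^ (-α) with hY
  have hY0 : 0 < Y := by positivity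
  set q0 := (1 - α) * (3 - α) / 4 + (θ - 3 / 2) * (2 - α) * ((1 - α) / 2)
    + (θ - 1) ^ 2 * (1 - α) * (2 - α) / 2 with hq0
  have eQ : (2 - α) * (1 - α) * Real.Gamma (1 - α) * (gSum α m *
      (2 * ((m : ℝ) + 1 - α) * (m + 2 - α) / ((1 - α) * (2 - α))
        + (2 * θ - 3) * (m + 1 - α) / (1 - α) + (θ - 1) ^ 2)) / 2
      = (Real.Gamma (1 - α) * gSum α m) * (y ^ 2 + (2 - α) * (θ - 1 / 2) * y + q0) := by
    rw [hq0, hy]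
    field_simp
    ring
  rw [eQ, hρ]
  have hq : |q0| ≤ 5 := by
    exact abs_kernel_const_le h0 h1 hθ0 hθ1
  have hmain : |ρ * Y * (y ^ 2 + (2 - α) * (θ - 1 / 2) * y + q0)
      - Y * (y ^ 2 + (2 - α) * (θ - 1 / 2) * y)| ≤ 12 * Y := by
    have hy2 : 1 / y ^ 2 ≤ 1 := by rw [div_le_one (by positivity)]; exact one_le_pow₀ hy1
    have d1 : |ρ - 1| ≤ 1 / y ^ 2 := by rw [abs_le]; constructor <;> linarith
    have d2 : |y ^ 2 + (2 - α) * (θ - 1 / 2) * y + q0| ≤ 7 * y ^ 2 := by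
      exact abs_kernel_poly_le h0 h1 hθ0 hθ1 hy1 hq
    have d3 : |ρ - 1| * |y ^ 2 + (2 - α) * (θ - 1 / 2) * y + q0| ≤ 7 := by
      calc _ ≤ 1 / y ^ 2 * (7 * y ^ 2) := by gcongr
        _ = 7 := by field_simp
    calc _ = Y * |(ρ - 1) * (y ^ 2 + (2 - α) * (θ - 1 / 2) * y + q0) + q0| := by
          rw [← abs_of_pos hY0, ← abs_mul, abs_of_pos hY0]; congr 1; ring
      _ ≤ Y * (7 + 5) := by
          gcongr
          refine (abs_add_le _ _).trans ?_
          rw [abs_mul]; linarith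
      _ = _ := by ring
  have hη1 : (θ - (1 - α) / 2) ^ 2 ≤ 9 / 4 :=
    (sq_le_sq' (b := 3 / 2) (by linarith) (by linarith)).trans (by norm_num)
  have hη2 : (θ - (1 - α) / 2 - 1) ^ 2 ≤ 9 / 4 :=
    (sq_le_sq' (b := 3 / 2) (by linarith) (by linarith)).trans (by norm_num)
  have T1' : |r ^ (2 - α) - (Y * y ^ 2 + (2 - α) * (θ - (1 - α) / 2) * (Y * y))| ≤ 9 / 4 * Y :=
    T1.trans (by gcongr)
  have T2' : |(r - 1) ^ (2 - α) - (Y * y ^ 2 + (2 - α) * (θ - (1 - α) / 2 - 1) * (Y * y))|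
      ≤ 9 / 4 * Y := T2.trans (by gcongr)
  have hYr : Y ≤ 2 * r ^ (-α) := by
    have hr0 : 0 < r := by linarith
    have : r / 2 ≤ y := by linarith
    calc Y ≤ (r / 2) ^ (-α) := Real.rpow_le_rpow_of_nonpos (by positivity) this (by linarith)
      _ = 2 ^ α * r ^ (-α) := by
        rw [Real.div_rpow hr0.le (by norm_num), Real.rpow_neg (by norm_num : (0 : ℝ) ≤ 2)]
        field_simp
      _ ≤ 2 ^ (1 : ℝ) * r ^ (-α) := by
        gcongr
        norm_num
      _ = _ := by simp
  have l1 := abs_le.1 T1'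
  have l2 := abs_le.1 T2'
  have l3 := abs_le.1 hmain
  have c1 : 0 ≤ 1 - α / 2 := by linarith
  have c2 : 0 ≤ α / 2 := by linarith
  have m1 := mul_le_mul_of_nonneg_left l1.1 c1
  have m2 := mul_le_mul_of_nonneg_left l1.2 c1
  have m3 := mul_le_mul_of_nonneg_left l2.1 c2
  have m4 := mul_le_mul_of_nonneg_left l2.2 c2
  rw [abs_le]
  constructor <;> linarith

/-- The Peano kernel of the time discretisation on the scale of the mesh. -/
theorem exists_abs_kernel_le {α : ℝ} (h0 : 0 < α) (h1 : α < 1) :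
    ∃ K : ℝ, 0 < K ∧ ∀ (n : ℕ) (r : ℝ), 0 < r → r ≤ n →
      |(∑ k ∈ Finset.range (n + 1), gCoeff α k * (max (r - k) 0) ^ 2) / 2
        - ((1 - α / 2) * r ^ (2 - α) + α / 2 * (max (r - 1) 0) ^ (2 - α)) / Real.Gamma (3 - α)|
        ≤ K * r ^ (-α) := by
  have hG : 0 < Real.Gamma (3 - α) := Real.Gamma_pos_of_pos (by linarith)
  refine ⟨30 / Real.Gamma (3 - α) + 1, by positivity, fun n r hr hrn => ?_⟩
  have hpos : 0 < r ^ (-α) := by positivity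
  rcases le_or_gt 1 r with h | h
  · have := abs_kernel_le_of_one_le h0 h1 n h hrn
    set S := ∑ k ∈ Finset.range (n + 1), gCoeff α k * (max (r - k) 0) ^ 2
    set B := (1 - α / 2) * r ^ (2 - α) + α / 2 * (max (r - 1) 0) ^ (2 - α)
    have e : S / 2 - B / Real.Gamma (3 - α) =
        (Real.Gamma (3 - α) * S / 2 - B) / Real.Gamma (3 - α) := by field_simp
    rw [e, abs_div, abs_of_pos hG, div_le_iff₀ hG]
    calc _ ≤ 30 * r ^ (-α) := this
      _ ≤ (30 + Real.Gamma (3 - α)) * r ^ (-α) := by gcongr; linarith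
      _ = _ := by field_simp
  -- For `r < 1` only `k = 0` survives; everything is bounded, and `r^{-α} ≥ 1`.
  · rw [sum_gCoeff_floor hr.le n hrn, Nat.floor_eq_zero.2 h]
    have hra : 1 ≤ r ^ (-α) := Real.one_le_rpow_of_pos_of_le_one_of_nonpos hr h.le (by linarith)
    have hr2 : r ^ (2 - α) ≤ 1 := Real.rpow_le_one hr.le h.le (by linarith)
    have hr2' : 0 < r ^ (2 - α) := by positivity
    simp only [zero_add, Finset.range_one, Finset.sum_singleton, gCoeff_zero, Nat.cast_zero,
      sub_zero, one_mul]
    rw [max_eq_right (by linarith), Real.zero_rpow (by linarith)]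
    have b1 : ((1 - α / 2) * r ^ (2 - α) + α / 2 * 0) / Real.Gamma (3 - α)
        ≤ 30 / Real.Gamma (3 - α) := by gcongr; nlinarith
    have b2 : 0 ≤ ((1 - α / 2) * r ^ (2 - α) + α / 2 * 0) / Real.Gamma (3 - α) := by
      apply div_nonneg _ hG.le; nlinarith
    have b3 : r ^ 2 ≤ 1 := by nlinarith
    have b4 : 0 ≤ r ^ 2 := by positivity
    have b5 : 30 / Real.Gamma (3 - α) + 1 ≤ (30 / Real.Gamma (3 - α) + 1) * r ^ (-α) := by
      have : 0 < 30 / Real.Gamma (3 - α) + 1 := by positivity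
      nlinarith
    rw [abs_le]
    constructor <;> nlinarith

/-! ### Fourier inversion and the regularity of the zero extension. -/

open FourierTransform in
theorem fourier_eq_fourierHat (f : ℝ → ℝ) (w : ℝ) :
    𝓕 (fun t => (f t : ℂ)) w = fourierHat f (-(2 * Real.pi) * w) := by
  rw [Real.fourier_real_eq_integral_exp_smul]
  unfold fourierHat
  refine integral_congr_ae (Filter.Eventually.of_forall fun t => ?_)
  simp only [smul_eq_mul]
  congr 2
  push_cast
  ring

open FourierTransform in
theorem continuous_fourier {f : ℝ → ℂ} (hf : Integrable f) : Continuous (𝓕 f) :=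
  VectorFourier.fourierIntegral_continuous (μ := volume) (L := innerₗ ℝ)
    (e := Real.fourierChar) Real.continuous_fourierChar continuous_inner hf

-- Moments of the transform up to order two are what two derivatives of the inverse transform need;
-- the dilation by `-2π` passes between the two normalisations.
open FourierTransform in
theorem integrable_pow_mul_fourier {β : ℝ} (hβ : 2 ≤ β) {f : ℝ → ℝ} (hf : MemFourierClass β f)
    (n : ℕ) (hn : n ≤ 2) :
    Integrable fun w : ℝ => ‖w‖ ^ n * ‖𝓕 (fun t => (f t : ℂ)) w‖ := by
  have hfc : Integrable fun t => (f t : ℂ) := hf.1.ofReal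
  have hcont : Continuous (𝓕 (fun t => (f t : ℂ))) := by
    exact continuous_fourier hfc
  have h := hf.2.comp_mul_left' (R := -(2 * Real.pi)) (by simp [Real.pi_ne_zero])
  refine h.mono' (by fun_prop) (Filter.Eventually.of_forall fun w => ?_)
  rw [fourier_eq_fourierHat]
  simp only [norm_mul, norm_pow, norm_norm]
  gcongr
  have h1 : ‖w‖ ≤ 1 + |-(2 * Real.pi) * w| := by
    rw [abs_mul, abs_neg, abs_of_pos (by positivity), Real.norm_eq_abs]
    nlinarith [Real.pi_gt_three, abs_nonneg w]
  have h2 : 1 ≤ 1 + |-(2 * Real.pi) * w| := by linarith [abs_nonneg (-(2 * Real.pi) * w)]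
  calc ‖w‖ ^ n ≤ (1 + |-(2 * Real.pi) * w|) ^ n := by gcongr
    _ = (1 + |-(2 * Real.pi) * w|) ^ (n : ℝ) := (Real.rpow_natCast _ _).symm
    _ ≤ (1 + |-(2 * Real.pi) * w|) ^ β := by
      apply Real.rpow_le_rpow_of_exponent_le h2
      have : (n : ℝ) ≤ 2 := by exact_mod_cast hn
      linarith

open FourierTransform in
theorem integral_fourier_mul_eq {f g : ℝ → ℂ} (hf : Integrable f) (hg : Integrable g) :
    ∫ ξ, 𝓕 f ξ * g ξ = ∫ x, f x * 𝓕 g x := by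
  have := VectorFourier.integral_fourierIntegral_smul_eq_flip (L := innerₗ ℝ) (μ := volume)
    (ν := volume) (e := Real.fourierChar) Real.continuous_fourierChar
    continuous_inner hf hg
  simp only [smul_eq_mul] at this
  rw [flip_innerₗ] at this
  exact this

open FourierTransform in
/-- An integrable function with integrable Fourier transform agrees almost everywhere with the
inverse transform of its Fourier transform. -/
theorem ae_eq_fourierInv_fourier {f : ℝ → ℂ} (hf : Integrable f) (hF : Integrable (𝓕 f)) :
    f =ᵐ[volume] 𝓕⁻ (𝓕 f) := by
  have hcont : Continuous (𝓕⁻ (𝓕 f)) := by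
    have := continuous_fourier hF
    have h2 : 𝓕⁻ (𝓕 f) = fun x => 𝓕 (𝓕 f) (-x) := by
      ext x; rw [Real.fourierInv_eq_fourier_neg]
    rw [h2]
    exact Continuous.comp (g := 𝓕 (𝓕 f)) this continuous_neg
  refine ae_eq_of_integral_contDiff_smul_eq hf.locallyIntegrable hcont.locallyIntegrable
    fun φ hφ hφc => ?_
  have hφ1 : HasCompactSupport (Complex.ofRealCLM ∘ φ) := hφc.comp_left rfl
  have hφ2 : ContDiff ℝ (⊤ : ℕ∞) (Complex.ofRealCLM ∘ φ) := Complex.ofRealCLM.contDiff.comp hφ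
  -- The test function is the transform of a Schwartz function `Ψ`, itself a transform; moving the
  -- transform across the integral twice turns the pairing with `f` into one with `𝓕 (𝓕 f)`,
  -- reflected.
  let Φ : SchwartzMap ℝ ℂ := hφ1.toSchwartzMap hφ2
  let Ψ : SchwartzMap ℝ ℂ := 𝓕⁻ Φ
  have hΦ : ∀ x, Φ x = (φ x : ℂ) := fun x => rfl
  have hΨ : (Φ : ℝ → ℂ) = 𝓕 (Ψ : ℝ → ℂ) := by
    rw [← SchwartzMap.fourier_coe]; simp [Ψ]
  have hΨ2 : (Ψ : ℝ → ℂ) = 𝓕 (fun x => Φ (-x)) := by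
    rw [← Real.fourierInv_eq_fourier_comp_neg, ← SchwartzMap.fourierInv_coe]
  have i1 : Integrable (fun x => Φ (-x)) := Φ.integrable.comp_neg
  calc ∫ x, φ x • f x = ∫ x, 𝓕 (Ψ : ℝ → ℂ) x * f x := by
        rw [← hΨ]; simp [hΦ]
    _ = ∫ x, Ψ x * 𝓕 f x := integral_fourier_mul_eq Ψ.integrable hf
    _ = ∫ x, 𝓕 (fun x => Φ (-x)) x * 𝓕 f x := by rw [hΨ2]
    _ = ∫ x, Φ (-x) * 𝓕 (𝓕 f) x := integral_fourier_mul_eq i1 hF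
    _ = ∫ x, Φ x * 𝓕 (𝓕 f) (-x) := by
        rw [← integral_neg_eq_self]; simp
    _ = _ := by
        refine integral_congr_ae (Filter.Eventually.of_forall fun x => ?_)
        simp [hΦ, Real.fourierInv_eq_fourier_neg]

-- Applied to a zero extension, this forces the value and the first two derivatives to vanish at
-- time zero, the compatibility that second-order accuracy up to `t = 0` rests on.
open FourierTransform in
theorem MemFourierClass.exists_contDiff {β : ℝ} (hβ : 2 ≤ β) {f : ℝ → ℝ}
    (hf : MemFourierClass β f) : ∃ g : ℝ → ℝ, ContDiff ℝ 2 g ∧ f =ᵐ[volume] g := by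
  have hF := integrable_pow_mul_fourier hβ hf
  have hcd : ContDiff ℝ 2 (𝓕 (𝓕 (fun t => (f t : ℂ)))) := by
    have := Real.contDiff_fourier (f := 𝓕 (fun t => (f t : ℂ))) (N := 2)
      (fun n hn => hF n (by exact_mod_cast hn))
    exact_mod_cast this
  have hfc : Integrable fun t => (f t : ℂ) := hf.1.ofReal
  have hFI : Integrable (𝓕 (fun t => (f t : ℂ))) := by
    have h0 := hF 0 (by norm_num)
    simp only [pow_zero, one_mul] at h0
    refine (integrable_norm_iff ?_).1 h0
    exact (continuous_fourier hfc).aestronglyMeasurable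
  refine ⟨fun x => Complex.reCLM (𝓕⁻ (𝓕 (fun t => (f t : ℂ))) x), ?_, ?_⟩
  · have : 𝓕⁻ (𝓕 (fun t => (f t : ℂ))) = fun x => 𝓕 (𝓕 (fun t => (f t : ℂ))) (-x) := by
      ext x; rw [Real.fourierInv_eq_fourier_neg]
    rw [this]
    exact Complex.reCLM.contDiff.comp (hcd.comp contDiff_neg)
  · filter_upwards [ae_eq_fourierInv_fourier hfc hFI] with x hx
    rw [← hx]; simp

/-! ### Fractional integrals and derivatives of causal functions. -/

theorem intervalIntegrable_sub_rpow {r : ℝ} (hr : -1 < r) (t a b : ℝ) :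
    IntervalIntegrable (fun s => (t - s) ^ r) volume a b := by
  have := (intervalIntegral.intervalIntegrable_rpow' (a := t - a) (b := t - b) hr).comp_sub_left t
  simpa using this

theorem integral_sub_rpow {r t : ℝ} (hr : -1 < r) :
    ∫ s in (0 : ℝ)..t, (t - s) ^ r = t ^ (r + 1) / (r + 1) := by
  rw [intervalIntegral.integral_comp_sub_left (fun x => x ^ r) t, integral_rpow (Or.inl hr)]
  simp [Real.zero_rpow (by linarith : r + 1 ≠ 0)]

/-- Integration by parts against a power of the distance to the right end point. -/
theorem integral_mul_sub_rpow {f f' : ℝ → ℝ} {t r : ℝ} (ht : 0 ≤ t) (hr : -1 < r)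
    (hf : ContinuousOn f (Icc 0 t)) (hf' : ContinuousOn f' (Icc 0 t)) (h0 : f 0 = 0)
    (hd : ∀ s ∈ Ioo 0 t, HasDerivAt f (f' s) s) :
    ∫ s in (0 : ℝ)..t, f s * (t - s) ^ r = (r + 1)⁻¹ * ∫ s in (0 : ℝ)..t, f' s * (t - s) ^ (r + 1) := by
  have hr1 : 0 < r + 1 := by linarith
  have hv : ContinuousOn (fun s : ℝ => -((t - s) ^ (r + 1) / (r + 1))) (uIcc 0 t) := by
    have : Continuous fun s : ℝ => -((t - s) ^ (r + 1) / (r + 1)) := by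
      refine ((Continuous.rpow_const (by fun_prop) fun _ => Or.inr hr1.le).div_const _).neg
    exact this.continuousOn
  have hv' : ∀ s ∈ Ioo (min 0 t) (max 0 t),
      HasDerivAt (fun s : ℝ => -((t - s) ^ (r + 1) / (r + 1))) ((t - s) ^ r) s := by
    intro s hs
    rw [min_eq_left ht, max_eq_right ht] at hs
    have h1 : HasDerivAt (fun s : ℝ => t - s) (-1) s := by
      simpa using (hasDerivAt_id s).const_sub t
    have h2 := (h1.rpow_const (p := r + 1) (Or.inl (by linarith [hs.2]))).div_const (r + 1) |>.neg
    have e : (t - s) ^ r = -(-1 * (r + 1) * (t - s) ^ (r + 1 - 1) / (r + 1)) := by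
      rw [show r + 1 - 1 = r by ring]
      field_simp
    rw [e]
    exact h2
  have key := intervalIntegral.integral_mul_deriv_eq_deriv_mul_of_hasDerivAt
    (u := f) (u' := f') (a := 0) (b := t) (by rwa [uIcc_of_le ht]) hv
    (by rwa [min_eq_left ht, max_eq_right ht]) hv'
    (by apply ContinuousOn.intervalIntegrable; rwa [uIcc_of_le ht])
    (intervalIntegrable_sub_rpow hr t 0 t)
  rw [key, h0, sub_self, Real.zero_rpow hr1.ne']
  simp only [mul_neg, neg_zero, mul_zero, zero_div, zero_mul, sub_zero, zero_sub,
    intervalIntegral.integral_neg, neg_neg]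
  rw [← intervalIntegral.integral_const_mul]
  refine intervalIntegral.integral_congr fun s _ => ?_
  field_simp

/-- A function on the line that vanishes for negative times, with two continuous derivatives, and
with a continuous third derivative `F₃` on `[0, T]`. -/
structure CausalC3 (T : ℝ) (F F₃ : ℝ → ℝ) : Prop where
  contDiff : ContDiff ℝ 2 F
  eq_zero : ∀ t ≤ 0, F t = 0
  cont : ContinuousOn F₃ (Icc 0 T)
  hasDerivAt : ∀ t ∈ Ioo 0 T, HasDerivAt (deriv (deriv F)) (F₃ t) t

namespace CausalC3

variable {T : ℝ} {F F₃ : ℝ → ℝ}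

theorem contDiff_deriv (h : CausalC3 T F F₃) : ContDiff ℝ 1 (deriv F) := by
  have := h.contDiff
  rw [show (2 : WithTop ℕ∞) = 1 + 1 by norm_num, contDiff_succ_iff_deriv] at this
  exact this.2.2

theorem continuous_deriv (h : CausalC3 T F F₃) : Continuous (deriv F) :=
  h.contDiff_deriv.continuous

theorem continuous_deriv2 (h : CausalC3 T F F₃) : Continuous (deriv (deriv F)) := by
  have := h.contDiff_deriv
  rw [contDiff_one_iff_deriv] at this
  exact this.2

theorem hasDerivAt_self (h : CausalC3 T F F₃) (t : ℝ) : HasDerivAt F (deriv F t) t :=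
  (h.contDiff.differentiable (by norm_num) t).hasDerivAt

theorem hasDerivAt_deriv (h : CausalC3 T F F₃) (t : ℝ) :
    HasDerivAt (deriv F) (deriv (deriv F) t) t :=
  (h.contDiff_deriv.differentiable (by norm_num) t).hasDerivAt

/-- For `t < 0` the function is locally zero; continuity of the derivative carries this to `t = 0`.
-/
theorem _root_.TFSDE.deriv_eq_zero_of_nonpos {G : ℝ → ℝ} (hG : ∀ t ≤ 0, G t = 0)
    (hc : Continuous (deriv G)) : ∀ t ≤ 0, deriv G t = 0 := by
  have h1 : ∀ t < 0, deriv G t = 0 := fun t ht => by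
    have : G =ᶠ[nhds t] fun _ => 0 := by
      filter_upwards [Iio_mem_nhds ht] with s hs using hG s (le_of_lt hs)
    rw [this.deriv_eq]; simp
  have h2 : IsClosed {t | deriv G t = 0} := isClosed_eq hc continuous_const
  have h3 : closure (Iio (0 : ℝ)) ⊆ {t | deriv G t = 0} := h2.closure_subset_iff.2 h1
  rw [closure_Iio] at h3
  exact h3

theorem deriv_eq_zero (h : CausalC3 T F F₃) : ∀ t ≤ 0, deriv F t = 0 :=
  deriv_eq_zero_of_nonpos h.eq_zero h.continuous_deriv

theorem deriv2_eq_zero (h : CausalC3 T F F₃) : ∀ t ≤ 0, deriv (deriv F) t = 0 :=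
  deriv_eq_zero_of_nonpos h.deriv_eq_zero h.continuous_deriv2

/-- Taylor's formula at the origin with the integral form of the remainder. -/
theorem eq_integral (h : CausalC3 T F F₃) {x t : ℝ} (hx : 0 ≤ x) (hxt : x ≤ t) (htT : t ≤ T) :
    F x = ∫ s in (0 : ℝ)..t, (max (x - s) 0) ^ 2 / 2 * F₃ s := by
  have e0 : F x = ∫ s in (0 : ℝ)..x, deriv F s := by
    rw [intervalIntegral.integral_eq_sub_of_hasDerivAt (fun s _ => h.hasDerivAt_self s)
      (h.continuous_deriv.intervalIntegrable _ _), h.eq_zero 0 le_rfl, sub_zero]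
  have e1 := integral_mul_sub_rpow (r := 0) hx (by norm_num) h.continuous_deriv.continuousOn
    h.continuous_deriv2.continuousOn (h.deriv_eq_zero 0 le_rfl) (fun s _ => h.hasDerivAt_deriv s)
  have e2 := integral_mul_sub_rpow (f' := F₃) (r := 0 + 1) hx (by norm_num)
    h.continuous_deriv2.continuousOn (h.cont.mono (Icc_subset_Icc_right (hxt.trans htT)))
    (h.deriv2_eq_zero 0 le_rfl)
    (fun s hs => h.hasDerivAt s ⟨hs.1, hs.2.trans_le (hxt.trans htT)⟩)
  rw [e2] at e1
  simp only [Real.rpow_zero, mul_one] at e1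
  have hc : ContinuousOn (fun s => (max (x - s) 0) ^ 2 / 2 * F₃ s) (Icc 0 T) := by
    have : Continuous fun s : ℝ => (max (x - s) 0) ^ 2 / 2 := by fun_prop
    exact this.continuousOn.mul h.cont
  have hi1 : IntervalIntegrable (fun s => (max (x - s) 0) ^ 2 / 2 * F₃ s) volume 0 x := by
    apply ContinuousOn.intervalIntegrable
    rw [uIcc_of_le hx]; exact hc.mono (Icc_subset_Icc_right (hxt.trans htT))
  have hi2 : IntervalIntegrable (fun s => (max (x - s) 0) ^ 2 / 2 * F₃ s) volume x t := by
    apply ContinuousOn.intervalIntegrable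
    rw [uIcc_of_le hxt]; exact hc.mono (Icc_subset_Icc hx htT)
  rw [e0, e1, ← intervalIntegral.integral_add_adjacent_intervals hi1 hi2]
  have z : ∫ s in x..t, (max (x - s) 0) ^ 2 / 2 * F₃ s = 0 := by
    rw [intervalIntegral.integral_congr (g := fun _ => 0), intervalIntegral.integral_zero]
    intro s hs
    rw [uIcc_of_le hxt] at hs
    simp only
    rw [max_eq_right (by linarith [hs.1])]; simp
  rw [z, add_zero, ← intervalIntegral.integral_const_mul, ← intervalIntegral.integral_const_mul]
  refine intervalIntegral.integral_congr fun s hs => ?_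
  rw [uIcc_of_le hx] at hs
  rw [max_eq_left (by linarith [hs.2]), show (0 : ℝ) + 1 + 1 = (2 : ℕ) by norm_num,
    Real.rpow_natCast]
  norm_num
  ring

/-- After the substitution `s = t - ξ`, causality permits a fixed upper limit. Then `t` occurs only
in the smooth factor, and one can differentiate under the integral without a boundary term. -/
theorem integral_eq_of_le (h : ∀ t ≤ 0, F t = 0) (hc : Continuous F) {α t B : ℝ} (hα : α < 1)
    (htB : t ≤ B) :
    ∫ ξ in (0 : ℝ)..t, F ξ * (t - ξ) ^ (-α) = ∫ s in (0 : ℝ)..B, F (t - s) * s ^ (-α) := by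
  have e : ∫ ξ in (0 : ℝ)..t, F ξ * (t - ξ) ^ (-α) = ∫ s in (0 : ℝ)..t, F (t - s) * s ^ (-α) := by
    have := intervalIntegral.integral_comp_sub_left (a := 0) (b := t)
      (fun s => F (t - s) * s ^ (-α)) t
    simpa using this
  have hi : ∀ a b : ℝ, IntervalIntegrable (fun s => F (t - s) * s ^ (-α)) volume a b := fun a b =>
    (intervalIntegral.intervalIntegrable_rpow' (by linarith)).continuousOn_mul
      (hc.comp (continuous_const.sub continuous_id)).continuousOn
  rw [e, ← intervalIntegral.integral_add_adjacent_intervals (hi 0 t) (hi t B)]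
  have z : ∫ s in t..B, F (t - s) * s ^ (-α) = 0 := by
    rw [intervalIntegral.integral_congr (g := fun _ => 0), intervalIntegral.integral_zero]
    intro s hs
    rw [uIcc_of_le htB] at hs
    simp only
    rw [h _ (by linarith [hs.1]), zero_mul]
  rw [z, add_zero]

/-- The derivative of a fractional integral of a causal function. -/
theorem hasDerivAt_integral (h : CausalC3 T F F₃) {α t : ℝ} (hα : α < 1) (ht : 0 < t)
    (htT : t ≤ T) :
    HasDerivAt (fun t => ∫ ξ in (0 : ℝ)..t, F ξ * (t - ξ) ^ (-α))
      (((1 - α) * (2 - α))⁻¹ * ∫ s in (0 : ℝ)..t, F₃ s * (t - s) ^ (2 - α)) t := by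
  have hcF : Continuous F := h.contDiff.continuous
  obtain ⟨C, hC⟩ := (isCompact_Icc (a := -(T + 1)) (b := T + 1)).exists_bound_of_continuousOn
    h.continuous_deriv.continuousOn
  have hrp : IntervalIntegrable (fun s : ℝ => s ^ (-α)) volume 0 (T + 1) :=
    intervalIntegral.intervalIntegrable_rpow' (by linarith)
  have hmeas : ∀ G : ℝ → ℝ, Continuous G → ∀ x : ℝ, IntervalIntegrable
      (fun s => G (x - s) * s ^ (-α)) volume 0 (T + 1) := fun G hG x =>
    hrp.continuousOn_mul (hG.comp (continuous_const.sub continuous_id)).continuousOn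
  have key := intervalIntegral.hasDerivAt_integral_of_dominated_loc_of_deriv_le (μ := volume)
    (a := 0) (b := T + 1) (x₀ := t) (F := fun x s => F (x - s) * s ^ (-α))
    (F' := fun x s => deriv F (x - s) * s ^ (-α)) (bound := fun s => C * s ^ (-α))
    (s := Ioo 0 (T + 1)) (Ioo_mem_nhds ht (by linarith))
    (Filter.Eventually.of_forall fun x => by
      have := hmeas F hcF x
      exact (intervalIntegrable_iff.1 this).aestronglyMeasurable)
    (hmeas F hcF t)
    (intervalIntegrable_iff.1 (hmeas _ h.continuous_deriv t)).aestronglyMeasurable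
    (Filter.Eventually.of_forall fun s hs x hx => by
      rw [uIoc_of_le (by linarith)] at hs
      have hs' : 0 ≤ s ^ (-α) := Real.rpow_nonneg hs.1.le _
      rw [norm_mul, Real.norm_of_nonneg hs']
      refine mul_le_mul_of_nonneg_right (hC _ ⟨?_, ?_⟩) hs'
      · linarith [hs.2, hx.1]
      · linarith [hs.1, hx.2])
    (hrp.const_mul C)
    (Filter.Eventually.of_forall fun s _ x _ => by
      have h1 : HasDerivAt (fun x : ℝ => x - s) 1 x := (hasDerivAt_id x).sub_const s
      have := ((h.hasDerivAt_self (x - s)).comp x h1).mul_const (s ^ (-α))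
      simpa using this)
  have hd := key.2
  have e1 := integral_eq_of_le h.deriv_eq_zero h.continuous_deriv hα
    (by linarith : t ≤ T + 1)
  -- Two integrations by parts, free of boundary terms because `F'` and `F''` vanish at zero, raise
  -- the exponent from `-α` to `2 - α`.
  have e2 := integral_mul_sub_rpow (r := -α) ht.le (by linarith) h.continuous_deriv.continuousOn
    h.continuous_deriv2.continuousOn (h.deriv_eq_zero 0 le_rfl) (fun s _ => h.hasDerivAt_deriv s)
  have e3 := integral_mul_sub_rpow (f' := F₃) (r := -α + 1) ht.le (by linarith)
    h.continuous_deriv2.continuousOn (h.cont.mono (Icc_subset_Icc_right htT))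
    (h.deriv2_eq_zero 0 le_rfl)
    (fun s hs => h.hasDerivAt s ⟨hs.1, hs.2.trans_le htT⟩)
  rw [← e1, e2, e3] at hd
  have e4 : (-α + 1)⁻¹ * ((-α + 1 + 1)⁻¹ * ∫ s in (0 : ℝ)..t, F₃ s * (t - s) ^ (-α + 1 + 1))
      = ((1 - α) * (2 - α))⁻¹ * ∫ s in (0 : ℝ)..t, F₃ s * (t - s) ^ (2 - α) := by
    rw [← mul_assoc, ← mul_inv, show -α + 1 + 1 = 2 - α by ring, show -α + 1 = 1 - α by ring]
  rw [e4] at hd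
  refine hd.congr_of_eventuallyEq ?_
  filter_upwards [Ioo_mem_nhds ht (by linarith : t < T + 1)] with x hx
  exact integral_eq_of_le h.eq_zero hcF hα hx.2.le

end CausalC3

/-- The fractional derivative of order `α` of a causal function, in terms of its third derivative. -/
def causalFrac (α : ℝ) (F₃ : ℝ → ℝ) (t : ℝ) : ℝ :=
  (Real.Gamma (3 - α))⁻¹ * ∫ s in (0 : ℝ)..t, F₃ s * (t - s) ^ (2 - α)

theorem continuous_max_rpow {p : ℝ} (hp : 0 ≤ p) (x : ℝ) :
    Continuous fun s : ℝ => (max (x - s) 0) ^ p :=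
  Continuous.rpow_const (by fun_prop) fun _ => Or.inr hp

/-- Values at different times become integrals over one common interval, so that they can be
combined under the integral sign. -/
theorem causalFrac_eq {α : ℝ} (h1 : α < 1) {T : ℝ} {F₃ : ℝ → ℝ} (hc : ContinuousOn F₃ (Icc 0 T))
    {x t : ℝ} (hx : 0 ≤ x) (hxt : x ≤ t) (htT : t ≤ T) :
    causalFrac α F₃ x =
      ∫ s in (0 : ℝ)..t, (max (x - s) 0) ^ (2 - α) / Real.Gamma (3 - α) * F₃ s := by
  have hc' : ContinuousOn (fun s => (max (x - s) 0) ^ (2 - α) / Real.Gamma (3 - α) * F₃ s)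
      (Icc 0 T) :=
    ((continuous_max_rpow (by linarith) x).div_const _).continuousOn.mul hc
  have hi1 : IntervalIntegrable
      (fun s => (max (x - s) 0) ^ (2 - α) / Real.Gamma (3 - α) * F₃ s) volume 0 x := by
    apply ContinuousOn.intervalIntegrable
    rw [uIcc_of_le hx]; exact hc'.mono (Icc_subset_Icc_right (hxt.trans htT))
  have hi2 : IntervalIntegrable
      (fun s => (max (x - s) 0) ^ (2 - α) / Real.Gamma (3 - α) * F₃ s) volume x t := by
    apply ContinuousOn.intervalIntegrable
    rw [uIcc_of_le hxt]; exact hc'.mono (Icc_subset_Icc hx htT)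
  rw [← intervalIntegral.integral_add_adjacent_intervals hi1 hi2]
  have z : ∫ s in x..t, (max (x - s) 0) ^ (2 - α) / Real.Gamma (3 - α) * F₃ s = 0 := by
    rw [intervalIntegral.integral_congr (g := fun _ => 0), intervalIntegral.integral_zero]
    intro s hs
    rw [uIcc_of_le hxt] at hs
    simp only
    rw [max_eq_right (by linarith [hs.1]), Real.zero_rpow (by linarith)]; simp
  rw [z, add_zero, causalFrac, ← intervalIntegral.integral_const_mul]
  refine intervalIntegral.integral_congr fun s hs => ?_
  rw [uIcc_of_le hx] at hs
  rw [max_eq_left (by linarith [hs.2])]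
  ring

theorem rpow_sub_rpow_le {p x y : ℝ} (hp1 : 1 ≤ p) (hy : 0 ≤ y) (hyx : y ≤ x) :
    x ^ p - y ^ p ≤ p * x ^ (p - 1) * (x - y) := by
  rcases hy.trans hyx |>.eq_or_lt with h | h
  · have : y = 0 := by linarith
    rw [this, ← h]; simp
  · have hb := one_add_mul_self_le_rpow_one_add (s := y / x - 1)
      (by have := div_nonneg hy h.le; linarith) hp1
    rw [add_sub_cancel, Real.div_rpow hy h.le, le_div_iff₀ (by positivity)] at hb
    have e : x ^ p = x ^ (p - 1) * x := by rw [← Real.rpow_add_one h.ne']; congr 1; ring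
    have e2 : (1 + p * (y / x - 1)) * x ^ p = x ^ p - p * x ^ (p - 1) * (x - y) := by
      rw [e]; field_simp; ring
    linarith

section Bounds

variable {α T B t : ℝ} {F₃ : ℝ → ℝ}

theorem abs_causalFrac_le (h1 : α < 1) (hB : ∀ s ∈ Icc 0 T, |F₃ s| ≤ B)
    (ht : 0 ≤ t) (htT : t ≤ T) :
    |causalFrac α F₃ t| ≤ (Real.Gamma (3 - α))⁻¹ * (B * T ^ (2 - α) * T) := by
  have hG : 0 < Real.Gamma (3 - α) := Real.Gamma_pos_of_pos (by linarith)
  have hT : 0 ≤ T := ht.trans htT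
  have hB0 : 0 ≤ B := (abs_nonneg _).trans (hB 0 ⟨le_rfl, hT⟩)
  rw [causalFrac, abs_mul, abs_of_pos (inv_pos.2 hG)]
  gcongr
  have := intervalIntegral.norm_integral_le_of_norm_le_const (a := 0) (b := t)
    (f := fun s => F₃ s * (t - s) ^ (2 - α)) (C := B * T ^ (2 - α)) (fun s hs => by
      rw [uIoc_of_le ht] at hs
      rw [norm_mul, Real.norm_eq_abs, Real.norm_of_nonneg (Real.rpow_nonneg (by linarith [hs.2]) _)]
      have := hB s ⟨hs.1.le, hs.2.trans htT⟩
      have k : (t - s) ^ (2 - α) ≤ T ^ (2 - α) :=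
        Real.rpow_le_rpow (by linarith [hs.2]) (by linarith [hs.1]) (by linarith)
      exact mul_le_mul this k (Real.rpow_nonneg (by linarith [hs.2]) _) hB0)
  rw [sub_zero, abs_of_nonneg ht] at this
  refine this.trans ?_
  gcongr

theorem abs_causalFrac_sub_le (h0 : 0 < α) (h1 : α < 1) (hc : ContinuousOn F₃ (Icc 0 T))
    (hB : ∀ s ∈ Icc 0 T, |F₃ s| ≤ B) {τ : ℝ} (hτ : 0 ≤ τ) (hτt : τ ≤ t) (htT : t ≤ T) :
    |causalFrac α F₃ t - causalFrac α F₃ (t - τ)|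
      ≤ 2 * (Real.Gamma (3 - α))⁻¹ * (B * T ^ (1 - α) * T) * τ := by
  have hG : 0 < Real.Gamma (3 - α) := Real.Gamma_pos_of_pos (by linarith)
  have ht : 0 ≤ t := hτ.trans hτt
  have hT : 0 ≤ T := ht.trans htT
  have hB0 : 0 ≤ B := (abs_nonneg _).trans (hB 0 ⟨le_rfl, hT⟩)
  have hint : ∀ x : ℝ, IntervalIntegrable
      (fun s => (max (x - s) 0) ^ (2 - α) / Real.Gamma (3 - α) * F₃ s) volume 0 t := fun x => by
    apply ContinuousOn.intervalIntegrable
    rw [uIcc_of_le ht]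
    exact ((continuous_max_rpow (by linarith) x).div_const _).continuousOn.mul
      (hc.mono (Icc_subset_Icc_right htT))
  rw [causalFrac_eq h1 hc ht le_rfl htT, causalFrac_eq h1 hc (by linarith : 0 ≤ t - τ)
    (by linarith) htT, ← intervalIntegral.integral_sub (hint _) (hint _)]
  have := intervalIntegral.norm_integral_le_of_norm_le_const (a := 0) (b := t)
    (f := fun s => (max (t - s) 0) ^ (2 - α) / Real.Gamma (3 - α) * F₃ s
      - (max (t - τ - s) 0) ^ (2 - α) / Real.Gamma (3 - α) * F₃ s)
    (C := (Real.Gamma (3 - α))⁻¹ * (2 * T ^ (1 - α) * τ) * B) (fun s hs => by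
      rw [uIoc_of_le ht] at hs
      have hm : max (t - τ - s) 0 ≤ t - s := max_le (by linarith) (by linarith [hs.2])
      have hm0 : 0 ≤ max (t - τ - s) 0 := le_max_right _ _
      have hm' : t - s - τ ≤ max (t - τ - s) 0 := by
        refine le_trans ?_ (le_max_left _ _); linarith
      have k1 := rpow_sub_rpow_le (p := 2 - α) (by linarith) hm0 hm
      have k2 := Real.rpow_le_rpow hm0 hm (by linarith : 0 ≤ 2 - α)
      rw [max_eq_left (by linarith [hs.2] : 0 ≤ t - s), ← sub_mul, ← sub_div, norm_mul,
        Real.norm_eq_abs (F₃ s), Real.norm_of_nonneg (div_nonneg (by linarith) hG.le),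
        div_eq_inv_mul]
      have := hB s ⟨hs.1.le, hs.2.trans htT⟩
      have k3 : (t - s) ^ (2 - α) - (max (t - τ - s) 0) ^ (2 - α) ≤ 2 * T ^ (1 - α) * τ := by
        refine k1.trans ?_
        have k4 : (t - s) ^ (2 - α - 1) ≤ T ^ (1 - α) := by
          rw [show 2 - α - 1 = 1 - α by ring]
          exact Real.rpow_le_rpow (by linarith [hs.2]) (by linarith [hs.1]) (by linarith)
        have k5 : 0 ≤ (t - s) ^ (2 - α - 1) := Real.rpow_nonneg (by linarith [hs.2]) _
        have k6 : 0 ≤ t - s - max (t - τ - s) 0 := by linarith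
        have k7 : (2 - α) * (t - s) ^ (2 - α - 1) ≤ 2 * T ^ (1 - α) :=
          mul_le_mul (by linarith) k4 k5 (by norm_num)
        exact mul_le_mul k7 (by linarith) k6 (by positivity)
      refine mul_le_mul ?_ this (abs_nonneg _) (by positivity)
      exact mul_le_mul_of_nonneg_left k3 (inv_pos.2 hG).le)
  rw [sub_zero, abs_of_nonneg ht] at this
  refine this.trans ?_
  calc (Real.Gamma (3 - α))⁻¹ * (2 * T ^ (1 - α) * τ) * B * t
      ≤ (Real.Gamma (3 - α))⁻¹ * (2 * T ^ (1 - α) * τ) * B * T := by gcongr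
    _ = _ := by ring

end Bounds

/-! ### Second-order accuracy in time. -/

/-- The Peano kernel of the time discretisation with step `τ`. -/
def timeKernel (α τ : ℝ) (n : ℕ) (x : ℝ) : ℝ :=
  (τ ^ α)⁻¹ * ∑ k ∈ Finset.range (n + 1), gCoeff α k * ((max (x - k * τ) 0) ^ 2 / 2)
    - ((1 - α / 2) * ((max x 0) ^ (2 - α) / Real.Gamma (3 - α))
      + α / 2 * ((max (x - τ) 0) ^ (2 - α) / Real.Gamma (3 - α)))

/-- By homogeneity the kernel is `τ^(2-α)` times the unit-step kernel at `x/τ`, and `τ^(2-α)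
(x/τ)^{-α} = τ² x^{-α}`. -/
theorem exists_abs_timeKernel_le {α : ℝ} (h0 : 0 < α) (h1 : α < 1) :
    ∃ K : ℝ, 0 < K ∧ ∀ (τ : ℝ) (n : ℕ) (x : ℝ), 0 < τ → 0 < x → x ≤ n * τ →
      |timeKernel α τ n x| ≤ K * τ ^ 2 * x ^ (-α) := by
  obtain ⟨K, hK, h⟩ := exists_abs_kernel_le h0 h1
  refine ⟨K, hK, fun τ n x hτ hx hxn => ?_⟩
  have hr : 0 < x / τ := by positivity
  have key := h n (x / τ) hr (by rwa [div_le_iff₀ hτ])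
  have e0 : ∀ c : ℝ, max (x - c * τ) 0 = τ * max (x / τ - c) 0 := fun c => by
    rw [mul_max_of_nonneg _ _ hτ.le, mul_zero, mul_sub, mul_div_cancel₀ _ hτ.ne', mul_comm c]
  have e1 : max (x - τ) 0 = τ * max (x / τ - 1) 0 := by simpa using e0 1
  have e2 : x = τ * (x / τ) := by field_simp
  have hp : (τ ^ α)⁻¹ * τ ^ 2 = τ ^ (2 - α) := by
    rw [Real.rpow_sub hτ, Real.rpow_two]; field_simp
  have e3 : timeKernel α τ n x = τ ^ (2 - α) *
      ((∑ k ∈ Finset.range (n + 1), gCoeff α k * (max (x / τ - k) 0) ^ 2) / 2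
        - ((1 - α / 2) * (x / τ) ^ (2 - α) + α / 2 * (max (x / τ - 1) 0) ^ (2 - α))
          / Real.Gamma (3 - α)) := by
    have hx' : x ^ (2 - α) = τ ^ (2 - α) * (x / τ) ^ (2 - α) := by
      rw [← Real.mul_rpow hτ.le hr.le, ← e2]
    unfold timeKernel
    rw [max_eq_left hx.le, e1, Real.mul_rpow hτ.le (le_max_right _ _), hx', mul_sub,
      Finset.sum_div, Finset.mul_sum, Finset.mul_sum]
    congr 1
    · refine Finset.sum_congr rfl fun k _ => ?_
      rw [e0, ← hp]; ring
    · ring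
  have e4 : x ^ (-α) = τ ^ (-α) * (x / τ) ^ (-α) := by
    rw [← Real.mul_rpow hτ.le hr.le, ← e2]
  have e5 : τ ^ 2 * τ ^ (-α) = τ ^ (2 - α) := by
    rw [Real.rpow_neg hτ.le, ← hp]; ring
  have hτp : 0 < τ ^ (2 - α) := by positivity
  rw [e3, abs_mul, abs_of_pos hτp]
  calc _ ≤ τ ^ (2 - α) * (K * (x / τ) ^ (-α)) := by gcongr
    _ = _ := by rw [e4, ← e5]; ring

/-- Second-order accuracy of the shifted average of the Grünwald formula. -/
theorem exists_abs_grunwald_sub_le {α : ℝ} (h0 : 0 < α) (h1 : α < 1) :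
    ∃ K : ℝ, 0 < K ∧ ∀ (T B τ : ℝ) (F F₃ : ℝ → ℝ) (n : ℕ), CausalC3 T F F₃ →
      (∀ s ∈ Icc 0 T, |F₃ s| ≤ B) → 0 < τ → 1 ≤ n → n * τ ≤ T →
      |(τ ^ α)⁻¹ * ∑ k ∈ Finset.range (n + 1), gCoeff α k * F (n * τ - k * τ)
        - ((1 - α / 2) * causalFrac α F₃ (n * τ) + α / 2 * causalFrac α F₃ (n * τ - τ))|
        ≤ K * (B * T ^ (1 - α)) * τ ^ 2 := by
  obtain ⟨K, hK, h⟩ := exists_abs_timeKernel_le h0 h1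
  refine ⟨K * (1 - α)⁻¹, by have : 0 < 1 - α := by linarith
                            positivity, fun T B τ F F₃ n hF hB hτ hn hnT => ?_⟩
  have hn' : (1 : ℝ) ≤ n := by exact_mod_cast hn
  set t := (n : ℝ) * τ with ht
  have hτt : τ ≤ t := by rw [ht]; nlinarith
  have ht0 : 0 ≤ t := by positivity
  have hT : 0 ≤ T := ht0.trans hnT
  have hB0 : 0 ≤ B := (abs_nonneg _).trans (hB 0 ⟨le_rfl, hT⟩)
  have hct : ContinuousOn F₃ (uIcc 0 t) := by
    rw [uIcc_of_le ht0]; exact hF.cont.mono (Icc_subset_Icc_right hnT)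
  have hii : ∀ g : ℝ → ℝ, Continuous g → IntervalIntegrable (fun s => g s * F₃ s) volume 0 t :=
    fun g hg => (hg.continuousOn.mul hct).intervalIntegrable
  have hsum : (τ ^ α)⁻¹ * ∑ k ∈ Finset.range (n + 1), gCoeff α k * F (t - k * τ)
        - ((1 - α / 2) * causalFrac α F₃ t + α / 2 * causalFrac α F₃ (t - τ))
      = ∫ s in (0 : ℝ)..t, timeKernel α τ n (t - s) * F₃ s := by
    rw [causalFrac_eq h1 hF.cont ht0 le_rfl hnT, causalFrac_eq h1 hF.cont
      (by linarith : 0 ≤ t - τ) (by linarith) hnT]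
    have a : ∀ k ∈ Finset.range (n + 1), gCoeff α k * F (t - k * τ) =
        ∫ s in (0 : ℝ)..t, (gCoeff α k * ((max (t - s - k * τ) 0) ^ 2 / 2)) * F₃ s := by
      intro k hk
      have hk' : (k : ℝ) ≤ n := by
        have := Finset.mem_range.1 hk
        exact_mod_cast (by omega : k ≤ n)
      rw [hF.eq_integral (x := t - k * τ) (t := t) (by rw [ht]; nlinarith)
        (by have : 0 ≤ (k : ℝ) * τ := by positivity
            linarith) hnT, ← intervalIntegral.integral_const_mul]
      refine intervalIntegral.integral_congr fun s _ => ?_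
      rw [show t - k * τ - s = t - s - k * τ by ring]; ring
    rw [Finset.sum_congr rfl a, ← intervalIntegral.integral_finsetSum (fun k _ =>
      hii (fun s => gCoeff α k * ((max (t - s - k * τ) 0) ^ 2 / 2)) (by fun_prop)),
      ← intervalIntegral.integral_const_mul, ← intervalIntegral.integral_const_mul,
      ← intervalIntegral.integral_const_mul]
    have c1 : Continuous fun s => (max (t - s) 0) ^ (2 - α) / Real.Gamma (3 - α) :=
      (continuous_max_rpow (by linarith) t).div_const _
    have c2 : Continuous fun s => (max (t - τ - s) 0) ^ (2 - α) / Real.Gamma (3 - α) :=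
      (continuous_max_rpow (by linarith) (t - τ)).div_const _
    rw [← intervalIntegral.integral_add ((hii _ c1).const_mul _) ((hii _ c2).const_mul _),
      ← intervalIntegral.integral_sub]
    · refine intervalIntegral.integral_congr fun s _ => ?_
      simp only [timeKernel]
      rw [show t - τ - s = t - s - τ by ring, ← Finset.sum_mul]
      ring
    · have : (fun s => (τ ^ α)⁻¹ * ∑ k ∈ Finset.range (n + 1),
          gCoeff α k * ((max (t - s - k * τ) 0) ^ 2 / 2) * F₃ s) = fun s => ((τ ^ α)⁻¹ *
          ∑ k ∈ Finset.range (n + 1), gCoeff α k * ((max (t - s - k * τ) 0) ^ 2 / 2)) * F₃ s := by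
        ext s; rw [← Finset.sum_mul]; ring
      rw [this]
      exact hii _ (by fun_prop)
    · exact ((hii _ c1).const_mul _).add ((hii _ c2).const_mul _)
  rw [hsum]
  have hbd := intervalIntegral.norm_integral_le_of_norm_le (μ := volume) ht0
    (f := fun s => timeKernel α τ n (t - s) * F₃ s)
    (g := fun s => K * τ ^ 2 * B * (t - s) ^ (-α)) (by
      -- The kernel bound needs `t - s > 0`; the excluded point `s = t` is null.
      filter_upwards [volume.ae_ne t] with s hst hs
      have hs' : 0 < t - s := by
        have := lt_of_le_of_ne hs.2 hst
        linarith
      rw [norm_mul, Real.norm_eq_abs, Real.norm_eq_abs]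
      have b1 := h τ n (t - s) hτ hs' (by linarith [hs.1])
      have b2 := hB s ⟨hs.1.le, hs.2.trans hnT⟩
      calc _ ≤ (K * τ ^ 2 * (t - s) ^ (-α)) * B := by gcongr
        _ = _ := by ring)
    ((intervalIntegrable_sub_rpow (by linarith) t 0 t).const_mul _)
  rw [intervalIntegral.integral_const_mul, integral_sub_rpow (by linarith)] at hbd
  refine hbd.trans ?_
  have hpos : 0 < 1 - α := by linarith
  have : t ^ (-α + 1) ≤ T ^ (1 - α) := by
    rw [show -α + 1 = 1 - α by ring]
    exact Real.rpow_le_rpow ht0 hnT hpos.le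
  rw [show -α + 1 = 1 - α by ring] at this ⊢
  calc K * τ ^ 2 * B * (t ^ (1 - α) / (1 - α)) ≤ K * τ ^ 2 * B * (T ^ (1 - α) / (1 - α)) := by
        gcongr
    _ = _ := by rw [div_eq_mul_inv]; ring

theorem abs_exp_sub_one_le (x : ℝ) : |Real.exp x - 1| ≤ |x| * Real.exp |x| := by
  have := Complex.norm_exp_sub_sum_le_norm_mul_exp (x : ℂ) 1
  simp only [Finset.sum_range_one, pow_zero, Nat.factorial_zero, Nat.cast_one, div_one, pow_one,
    Complex.norm_real, Real.norm_eq_abs] at this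
  rw [← Complex.ofReal_exp, ← Complex.ofReal_one, ← Complex.ofReal_sub, Complex.norm_real] at this
  exact this

theorem abs_exp_sub_one_sub_le (x : ℝ) : |Real.exp x - 1 - x| ≤ x ^ 2 * Real.exp |x| := by
  have := Complex.norm_exp_sub_sum_le_norm_mul_exp (x : ℂ) 2
  simp only [Finset.sum_range_succ, Finset.sum_range_zero, zero_add, pow_zero, Nat.factorial_zero,
    Nat.cast_one, div_one, pow_one, Nat.factorial_one,
    Complex.norm_real, Real.norm_eq_abs, sq_abs] at this
  rw [← Complex.ofReal_exp, ← Complex.ofReal_one, ← Complex.ofReal_add, ← Complex.ofReal_sub,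
    Complex.norm_real] at this
  rwa [sub_sub]

/-- The discrete substantial derivative is the exponentially weighted Grünwald sum. -/
theorem deltaT_eq (α lam τ : ℝ) (v V : ℕ → ℝ) (n : ℕ)
    (hv : ∀ m ≤ n, v m = Real.exp (-lam * (m * τ)) * V m) :
    deltaT α lam τ v n = Real.exp (-lam * (n * τ)) * (Real.exp (α * lam * τ / 2) *
      ((τ ^ α)⁻¹ * ∑ k ∈ Finset.range (n + 1), gCoeff α k * V (n - k))) := by
  unfold deltaT gCoeffSubst
  rw [mul_left_comm (Real.exp (α * lam * τ / 2)), mul_left_comm (Real.exp (-lam * (n * τ))),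
    ← mul_assoc (Real.exp (-lam * (n * τ))), ← Real.exp_add,
    Finset.mul_sum _ _ (Real.exp (-lam * (n * τ) + α * lam * τ / 2))]
  congr 1
  refine Finset.sum_congr rfl fun k hk => ?_
  have hk' : k ≤ n := by have := Finset.mem_range.1 hk; omega
  rw [hv (n - k) (Nat.sub_le _ _), Nat.cast_sub hk']
  rw [show Real.exp (-((k : ℝ) - α / 2) * lam * τ) * gCoeff α k *
      (Real.exp (-lam * (((n : ℝ) - k) * τ)) * V (n - k)) =
      (Real.exp (-((k : ℝ) - α / 2) * lam * τ) * Real.exp (-lam * (((n : ℝ) - k) * τ))) *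
        (gCoeff α k * V (n - k)) by ring, ← Real.exp_add]
  congr 2
  ring

/-- Once `e^{-lam t_n}` is factored out, `a = e^{α lam τ/2}` multiplies the Grünwald sum and `b =
e^{lam τ}` the earlier level of the average. The first-order parts of `a - 1` and `(α/2)(b - 1)`
coincide, which is the purpose of the shift `α/2` in the weights `gCoeffSubst`. What remains, `(a -
1)(J - J')`, is a product of two `O(τ)` factors. -/
theorem exists_abs_deltaT_sub_avgT_le {α : ℝ} (h0 : 0 < α) (h1 : α < 1) (lam : ℝ) {T : ℝ}
    (hT : 0 < T) :
    ∃ K : ℝ, 0 < K ∧ ∀ (B τ : ℝ) (F F₃ : ℝ → ℝ) (n : ℕ) (v w : ℕ → ℝ), CausalC3 T F F₃ →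
      (∀ s ∈ Icc 0 T, |F₃ s| ≤ B) → 0 < τ → 1 ≤ n → n * τ ≤ T →
      (∀ m ≤ n, v m = Real.exp (-lam * (m * τ)) * F (m * τ)) →
      (∀ m ≤ n, w m = Real.exp (-lam * (m * τ)) * causalFrac α F₃ (m * τ)) →
      |deltaT α lam τ v n - avgT α w n| ≤ K * B * τ ^ 2 := by
  obtain ⟨K₁, hK₁, h⟩ := exists_abs_grunwald_sub_le h0 h1
  have hG : 0 < Real.Gamma (3 - α) := Real.Gamma_pos_of_pos (by linarith)
  set G := (Real.Gamma (3 - α))⁻¹ with hGdef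
  have hG' : 0 < G := inv_pos.2 hG
  set L := Real.exp (|lam| * T) with hL
  have hL0 : 0 < L := Real.exp_pos _
  refine ⟨L * (L * (K₁ * T ^ (1 - α)) + |lam| * L * (2 * G * (T ^ (1 - α) * T))
    + G * (T ^ (2 - α) * T) * (2 * lam ^ 2 * L)), by positivity,
    fun B τ F F₃ n v w hF hB hτ hn hnT hv hw => ?_⟩
  have hn' : (1 : ℝ) ≤ n := by exact_mod_cast hn
  have hτT : τ ≤ T := le_trans (by nlinarith) hnT
  have hB0 : 0 ≤ B := (abs_nonneg _).trans (hB 0 ⟨le_rfl, hT.le⟩)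
  have hτt : τ ≤ n * τ := by nlinarith
  have hexp : ∀ x : ℝ, |x| ≤ |lam| * τ → Real.exp |x| ≤ L := fun x hx => by
    rw [hL]
    apply Real.exp_le_exp.2
    exact hx.trans (by gcongr)
  set J := causalFrac α F₃ (n * τ)
  set J' := causalFrac α F₃ (n * τ - τ)
  have hS := h T B τ F F₃ n hF hB hτ hn hnT
  have hd := abs_causalFrac_sub_le h0 h1 hF.cont hB hτ.le hτt hnT
  have hJ' := abs_causalFrac_le h1 hB (by linarith : 0 ≤ n * τ - τ) (by linarith : n * τ - τ ≤ T)
  have e1 := deltaT_eq α lam τ v (fun m => F (m * τ)) n hv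
  have e1' : ∑ k ∈ Finset.range (n + 1), gCoeff α k * F (((n - k : ℕ) : ℝ) * τ)
      = ∑ k ∈ Finset.range (n + 1), gCoeff α k * F (n * τ - k * τ) := by
    refine Finset.sum_congr rfl fun k hk => ?_
    rw [Nat.cast_sub (by have := Finset.mem_range.1 hk; omega), sub_mul]
  have e2 : avgT α w n = Real.exp (-lam * (n * τ)) *
      ((1 - α / 2) * J + α / 2 * (Real.exp (lam * τ) * J')) := by
    unfold avgT
    have hm : (((n - 1 : ℕ) : ℝ)) * τ = n * τ - τ := by
      rw [Nat.cast_sub hn]; push_cast; ring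
    rw [hw n le_rfl, hw (n - 1) (Nat.sub_le _ _), hm]
    have : Real.exp (-lam * (n * τ - τ)) = Real.exp (-lam * (n * τ)) * Real.exp (lam * τ) := by
      rw [← Real.exp_add]; congr 1; ring
    rw [this]; ring
  set S := (τ ^ α)⁻¹ * ∑ k ∈ Finset.range (n + 1), gCoeff α k * F (n * τ - k * τ)
  set a := Real.exp (α * lam * τ / 2)
  set b := Real.exp (lam * τ)
  set E := Real.exp (-lam * (n * τ))
  have hx : |α * lam * τ / 2| ≤ |lam| * τ := by
    rw [show α * lam * τ / 2 = (α / 2) * (lam * τ) by ring, abs_mul, abs_mul lam,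
      abs_of_pos (by linarith : 0 < α / 2), abs_of_pos hτ]
    have : 0 ≤ |lam| * τ := by positivity
    nlinarith
  have hy : |lam * τ| ≤ |lam| * τ := by rw [abs_mul, abs_of_pos hτ]
  have hE : E ≤ L := by
    apply Real.exp_le_exp.2
    calc -lam * (n * τ) ≤ |lam| * (n * τ) := by
          have := neg_abs_le lam
          have : 0 ≤ (n : ℝ) * τ := by positivity
          nlinarith
      _ ≤ |lam| * T := by gcongr
  have ha : a ≤ L := (Real.exp_le_exp.2 (le_abs_self _)).trans (hexp _ hx)
  have ha1 : |a - 1| ≤ |lam| * τ * L :=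
    (abs_exp_sub_one_le _).trans (mul_le_mul hx (hexp _ hx) (Real.exp_pos _).le (by positivity))
  have hsq : (|lam| * τ) ^ 2 = lam ^ 2 * τ ^ 2 := by rw [mul_pow, sq_abs]
  have ha2 : |a - 1 - α * lam * τ / 2| ≤ lam ^ 2 * τ ^ 2 * L := by
    refine (abs_exp_sub_one_sub_le _).trans (mul_le_mul ?_ (hexp _ hx) (Real.exp_pos _).le
      (by positivity))
    rw [← hsq, ← sq_abs]
    exact pow_le_pow_left₀ (abs_nonneg _) hx 2
  have hb2 : |b - 1 - lam * τ| ≤ lam ^ 2 * τ ^ 2 * L := by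
    refine (abs_exp_sub_one_sub_le _).trans (mul_le_mul ?_ (hexp _ hy) (Real.exp_pos _).le
      (by positivity))
    rw [← hsq, ← sq_abs]
    exact pow_le_pow_left₀ (abs_nonneg _) hy 2
  have e3 : deltaT α lam τ v n - avgT α w n = E * (a * (S - ((1 - α / 2) * J + α / 2 * J'))
      + (1 - α / 2) * ((a - 1) * (J - J'))
      + J' * ((a - 1 - α * lam * τ / 2) - α / 2 * (b - 1 - lam * τ))) := by
    rw [e1, e1', e2]; ring
  have t1 : |a * (S - ((1 - α / 2) * J + α / 2 * J'))| ≤ L * (K₁ * (B * T ^ (1 - α)) * τ ^ 2) := by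
    rw [abs_mul, abs_of_pos (Real.exp_pos _)]
    exact mul_le_mul ha hS (abs_nonneg _) hL0.le
  have t2 : |(1 - α / 2) * ((a - 1) * (J - J'))| ≤
      1 * ((|lam| * τ * L) * (2 * G * (B * T ^ (1 - α) * T) * τ)) := by
    rw [abs_mul, abs_mul, abs_of_pos (by linarith : 0 < 1 - α / 2)]
    gcongr
    linarith
  have t3 : |J' * ((a - 1 - α * lam * τ / 2) - α / 2 * (b - 1 - lam * τ))| ≤
      (G * (B * T ^ (2 - α) * T)) * (2 * (lam ^ 2 * τ ^ 2 * L)) := by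
    rw [abs_mul]
    have : |a - 1 - α * lam * τ / 2 - α / 2 * (b - 1 - lam * τ)| ≤ 2 * (lam ^ 2 * τ ^ 2 * L) := by
      refine (abs_sub _ _).trans ?_
      rw [abs_mul, abs_of_pos (by linarith : 0 < α / 2)]
      nlinarith [abs_nonneg (b - 1 - lam * τ)]
    gcongr
  rw [e3, abs_mul, abs_of_pos (Real.exp_pos _)]
  calc _ ≤ L * (L * (K₁ * (B * T ^ (1 - α)) * τ ^ 2)
        + 1 * ((|lam| * τ * L) * (2 * G * (B * T ^ (1 - α) * T) * τ))
        + (G * (B * T ^ (2 - α) * T)) * (2 * (lam ^ 2 * τ ^ 2 * L))) := by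
        refine mul_le_mul hE ((abs_add_le _ _).trans (add_le_add ((abs_add_le _ _).trans
          (add_le_add t1 t2)) t3)) (abs_nonneg _) hL0.le
    _ = _ := by ring

/-- The third derivative of `e^{lam t} f(t)` on `[0, T]`. -/
def expThird (lam T : ℝ) (f : ℝ → ℝ) (t : ℝ) : ℝ :=
  Real.exp (lam * t) * (iteratedDerivWithin 3 f (Icc 0 T) t
    + 3 * lam * iteratedDerivWithin 2 f (Icc 0 T) t
    + 3 * lam ^ 2 * iteratedDerivWithin 1 f (Icc 0 T) t
    + lam ^ 3 * iteratedDerivWithin 0 f (Icc 0 T) t)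

theorem hasDerivAt_iteratedDerivWithin {p : ℕ} {f : ℝ → ℝ} {a b : ℝ}
    (hf : ContDiffOn ℝ p f (Icc a b)) {i : ℕ} (hi : i < p) {t : ℝ} (ht : t ∈ Ioo a b) :
    HasDerivAt (iteratedDerivWithin i f (Icc a b)) (iteratedDerivWithin (i + 1) f (Icc a b) t) t := by
  have hu : UniqueDiffOn ℝ (Icc a b) := uniqueDiffOn_Icc (ht.1.trans ht.2)
  have hd := hf.differentiableOn_iteratedDerivWithin (m := i) (by exact_mod_cast hi) hu
  have := (hd t (Ioo_subset_Icc_self ht)).hasDerivWithinAt.hasDerivAt (Icc_mem_nhds ht.1 ht.2)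
  rwa [iteratedDerivWithin_succ]

/-- The C² representative of the zero extension equals `f` on `[0,T]` and zero on `t ≤ 0`, since
continuous functions that agree almost everywhere on such intervals agree there. The third
derivative is needed only inside `(0,T)`, where Leibniz's rule for `e^{lam t} f` supplies it. -/
theorem exists_causalC3 {α lam T : ℝ} (h0 : 0 < α) (hT : 0 < T) {f : ℝ → ℝ}
    (hf : ContDiffOn ℝ 3 f (Icc 0 T)) (hm : MemFourierClass (2 + α) (zeroExt f)) :
    ∃ F, CausalC3 T F (expThird lam T f) ∧ (∀ t ∈ Icc 0 T, F t = Real.exp (lam * t) * f t) ∧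
      ∀ᵐ t, F t = Real.exp (lam * t) * zeroExt f t := by
  obtain ⟨g, hg, hae⟩ := hm.exists_contDiff (by linarith)
  have hu : UniqueDiffOn ℝ (Icc 0 T) := uniqueDiffOn_Icc hT
  have hg0 : ∀ t ≤ 0, g t = 0 := by
    have h1 : EqOn (fun _ => (0 : ℝ)) g (Iio 0) := by
      refine Measure.eqOn_open_of_ae_eq (μ := volume) ?_ isOpen_Iio continuousOn_const
        hg.continuous.continuousOn
      rw [Filter.EventuallyEq, ae_restrict_iff' measurableSet_Iio]
      filter_upwards [hae] with t ht hlt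
      rw [← ht, zeroExt, if_neg (not_le.2 hlt)]
    have h2 : closure (Iio (0 : ℝ)) ⊆ {t | g t = 0} :=
      (isClosed_eq hg.continuous continuous_const).closure_subset_iff.2 fun t ht => (h1 ht).symm
    rw [closure_Iio] at h2
    exact h2
  have hgf : EqOn f g (Icc 0 T) := by
    refine Measure.eqOn_Icc_of_ae_eq volume hT.ne ?_ hf.continuousOn hg.continuous.continuousOn
    rw [Filter.EventuallyEq, ae_restrict_iff' measurableSet_Icc]
    filter_upwards [hae] with t ht hlt
    rw [← ht, zeroExt, if_pos hlt.1]
  have hc : ∀ i ≤ 3, ContinuousOn (iteratedDerivWithin i f (Icc 0 T)) (Icc 0 T) := fun i hi =>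
    hf.continuousOn_iteratedDerivWithin (by exact_mod_cast hi) hu
  refine ⟨fun t => Real.exp (lam * t) * g t, ⟨by fun_prop, fun t ht => by simp [hg0 t ht], ?_, ?_⟩,
    fun t ht => by rw [hgf ht], ?_⟩
  · have h3 := hc 3 (by norm_num)
    have h2 := hc 2 (by norm_num)
    have h1 := hc 1 (by norm_num)
    have h0' := hc 0 (by norm_num)
    have he : ContinuousOn (fun t => Real.exp (lam * t)) (Icc 0 T) := by fun_prop
    exact he.mul (((h3.add (h2.const_mul _)).add (h1.const_mul _)).add (h0'.const_mul _))
  · set d : ℕ → ℝ → ℝ := fun i => iteratedDerivWithin i f (Icc 0 T) with hd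
    have hdd : ∀ i < 3, ∀ t ∈ Ioo 0 T, HasDerivAt (d i) (d (i + 1) t) t := fun i hi t ht =>
      hasDerivAt_iteratedDerivWithin (p := 3) hf hi ht
    have hexp : ∀ t, HasDerivAt (fun t => Real.exp (lam * t)) (Real.exp (lam * t) * lam) t :=
      fun t => by simpa using ((hasDerivAt_id t).const_mul lam).exp
    have d1 : ∀ t ∈ Ioo 0 T, deriv (fun t => Real.exp (lam * t) * g t) t =
        Real.exp (lam * t) * (d 1 t + lam * d 0 t) := by
      intro t ht
      have hev : (fun t => Real.exp (lam * t) * g t) =ᶠ[nhds t]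
          fun t => Real.exp (lam * t) * d 0 t := by
        filter_upwards [Ioo_mem_nhds ht.1 ht.2] with s hs
        rw [hd, ← hgf (Ioo_subset_Icc_self hs)]; simp
      rw [hev.deriv_eq, ((hexp t).fun_mul (hdd 0 (by norm_num) t ht)).deriv]
      ring
    have d2 : ∀ t ∈ Ioo 0 T, deriv (deriv (fun t => Real.exp (lam * t) * g t)) t =
        Real.exp (lam * t) * (d 2 t + 2 * lam * d 1 t + lam ^ 2 * d 0 t) := by
      intro t ht
      have hev : deriv (fun t => Real.exp (lam * t) * g t) =ᶠ[nhds t]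
          fun t => Real.exp (lam * t) * (d 1 t + lam * d 0 t) := by
        filter_upwards [Ioo_mem_nhds ht.1 ht.2] with s hs using d1 s hs
      rw [hev.deriv_eq, ((hexp t).fun_mul ((hdd 1 (by norm_num) t ht).fun_add
        ((hdd 0 (by norm_num) t ht).const_mul lam))).deriv]
      ring
    intro t ht
    have hev : deriv (deriv (fun t => Real.exp (lam * t) * g t)) =ᶠ[nhds t]
        fun t => Real.exp (lam * t) * (d 2 t + 2 * lam * d 1 t + lam ^ 2 * d 0 t) := by
      filter_upwards [Ioo_mem_nhds ht.1 ht.2] with s hs using d2 s hs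
    have := (hexp t).fun_mul (((hdd 2 (by norm_num) t ht).fun_add
      ((hdd 1 (by norm_num) t ht).const_mul (2 * lam))).fun_add
      ((hdd 0 (by norm_num) t ht).const_mul (lam ^ 2)))
    refine (this.congr_of_eventuallyEq hev).congr_deriv ?_
    simp only [expThird, hd]
    ring
  · filter_upwards [hae] with t ht
    rw [ht]

/-- The factor `e^{-lam (t - ξ)}` splits, so the substantial integral is `e^{-lam t}` times the
ordinary one of `F`; applying `d/dt + lam` to `e^{-lam t} J` leaves `e^{-lam t} J'`. -/
theorem substDeriv_eq {α lam T : ℝ} (h0 : 0 < α) (h1 : α < 1) {f F F₃ : ℝ → ℝ}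
    (hF : CausalC3 T F F₃) (hae : ∀ᵐ t, F t = Real.exp (lam * t) * zeroExt f t)
    {t : ℝ} (ht : 0 < t) (htT : t ≤ T) :
    substDeriv α lam 0 f t = Real.exp (-lam * t) * causalFrac α F₃ t := by
  have hceil : ⌈α⌉₊ = 1 := by
    rw [Nat.ceil_eq_iff (by norm_num)]; simpa using ⟨h0, h1.le⟩
  have hI : ∀ x > 0, substInt (1 - α) lam 0 f x = (Real.Gamma (1 - α))⁻¹ *
      (Real.exp (-lam * x) * ∫ ξ in (0 : ℝ)..x, F ξ * (x - ξ) ^ (-α)) := by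
    intro x hx
    unfold substInt
    rw [← intervalIntegral.integral_const_mul (Real.exp (-lam * x))]
    congr 1
    refine intervalIntegral.integral_congr_ae ?_
    filter_upwards [hae] with ξ hξ hmem
    rw [uIoc_of_le hx.le] at hmem
    rw [hξ, zeroExt, if_pos hmem.1.le, show 1 - (1 - α) = α by ring,
      Real.rpow_neg (by linarith [hmem.2]), mul_sub, Real.exp_sub, neg_mul, Real.exp_neg]
    field_simp
  have hJ := hF.hasDerivAt_integral h1 ht htT
  have hexp : HasDerivAt (fun t => Real.exp (-lam * t)) (Real.exp (-lam * t) * -lam) t := by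
    simpa using ((hasDerivAt_id t).const_mul (-lam)).exp
  have hd := (hexp.fun_mul hJ).const_mul (Real.Gamma (1 - α))⁻¹
  have hd' := hd.congr_of_eventuallyEq (f₁ := substInt (1 - α) lam 0 f) (by
    filter_upwards [lt_mem_nhds ht] with x hx using hI x hx)
  unfold substDeriv
  rw [hceil, Function.iterate_one, Nat.cast_one, hd'.deriv, hI t ht, causalFrac, Gamma_three_sub h1]
  simp only [mul_inv]
  ring

/-! ### Fourth-order accuracy in space. -/

/-- One rung of a Taylor remainder estimate; six applications descend from the sixth derivative to
the function. -/
theorem abs_le_of_hasDerivAt_of_abs_deriv_le {G G' : ℝ → ℝ} {h C : ℝ} {k : ℕ}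
    (hc : ContinuousOn G (Icc 0 h)) (h0 : G 0 = 0) (hd : ∀ s ∈ Ico 0 h, HasDerivAt G (G' s) s)
    (hb : ∀ s ∈ Icc 0 h, |G' s| ≤ C * s ^ k) :
    ∀ s ∈ Icc 0 h, |G s| ≤ C / (k + 1) * s ^ (k + 1) := by
  have hk : ((k : ℝ) + 1) ≠ 0 := by positivity
  intro s hs
  refine image_norm_le_of_norm_deriv_right_le_deriv_boundary
    (B := fun s => C / (k + 1) * s ^ (k + 1)) (B' := fun s => C * s ^ k) hc
    (fun s hs => (hd s hs).hasDerivWithinAt) (by simp [h0]) (fun x => ?_)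
    (fun s hs => hb s (Ico_subset_Icc_self hs)) hs
  have := (hasDerivAt_pow (k + 1) x).const_mul (C / (k + 1))
  refine this.congr_deriv ?_
  push_cast
  field_simp

/-- Fourth-order accuracy of the compact difference operator. -/
theorem abs_compact_sub_le {φ : ℝ → ℝ} {a b B x h : ℝ} (hφ : ContDiffOn ℝ 6 φ (Icc a b))
    (hB : ∀ y ∈ Icc a b, |iteratedDerivWithin 6 φ (Icc a b) y| ≤ B) (hh : 0 < h)
    (hax : a ≤ x - h) (hxb : x + h ≤ b) :
    |(iteratedDerivWithin 2 φ (Icc a b) (x - h) + 10 * iteratedDerivWithin 2 φ (Icc a b) x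
        + iteratedDerivWithin 2 φ (Icc a b) (x + h)) / 12
      - (φ (x - h) - 2 * φ x + φ (x + h)) / h ^ 2| ≤ B * h ^ 4 := by
  set d : ℕ → ℝ → ℝ := fun i => iteratedDerivWithin i φ (Icc a b) with hd
  have hu : UniqueDiffOn ℝ (Icc a b) := uniqueDiffOn_Icc (by linarith)
  have hdc : ∀ i ≤ 6, ContinuousOn (d i) (Icc a b) := fun i hi =>
    hφ.continuousOn_iteratedDerivWithin (by exact_mod_cast hi) hu
  have hdd : ∀ i < 6, ∀ t ∈ Ioo a b, HasDerivAt (d i) (d (i + 1) t) t := fun i hi t ht =>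
    hasDerivAt_iteratedDerivWithin (p := 6) hφ hi ht
  -- `p i` is the `i`-th derivative in `s` of `φ(x + s) + φ(x - s)`. Odd orders vanish at `s = 0`,
  -- and in the compact combination the fourth-order terms cancel, both being `p 4 0 * h² / 24`.
  set p : ℕ → ℝ → ℝ := fun i s => d i (x + s) + (-1) ^ i * d i (x - s) with hp
  have hpc : ∀ i ≤ 6, ContinuousOn (p i) (Icc 0 h) := fun i hi => by
    refine ContinuousOn.add ?_ (ContinuousOn.mul continuousOn_const ?_)
    · exact (hdc i hi).comp (by fun_prop) fun s hs => ⟨by linarith [hs.1], by linarith [hs.2]⟩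
    · exact (hdc i hi).comp (by fun_prop) fun s hs => ⟨by linarith [hs.2], by linarith [hs.1]⟩
  have hpd : ∀ i < 6, ∀ s ∈ Ico 0 h, HasDerivAt (p i) (p (i + 1) s) s := fun i hi s hs => by
    have h1 : HasDerivAt (fun s : ℝ => x + s) 1 s := by simpa using (hasDerivAt_id s).const_add x
    have h2 : HasDerivAt (fun s : ℝ => x - s) (-1) s := by
      simpa using (hasDerivAt_id s).const_sub x
    have k1 := (hdd i hi (x + s) ⟨by linarith [hs.1], by linarith [hs.2]⟩).comp s h1
    have k2 := (hdd i hi (x - s) ⟨by linarith [hs.2], by linarith [hs.1]⟩).comp s h2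
    refine (k1.add (k2.const_mul ((-1) ^ i))).congr_deriv ?_
    simp only [hp, pow_succ]
    ring
  have p6 : ∀ s ∈ Icc 0 h, |p 6 s| ≤ 2 * B * s ^ 0 := fun s hs => by
    have b1 := hB (x + s) ⟨by linarith [hs.1], by linarith [hs.2]⟩
    have b2 := hB (x - s) ⟨by linarith [hs.2], by linarith [hs.1]⟩
    have : p 6 s = d 6 (x + s) + d 6 (x - s) := by simp only [hp]; ring
    rw [this, pow_zero, mul_one]
    refine (abs_add_le _ _).trans ?_
    linarith
  have p5 := abs_le_of_hasDerivAt_of_abs_deriv_le (hpc 5 (by norm_num)) (by simp [hp]; ring)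
    (hpd 5 (by norm_num)) p6
  have p4 := abs_le_of_hasDerivAt_of_abs_deriv_le (G := fun s => p 4 s - p 4 0)
    ((hpc 4 (by norm_num)).sub continuousOn_const) (by simp)
    (fun s hs => (hpd 4 (by norm_num) s hs).sub_const _) p5
  have p3 := abs_le_of_hasDerivAt_of_abs_deriv_le (G := fun s => p 3 s - p 4 0 * s)
    ((hpc 3 (by norm_num)).sub (by fun_prop)) (by simp [hp]; ring)
    (fun s hs => ((hpd 3 (by norm_num) s hs).sub ((hasDerivAt_id s).const_mul (p 4 0))).congr_deriv
      (by simp)) p4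
  have hpow : ∀ (n : ℕ) (c s : ℝ), HasDerivAt (fun s : ℝ => c * s ^ (n + 1)) (c * (n + 1) * s ^ n) s :=
    fun n c s => ((hasDerivAt_pow (n + 1) s).const_mul c).congr_deriv (by push_cast; ring_nf)
  have p2 := abs_le_of_hasDerivAt_of_abs_deriv_le
    (G := fun s => p 2 s - p 2 0 - p 4 0 / 2 * s ^ (1 + 1))
    (((hpc 2 (by norm_num)).sub continuousOn_const).sub (by fun_prop)) (by simp)
    (fun s hs => (((hpd 2 (by norm_num) s hs).sub_const _).sub (hpow 1 (p 4 0 / 2) s)).congr_deriv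
      (by push_cast; ring)) p3
  have p1 := abs_le_of_hasDerivAt_of_abs_deriv_le
    (G := fun s => p 1 s - p 2 0 * s ^ (0 + 1) - p 4 0 / 6 * s ^ (2 + 1))
    (((hpc 1 (by norm_num)).sub (by fun_prop)).sub (by fun_prop)) (by simp [hp])
    (fun s hs => (((hpd 1 (by norm_num) s hs).sub (hpow 0 (p 2 0) s)).sub
      (hpow 2 (p 4 0 / 6) s)).congr_deriv (by push_cast; ring)) p2
  have p0 := abs_le_of_hasDerivAt_of_abs_deriv_le
    (G := fun s => p 0 s - p 0 0 - p 2 0 / 2 * s ^ (1 + 1) - p 4 0 / 24 * s ^ (3 + 1))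
    ((((hpc 0 (by norm_num)).sub continuousOn_const).sub (by fun_prop)).sub (by fun_prop)) (by simp)
    (fun s hs => ((((hpd 0 (by norm_num) s hs).sub_const _).sub (hpow 1 (p 2 0 / 2) s)).sub
      (hpow 3 (p 4 0 / 24) s)).congr_deriv (by push_cast; ring)) p1
  have q0 := p0 h ⟨hh.le, le_rfl⟩
  have q2 := p2 h ⟨hh.le, le_rfl⟩
  have hB0 : 0 ≤ B := (abs_nonneg _).trans (hB x ⟨by linarith, by linarith⟩)
  have e0 : ∀ s, p 0 s = φ (x + s) + φ (x - s) := fun s => by simp [hp, hd]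
  have e2 : ∀ s, p 2 s = d 2 (x + s) + d 2 (x - s) := fun s => by simp [hp]
  set Q0 := p 0 h - p 0 0 - p 2 0 / 2 * h ^ (1 + 1) - p 4 0 / 24 * h ^ (3 + 1)
  set Q2 := p 2 h - p 2 0 - p 4 0 / 2 * h ^ (1 + 1)
  have key : (d 2 (x - h) + 10 * d 2 x + d 2 (x + h)) / 12
      - (φ (x - h) - 2 * φ x + φ (x + h)) / h ^ 2 = Q2 / 12 - Q0 / h ^ 2 := by
    simp only [Q0, Q2, e0, e2, add_zero, sub_zero]
    field_simp
    ring
  rw [key]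
  have b2 : |Q2 / 12| ≤ B * h ^ 4 / 2 := by
    rw [abs_div, abs_of_pos (by norm_num : (0 : ℝ) < 12), div_le_iff₀ (by norm_num)]
    refine q2.trans ?_
    have : 0 ≤ B * h ^ 4 := by positivity
    norm_num
    linarith
  have b0 : |Q0 / h ^ 2| ≤ B * h ^ 4 / 2 := by
    rw [abs_div, abs_of_pos (by positivity : 0 < h ^ 2), div_le_iff₀ (by positivity)]
    refine q0.trans ?_
    have : 0 ≤ B * h ^ 6 := by positivity
    norm_num
    nlinarith
  refine (abs_sub _ _).trans ?_
  linarith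

theorem iteratedDeriv_two_eq {f : ℝ → ℝ} {a b x : ℝ} (hf : ContDiffOn ℝ 2 f (Icc a b))
    (hx : x ∈ Ioo a b) : iteratedDeriv 2 f x = iteratedDerivWithin 2 f (Icc a b) x := by
  have h1 : ∀ y ∈ Ioo a b, deriv f y = iteratedDerivWithin 1 f (Icc a b) y := fun y hy => by
    have := (hasDerivAt_iteratedDerivWithin (p := 2) hf (i := 0) (by norm_num) hy).deriv
    simpa using this
  have hev : deriv f =ᶠ[nhds x] iteratedDerivWithin 1 f (Icc a b) := by
    filter_upwards [Ioo_mem_nhds hx.1 hx.2] with y hy using h1 y hy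
  rw [iteratedDeriv_succ, iteratedDeriv_one, hev.deriv_eq]
  exact (hasDerivAt_iteratedDerivWithin (p := 2) hf (i := 1) (by norm_num) hx).deriv

/-! ### Truncation error of the compact scheme. -/

/-- The value of the substantial derivative prescribed by the equation, on the closed domain. -/
def eqnValue (a b : ℝ) (F u : ℝ → ℝ → ℝ) (x t : ℝ) : ℝ :=
  iteratedDerivWithin 2 (fun y => u y t) (Icc a b) x + F x t

section Consistency

variable {α lam a b T : ℝ} {F φ u : ℝ → ℝ → ℝ}

theorem continuousOn_eqnValue (hF : ContinuousOn (fun z : ℝ × ℝ => F z.1 z.2) (Icc a b ×ˢ Icc 0 T))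
    (hu : ClassC 6 3 a b T u) :
    ContinuousOn (fun z : ℝ × ℝ => eqnValue a b F u z.1 z.2) (Icc a b ×ˢ Icc 0 T) :=
  (hu.cont_x 2 (by norm_num)).add hF

theorem exists_bound_expThird (lam : ℝ) (hu : ClassC 6 3 a b T u) :
    ∃ B, ∀ x ∈ Icc a b, ∀ t ∈ Icc 0 T, |expThird lam T (u x) t| ≤ B := by
  have hc : ContinuousOn (fun z : ℝ × ℝ => expThird lam T (u z.1) z.2) (Icc a b ×ˢ Icc 0 T) := by
    have h3 := hu.cont_t 3 le_rfl
    have h2 := hu.cont_t 2 (by norm_num)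
    have h1 := hu.cont_t 1 (by norm_num)
    have h0 := hu.cont_t 0 (by norm_num)
    have he : ContinuousOn (fun z : ℝ × ℝ => Real.exp (lam * z.2)) (Icc a b ×ˢ Icc 0 T) := by
      fun_prop
    exact he.mul (((h3.add (h2.const_mul _)).add (h1.const_mul _)).add (h0.const_mul _))
  obtain ⟨B, hB⟩ := (isCompact_Icc.prod isCompact_Icc).exists_bound_of_continuousOn hc
  exact ⟨B, fun x hx t ht => hB (x, t) ⟨hx, ht⟩⟩

/-- The equation gives this for `t > 0`. The value at `t = 0`, which the time average at `n = 1`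
uses, follows by continuity: the right side tends to zero. -/
theorem eqnValue_eq_causalFrac (h0 : 0 < α) (h1 : α < 1) (hT : 0 < T)
    (hF : ContinuousOn (fun z : ℝ × ℝ => F z.1 z.2) (Icc a b ×ˢ Icc 0 T))
    (hu : ClassC 6 3 a b T u) (hsol : IsSolution α lam a b T F φ u)
    {x : ℝ} (hx : x ∈ Ioo a b) {G : ℝ → ℝ} (hG : CausalC3 T G (expThird lam T (u x)))
    (hae : ∀ᵐ t, G t = Real.exp (lam * t) * zeroExt (u x) t) :
    ∀ t ∈ Icc 0 T, eqnValue a b F u x t =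
      Real.exp (-lam * t) * causalFrac α (expThird lam T (u x)) t := by
  have hpos : ∀ t ∈ Ioc 0 T, eqnValue a b F u x t =
      Real.exp (-lam * t) * causalFrac α (expThird lam T (u x)) t := fun t ht => by
    have e := hsol.eqn x hx t ht
    rw [substDeriv_eq h0 h1 hG hae ht.1 ht.2, iteratedDeriv_two_eq
      ((hu.contDiff_x t ⟨ht.1.le, ht.2⟩).of_le (by norm_cast)) hx] at e
    exact e.symm
  intro t ht
  rcases ht.1.eq_or_lt with h | h
  swap
  · exact hpos t ⟨h, ht.2⟩
  rw [← h]
  have hz : causalFrac α (expThird lam T (u x)) 0 = 0 := by simp [causalFrac]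
  rw [hz, mul_zero]
  have hc : ContinuousOn (fun t => eqnValue a b F u x t) (Icc 0 T) :=
    (continuousOn_eqnValue hF hu).comp (f := fun t => (x, t)) (by fun_prop)
      fun t ht => ⟨Ioo_subset_Icc_self hx, ht⟩
  have hl : Filter.Tendsto (fun t => eqnValue a b F u x t) (nhdsWithin 0 (Ioc 0 T))
      (nhds (eqnValue a b F u x 0)) :=
    (hc 0 ⟨le_rfl, hT.le⟩).mono Ioc_subset_Icc_self
  obtain ⟨B, hB⟩ := exists_bound_expThird lam hu
  have hBx := hB x (Ioo_subset_Icc_self hx)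
  have hsq : Filter.Tendsto (fun t => Real.exp (-lam * t) * ((Real.Gamma (3 - α))⁻¹ *
      (B * t ^ (2 - α) * t))) (nhdsWithin 0 (Ioc 0 T)) (nhds 0) := by
    have : Continuous fun t : ℝ => Real.exp (-lam * t) * ((Real.Gamma (3 - α))⁻¹ *
        (B * t ^ (2 - α) * t)) := by
      have : Continuous fun t : ℝ => t ^ (2 - α) := Real.continuous_rpow_const (by linarith)
      fun_prop
    have h2 := this.tendsto 0
    simp only [mul_zero] at h2
    exact h2.mono_left nhdsWithin_le_nhds
  have hl0 : Filter.Tendsto (fun t => eqnValue a b F u x t) (nhdsWithin 0 (Ioc 0 T)) (nhds 0) := by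
    refine squeeze_zero_norm' ?_ hsq
    filter_upwards [self_mem_nhdsWithin] with t ht
    rw [hpos t ht, norm_mul, Real.norm_of_nonneg (Real.exp_pos _).le]
    gcongr
    -- The bound is used with final time `t` itself, which makes it decay as `t → 0`.
    exact abs_causalFrac_le h1 (fun s hs => hBx s ⟨hs.1, hs.2.trans ht.2⟩) ht.1.le le_rfl
  have : (nhdsWithin (0 : ℝ) (Ioc 0 T)).NeBot := by
    rw [← mem_closure_iff_nhdsWithin_neBot, closure_Ioc hT.ne]
    exact ⟨le_rfl, hT.le⟩
  exact tendsto_nhds_unique hl hl0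

/-- The compact average reaches the end points of `[a,b]`, where no equation is assumed. The
interior bound is uniform in `x` and all terms are continuous in `x`, so it extends to the closure.
-/
theorem exists_abs_deltaT_sub_avgT_eqnValue_le (h0 : 0 < α) (h1 : α < 1) (hab : a < b) (hT : 0 < T)
    (hF : ContinuousOn (fun z : ℝ × ℝ => F z.1 z.2) (Icc a b ×ˢ Icc 0 T))
    (hu : ClassC 6 3 a b T u) (hsol : IsSolution α lam a b T F φ u)
    (hext : ∀ x ∈ Ioo a b, MemFourierClass (2 + α) (zeroExt (u x))) :
    ∃ K : ℝ, ∀ (τ : ℝ) (n : ℕ), 0 < τ → 1 ≤ n → n * τ ≤ T → ∀ x ∈ Icc a b,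
      |deltaT α lam τ (fun m => u x (m * τ)) n - avgT α (fun m => eqnValue a b F u x (m * τ)) n|
        ≤ K * τ ^ 2 := by
  obtain ⟨K, hK, h⟩ := exists_abs_deltaT_sub_avgT_le h0 h1 lam hT
  obtain ⟨B, hB⟩ := exists_bound_expThird lam hu
  refine ⟨K * B, fun τ n hτ hn hnT => ?_⟩
  have hm : ∀ m ≤ n, (m : ℝ) * τ ∈ Icc 0 T := fun m hmn => by
    refine ⟨by positivity, le_trans ?_ hnT⟩
    gcongr
  have hin : ∀ x ∈ Ioo a b,
      |deltaT α lam τ (fun m => u x (m * τ)) n - avgT α (fun m => eqnValue a b F u x (m * τ)) n|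
        ≤ K * B * τ ^ 2 := fun x hx => by
    obtain ⟨G, hG, hGu, hae⟩ := exists_causalC3 (lam := lam) h0 hT
      (hu.contDiff_t x (Ioo_subset_Icc_self hx)) (hext x hx)
    refine h B τ G _ n _ _ hG (hB x (Ioo_subset_Icc_self hx)) hτ hn hnT (fun m hmn => ?_)
      fun m hmn => eqnValue_eq_causalFrac h0 h1 hT hF hu hsol hx hG hae _ (hm m hmn)
    rw [hGu _ (hm m hmn), ← mul_assoc, ← Real.exp_add]
    simp
  intro x hx
  rw [← closure_Ioo hab.ne] at hx
  have hcu : ∀ m ≤ n, ContinuousOn (fun x => u x (m * τ)) (closure (Ioo a b)) := fun m hmn => by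
    rw [closure_Ioo hab.ne]
    exact (hu.contDiff_x _ (hm m hmn)).continuousOn
  have hcW : ∀ m ≤ n, ContinuousOn (fun x => eqnValue a b F u x (m * τ)) (closure (Ioo a b)) :=
    fun m hmn => by
      rw [closure_Ioo hab.ne]
      exact (continuousOn_eqnValue hF hu).comp (f := fun x => (x, (m : ℝ) * τ)) (by fun_prop)
        fun x hx => ⟨hx, hm m hmn⟩
  refine le_on_closure hin (ContinuousOn.abs (ContinuousOn.sub ?_ ?_)) continuousOn_const hx
  · unfold deltaT
    refine continuousOn_const.mul (continuousOn_finsetSum _ fun k _ => ?_)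
    exact continuousOn_const.mul (hcu (n - k) (Nat.sub_le _ _))
  · unfold avgT
    exact (continuousOn_const.mul (hcW n le_rfl)).add
      (continuousOn_const.mul (hcW (n - 1) (Nat.sub_le _ _)))

/-- The truncation error of the compact scheme is of second order in time and fourth order in
space. -/
theorem exists_truncBound (h0 : 0 < α) (h1 : α < 1) (hab : a < b) (hT : 0 < T)
    (hF : ContinuousOn (fun z : ℝ × ℝ => F z.1 z.2) (Icc a b ×ˢ Icc 0 T))
    (hu : ClassC 6 3 a b T u) (hsol : IsSolution α lam a b T F φ u)
    (hext : ∀ x ∈ Ioo a b, MemFourierClass (2 + α) (zeroExt (u x))) :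
    ∃ c : ℝ, 0 < c ∧ ∀ M N : ℕ, 1 ≤ M → 1 ≤ N → TruncBound α lam a b T F u M N c := by
  obtain ⟨K, hK⟩ := exists_abs_deltaT_sub_avgT_eqnValue_le h0 h1 hab hT hF hu hsol hext
  obtain ⟨B, hB⟩ := (isCompact_Icc.prod isCompact_Icc).exists_bound_of_continuousOn
    (hu.cont_x 6 le_rfl)
  refine ⟨|K| + |B| + 1, by positivity, fun M N hM hN n hn i hi => ?_⟩
  rw [Finset.mem_Icc] at hn
  rw [Finset.mem_Ico] at hi
  have hM' : (0 : ℝ) < M := by exact_mod_cast hM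
  have hN' : (0 : ℝ) < N := by exact_mod_cast hN
  set h := (b - a) / M with hh
  set τ := T / N with hτ
  have hh0 : 0 < h := div_pos (by linarith) hM'
  have hτ0 : 0 < τ := div_pos hT hN'
  have hMh : M * h = b - a := by rw [hh]; field_simp
  have hNτ : N * τ = T := by rw [hτ]; field_simp
  have hnT : ∀ m ≤ n, (m : ℝ) * τ ≤ T := fun m hm => by
    rw [← hNτ]
    have : (m : ℝ) ≤ N := by exact_mod_cast hm.trans hn.2
    gcongr
  have hgrid : ∀ j ≤ M, a + (j : ℝ) * h ∈ Icc a b := fun j hj => by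
    have : (j : ℝ) ≤ M := by exact_mod_cast hj
    have h1 : (j : ℝ) * h ≤ M * h := by gcongr
    have h2 : 0 ≤ (j : ℝ) * h := by positivity
    exact ⟨by linarith, by linarith⟩
  set E : ℕ → ℝ := fun j => deltaT α lam τ (fun m => u (a + j * h) (m * τ)) n
    - avgT α (fun m => eqnValue a b F u (a + j * h) (m * τ)) n with hE
  have hEb : ∀ j ≤ M, |E j| ≤ K * τ ^ 2 := fun j hj =>
    hK τ n hτ0 hn.1 (hnT n le_rfl) _ (hgrid j hj)
  set d : ℕ → ℕ → ℝ := fun m j =>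
    iteratedDerivWithin 2 (fun y => u y (m * τ)) (Icc a b) (a + j * h) with hd
  set S : ℕ → ℝ := fun m => (d m (i - 1) + 10 * d m i + d m (i + 1)) / 12
    - (u (a + ((i - 1 : ℕ) : ℝ) * h) (m * τ) - 2 * u (a + i * h) (m * τ)
      + u (a + ((i + 1 : ℕ) : ℝ) * h) (m * τ)) / h ^ 2 with hS
  have hSb : ∀ m ≤ n, |S m| ≤ B * h ^ 4 := fun m hm => by
    have hmT : (m : ℝ) * τ ∈ Icc 0 T := ⟨by positivity, hnT m hm⟩
    have e1 : a + ((i - 1 : ℕ) : ℝ) * h = a + i * h - h := by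
      rw [Nat.cast_sub hi.1]; push_cast; ring
    have e2 : a + ((i + 1 : ℕ) : ℝ) * h = a + i * h + h := by push_cast; ring
    have g1 := hgrid (i - 1) (by omega)
    have g2 := hgrid (i + 1) (by omega)
    rw [e1] at g1
    rw [e2] at g2
    have := abs_compact_sub_le (hu.contDiff_x _ hmT) (fun y hy => hB (y, m * τ) ⟨hy, hmT⟩) hh0
      g1.1 g2.2
    simp only [hS, hd, e1, e2]
    exact this
  -- With `eqnValue` inserted as an intermediate quantity, `F` drops out: the residual is the
  -- compact average of the time error `E` plus the time average of the space error `S`.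
  have hR : truncErr α lam a b T F u M N n i =
      (E (i - 1) + 10 * E i + E (i + 1)) / 12 + ((1 - α / 2) * S n + α / 2 * S (n - 1)) := by
    simp only [truncErr, schemeLHS, schemeRHS, avgX, if_pos hi, ← hh, ← hτ, onGrid, hE, hS, hd,
      avgT, eqnValue, deltaX]
    ring
  have a1 := abs_le.1 (hEb (i - 1) (by omega))
  have a2 := abs_le.1 (hEb i (by omega))
  have a3 := abs_le.1 (hEb (i + 1) (by omega))
  have s1 := abs_le.1 (hSb n le_rfl)
  have s2 := abs_le.1 (hSb (n - 1) (Nat.sub_le _ _))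
  have k1 : K * τ ^ 2 ≤ |K| * τ ^ 2 := by gcongr; exact le_abs_self K
  have k2 : B * h ^ 4 ≤ |B| * h ^ 4 := by gcongr; exact le_abs_self B
  have k3 : 0 ≤ |B| * τ ^ 2 := by positivity
  have k4 : 0 ≤ |K| * h ^ 4 := by positivity
  have k5 : 0 ≤ τ ^ 2 + h ^ 4 := by positivity
  have c1 : 0 ≤ 1 - α / 2 := by linarith
  have c2 : 0 ≤ α / 2 := by linarith
  have m1 := mul_le_mul_of_nonneg_left s1.1 c1
  have m2 := mul_le_mul_of_nonneg_left s1.2 c1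
  have m3 := mul_le_mul_of_nonneg_left s2.1 c2
  have m4 := mul_le_mul_of_nonneg_left s2.2 c2
  have t1 : |truncErr α lam a b T F u M N n i| ≤ K * τ ^ 2 + B * h ^ 4 := by
    rw [hR, abs_le]
    constructor <;> linarith
  linarith

end Consistency

/-! ### Grid forms -/

theorem sum_range_mul_eq {M : ℕ} (hM : 1 ≤ M) (A q : ℕ → ℝ) (h0 : q 0 = 0) :
    ∑ i ∈ Finset.range M, A i * q i = ∑ i ∈ Finset.Ico 1 M, A i * q i := by
  rw [Finset.range_eq_Ico, Finset.sum_eq_sum_Ico_succ_bot (by omega), h0]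
  simp

theorem sum_range_mul_succ_eq {M : ℕ} (hM : 1 ≤ M) (A q : ℕ → ℝ) (h1 : q M = 0) :
    ∑ i ∈ Finset.range M, A i * q (i + 1) = ∑ i ∈ Finset.Ico 1 M, A (i - 1) * q i := by
  have h := Finset.sum_Ico_add' (fun i => A (i - 1) * q i) 0 M 1
  simp only [Nat.add_sub_cancel, zero_add] at h
  rw [Finset.range_eq_Ico, h, Finset.sum_Ico_succ_top (by omega), h1]
  simp

/-- The index set of a representation of the compact average as a sum of squares. -/
def formIdx (M : ℕ) : Finset (ℕ ⊕ ℕ) := (Finset.Ico 1 M).disjSum (Finset.range M)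

/-- The linear functionals of that representation. -/
def formEval (p : ℕ → ℝ) : ℕ ⊕ ℕ → ℝ := Sum.elim p fun i => p i + p (i + 1)

/-- The weights of that representation. -/
def formWeight (h : ℝ) : ℕ ⊕ ℕ → ℝ := Sum.elim (fun _ => 8 * h / 12) fun _ => h / 12

/-- The bilinear form `(A_x p, q)` for grid functions `q` that vanish at the end points. -/
def compactForm (h : ℝ) (M : ℕ) (p q : ℕ → ℝ) : ℝ :=
  ∑ x ∈ formIdx M, formWeight h x * (formEval p x * formEval q x)

theorem formWeight_nonneg {h : ℝ} (hh : 0 ≤ h) (x : ℕ ⊕ ℕ) : 0 ≤ formWeight h x := by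
  rcases x with x | x <;> simp only [formWeight, Sum.elim_inl, Sum.elim_inr] <;> positivity

theorem compactForm_eq (h : ℝ) (M : ℕ) (p q : ℕ → ℝ) :
    compactForm h M p q = 8 * h / 12 * ∑ i ∈ Finset.Ico 1 M, p i * q i
      + h / 12 * ∑ i ∈ Finset.range M, (p i + p (i + 1)) * (q i + q (i + 1)) := by
  simp only [compactForm, formIdx, Finset.sum_disjSum, formWeight, formEval, Sum.elim_inl,
    Sum.elim_inr, Finset.mul_sum]

/-- Split `p_{i-1} + 10 p_i + p_{i+1}` into `8 p_i` and `p_{i-1} + 2 p_i + p_{i+1}`; the second part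
comes from `(p_i + p_{i+1})(q_i + q_{i+1})` by summation by parts. In this diagonal form, with
nonnegative weights, inequalities can be checked functional by functional. -/
theorem gridInner_avgX {h : ℝ} {M : ℕ} (hM : 1 ≤ M) (p q : ℕ → ℝ) (h0 : q 0 = 0) (h1 : q M = 0) :
    gridInner h M (avgX M p) q = compactForm h M p q := by
  have e : ∑ i ∈ Finset.range M, (p i + p (i + 1)) * (q i + q (i + 1)) =
      ∑ i ∈ Finset.Ico 1 M, (p (i - 1) + 2 * p i + p (i + 1)) * q i := by
    simp only [mul_add, Finset.sum_add_distrib]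
    rw [sum_range_mul_eq hM (fun i => p i + p (i + 1)) q h0,
      sum_range_mul_succ_eq hM (fun i => p i + p (i + 1)) q h1, ← Finset.sum_add_distrib]
    refine Finset.sum_congr rfl fun i hi => ?_
    have := (Finset.mem_Ico.1 hi).1
    rw [Nat.sub_add_cancel this]
    ring
  rw [compactForm_eq, e, gridInner, Finset.mul_sum, Finset.mul_sum, Finset.mul_sum,
    ← Finset.sum_add_distrib]
  refine Finset.sum_congr rfl fun i hi => ?_
  rw [avgX, if_pos (Finset.mem_Ico.1 hi)]
  ring

theorem neg_gridInner_deltaX {h : ℝ} {M : ℕ} (hM : 1 ≤ M) (v : ℕ → ℝ) (h0 : v 0 = 0)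
    (h1 : v M = 0) :
    -gridInner h M (deltaX h v) v = h * ((∑ i ∈ Finset.range M, (v (i + 1) - v i) ^ 2) / h ^ 2) := by
  have e : ∑ i ∈ Finset.range M, (v (i + 1) - v i) ^ 2 =
      ∑ i ∈ Finset.Ico 1 M, -((v (i - 1) - 2 * v i + v (i + 1)) * v i) := by
    have e1 : ∀ i, (v (i + 1) - v i) ^ 2 =
        (v (i + 1) - v i) * v (i + 1) - (v (i + 1) - v i) * v i := fun i => by ring
    simp only [e1, Finset.sum_sub_distrib]
    rw [sum_range_mul_eq hM (fun i => v (i + 1) - v i) v h0,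
      sum_range_mul_succ_eq hM (fun i => v (i + 1) - v i) v h1, ← Finset.sum_sub_distrib]
    refine Finset.sum_congr rfl fun i hi => ?_
    have := (Finset.mem_Ico.1 hi).1
    rw [Nat.sub_add_cancel this]
    ring
  rw [e, gridInner, Finset.sum_div, ← mul_neg, ← Finset.sum_neg_distrib]
  congr 1
  refine Finset.sum_congr rfl fun i _ => ?_
  rw [deltaX]
  ring

theorem gridNorm_sq {h : ℝ} (hh : 0 ≤ h) (M : ℕ) (v : ℕ → ℝ) :
    gridNorm h M v ^ 2 = h * ∑ i ∈ Finset.Ico 1 M, v i ^ 2 := by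
  have : 0 ≤ gridInner h M v v :=
    mul_nonneg hh (Finset.sum_nonneg fun i _ => mul_self_nonneg _)
  rw [gridNorm, Real.sq_sqrt this, gridInner]
  simp only [pow_two]

theorem gridNorm_sq_le_compactForm {h : ℝ} (hh : 0 ≤ h) (M : ℕ) (v : ℕ → ℝ) :
    gridNorm h M v ^ 2 ≤ 3 / 2 * compactForm h M v v := by
  have : 0 ≤ h / 12 * ∑ i ∈ Finset.range M, (v i + v (i + 1)) * (v i + v (i + 1)) :=
    mul_nonneg (by positivity) (Finset.sum_nonneg fun i _ => mul_self_nonneg _)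
  rw [gridNorm_sq hh, compactForm_eq]
  simp only [← pow_two] at this ⊢
  linarith

theorem compactForm_self_nonneg {h : ℝ} (hh : 0 ≤ h) (M : ℕ) (v : ℕ → ℝ) :
    0 ≤ compactForm h M v v :=
  Finset.sum_nonneg fun x _ => mul_nonneg (formWeight_nonneg hh x) (mul_self_nonneg _)

/-- The discrete Poincaré inequality. -/
theorem isMeshConst_inv_sq {a b : ℝ} (hab : a < b) : IsMeshConst a b (1 / (b - a) ^ 2) := by
  intro M hM v h0 h1
  have hM' : (0 : ℝ) < M := by exact_mod_cast hM
  have hL : 0 < b - a := by linarith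
  set h := (b - a) / M with hh
  have hh0 : 0 < h := by positivity
  have hLh : b - a = M * h := by rw [hh]; field_simp
  set D := ∑ i ∈ Finset.range M, (v (i + 1) - v i) ^ 2 with hD
  have hD0 : 0 ≤ D := Finset.sum_nonneg fun i _ => sq_nonneg _
  have hv : ∀ i ∈ Finset.Ico 1 M, v i ^ 2 ≤ M * D := fun i hi => by
    have hi' := (Finset.mem_Ico.1 hi).2
    have e : v i = ∑ j ∈ Finset.range i, (v (j + 1) - v j) := by
      rw [Finset.sum_range_sub, h0, sub_zero]
    rw [e]
    refine sq_sum_le_card_mul_sum_sq.trans ?_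
    rw [Finset.card_range]
    have h2 : ∑ j ∈ Finset.range i, (v (j + 1) - v j) ^ 2 ≤ D :=
      Finset.sum_le_sum_of_subset_of_nonneg (Finset.range_subset_range.2 hi'.le)
        fun _ _ _ => sq_nonneg _
    have h3 : (i : ℝ) ≤ M := by exact_mod_cast hi'.le
    have h4 : 0 ≤ ∑ j ∈ Finset.range i, (v (j + 1) - v j) ^ 2 :=
      Finset.sum_nonneg fun _ _ => sq_nonneg _
    gcongr
  have hs : ∑ i ∈ Finset.Ico 1 M, v i ^ 2 ≤ M * (M * D) := by
    refine (Finset.sum_le_card_nsmul _ _ _ hv).trans ?_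
    rw [nsmul_eq_mul, Nat.card_Ico]
    have : ((M - 1 : ℕ) : ℝ) ≤ M := by exact_mod_cast Nat.sub_le _ _
    gcongr
  rw [neg_gridInner_deltaX hM v h0 h1, gridNorm_sq hh0.le, hLh, ← hD]
  calc 1 / ((M : ℝ) * h) ^ 2 * (h * ∑ i ∈ Finset.Ico 1 M, v i ^ 2)
      ≤ 1 / ((M : ℝ) * h) ^ 2 * (h * (M * (M * D))) := by gcongr
    _ = _ := by field_simp

/-- Test with `M = 2` and the unit value at the single interior node. The bound keeps the
square-root factor of the error estimate away from zero over all admissible constants. -/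
theorem IsMeshConst.le {a b C : ℝ} (hab : a < b) (hC : IsMeshConst a b C) :
    C ≤ 8 / (b - a) ^ 2 := by
  have hL : 0 < b - a := by linarith
  have := hC 2 (by norm_num) (fun i => if i = 1 then 1 else 0) (by simp) (by simp)
  have hh : 0 < (b - a) / ((2 : ℕ) : ℝ) := by positivity
  rw [neg_gridInner_deltaX (by norm_num) _ (by simp) (by simp), gridNorm_sq hh.le,
    Finset.sum_range_succ, Finset.sum_range_one] at this
  rw [show Finset.Ico 1 2 = {1} by rfl, Finset.sum_singleton] at this
  norm_num at this
  rw [le_div_iff₀ (by positivity)]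
  have h2 : C * ((b - a) / 2) * (b - a) ≤ (b - a) / 2 * (2 / ((b - a) / 2) ^ 2) * (b - a) := by
    gcongr
  have h3 : (b - a) / 2 * (2 / ((b - a) / 2) ^ 2) * (b - a) = 4 := by field_simp; norm_num
  rw [h3] at h2
  nlinarith

/-! ### Energy identity -/

/-- The test function is the time average of `e`, the very function the second difference acts on,
so that the spatial part becomes a signed quadratic form. -/
theorem energy_identity {α lam τ h : ℝ} {M n : ℕ} (hM : 1 ≤ M) (e : ℕ → ℕ → ℝ)
    (h0 : ∀ m ≤ n, e m 0 = 0) (h1 : ∀ m ≤ n, e m M = 0) :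
    compactForm h M (fun j => deltaT α lam τ (fun m => e m j) n) (fun i => avgT α (fun m => e m i) n)
      - gridInner h M (deltaX h (fun i => avgT α (fun m => e m i) n))
          (fun i => avgT α (fun m => e m i) n)
      = gridInner h M (schemeLHS α lam τ h M e n) (fun i => avgT α (fun m => e m i) n) := by
  have z0 : avgT α (fun m => e m 0) n = 0 := by simp [avgT, h0 n le_rfl, h0 (n - 1) (Nat.sub_le _ _)]
  have z1 : avgT α (fun m => e m M) n = 0 := by simp [avgT, h1 n le_rfl, h1 (n - 1) (Nat.sub_le _ _)]
  rw [← gridInner_avgX hM _ (fun i => avgT α (fun m => e m i) n) z0 z1]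
  simp only [gridInner, ← mul_sub, ← Finset.sum_sub_distrib]
  congr 1
  refine Finset.sum_congr rfl fun i _ => ?_
  simp only [schemeLHS, avgT, deltaX]
  ring

theorem gridInner_le_of_abs_le {h r η : ℝ} {M : ℕ} (hh : 0 ≤ h) (hη : 0 < η)
    {R : ℕ → ℝ} (hR : ∀ i ∈ Finset.Ico 1 M, |R i| ≤ r) (y : ℕ → ℝ) :
    gridInner h M R y ≤ η * gridNorm h M y ^ 2 + h * M * r ^ 2 / (4 * η) := by
  rw [gridNorm_sq hh, gridInner]
  have : ∑ i ∈ Finset.Ico 1 M, R i * y i ≤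
      ∑ i ∈ Finset.Ico 1 M, (η * y i ^ 2 + r ^ 2 / (4 * η)) := by
    refine Finset.sum_le_sum fun i hi => ?_
    have h1 : R i ^ 2 ≤ r ^ 2 := sq_le_sq' (by linarith [(abs_le.1 (hR i hi)).1])
      ((abs_le.1 (hR i hi)).2)
    have h2 : R i * y i ≤ η * y i ^ 2 + R i ^ 2 / (4 * η) := by
      have : 0 ≤ (2 * η * y i - R i) ^ 2 / (4 * η) := by positivity
      have e : (2 * η * y i - R i) ^ 2 / (4 * η) = η * y i ^ 2 - R i * y i + R i ^ 2 / (4 * η) := by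
        field_simp; ring
      linarith
    have h3 : R i ^ 2 / (4 * η) ≤ r ^ 2 / (4 * η) := by gcongr
    linarith
  rw [Finset.sum_add_distrib, ← Finset.mul_sum, Finset.sum_const, nsmul_eq_mul, Nat.card_Ico] at this
  have hM1 : ((M - 1 : ℕ) : ℝ) ≤ M := by exact_mod_cast Nat.sub_le _ _
  have hM2 : ((M - 1 : ℕ) : ℝ) * (r ^ 2 / (4 * η)) ≤ M * (r ^ 2 / (4 * η)) := by gcongr
  calc _ ≤ h * (η * ∑ i ∈ Finset.Ico 1 M, y i ^ 2 + M * (r ^ 2 / (4 * η))) := by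
        gcongr; linarith
    _ = _ := by ring

/-! ### The discrete energy inequality -/

/-- The Grünwald convolution `∑ g_k w^{n-k}`. -/
def gConv (α : ℝ) (w : ℕ → ℝ) (n : ℕ) : ℝ := ∑ k ∈ Finset.range (n + 1), gCoeff α k * w (n - k)

/-- For `0 < α < 1` the left side is nonnegative. The free parameter is then set to `t = w n - gConv
α w n` and to `t = w n`, one choice for each of the next two inequalities. -/
theorem sum_neg_gCoeff_mul_sq (α t : ℝ) (w : ℕ → ℝ) (n : ℕ) :
    ∑ k ∈ Finset.range n, -gCoeff α (k + 1) * (w (n - (k + 1)) - t) ^ 2 =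
      (w n ^ 2 - gConv α (fun m => w m ^ 2) n) - 2 * t * (w n - gConv α w n)
        + t ^ 2 * (1 - gSum α n) := by
  simp only [gConv, gSum, Finset.sum_range_succ' _ n, gCoeff_zero, Nat.sub_zero]
  have : ∀ k, -gCoeff α (k + 1) * (w (n - (k + 1)) - t) ^ 2 =
      -(gCoeff α (k + 1) * w (n - (k + 1)) ^ 2) + 2 * t * (gCoeff α (k + 1) * w (n - (k + 1)))
        - t ^ 2 * gCoeff α (k + 1) := fun k => by ring
  simp only [this, Finset.sum_add_distrib, Finset.sum_sub_distrib, Finset.sum_neg_distrib,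
    ← Finset.mul_sum]
  ring

theorem gConv_sq_le_self {α : ℝ} (h0 : 0 < α) (h1 : α < 1) (w : ℕ → ℝ) (n : ℕ) :
    gConv α (fun m => w m ^ 2) n + gConv α w n ^ 2 ≤ 2 * (w n * gConv α w n) := by
  have e := sum_neg_gCoeff_mul_sq α (w n - gConv α w n) w n
  have hs : 0 ≤ ∑ k ∈ Finset.range n,
      -gCoeff α (k + 1) * (w (n - (k + 1)) - (w n - gConv α w n)) ^ 2 :=
    Finset.sum_nonneg fun k _ =>
      mul_nonneg (by linarith [gCoeff_succ_nonpos h0 h1 k]) (sq_nonneg _)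
  have hS : 0 ≤ gSum α n * (w n - gConv α w n) ^ 2 :=
    mul_nonneg (gSum_pos h1 n).le (sq_nonneg _)
  rw [e] at hs
  linarith

/-- The term with coefficient `-α` is kept, not merely discarded as nonnegative: with `D` the
convolution and `δ = w n - w (n - 1)`, it pays for the exchange of `w n` for `w (n - 1)` through
`2Dδ - αδ² ≤ D²/α`. -/
theorem gConv_sq_le_pred {α : ℝ} (h0 : 0 < α) (h1 : α < 1) (w : ℕ → ℝ) (n : ℕ) (hn : 1 ≤ n) :
    gConv α (fun m => w m ^ 2) n - gConv α w n ^ 2 / α ≤ 2 * (w (n - 1) * gConv α w n) := by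
  obtain ⟨n, rfl⟩ : ∃ m, n = m + 1 := ⟨n - 1, by omega⟩
  have e := sum_neg_gCoeff_mul_sq α (w (n + 1)) w (n + 1)
  rw [Finset.sum_range_succ'] at e
  have hs : 0 ≤ ∑ k ∈ Finset.range n,
      -gCoeff α (k + 1 + 1) * (w (n + 1 - (k + 1 + 1)) - w (n + 1)) ^ 2 :=
    Finset.sum_nonneg fun k _ =>
      mul_nonneg (by linarith [gCoeff_succ_nonpos h0 h1 (k + 1)]) (sq_nonneg _)
  have hg : gCoeff α (0 + 1) = -α := by rw [gCoeff_succ, gCoeff_zero]; simp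
  have hS : 0 ≤ gSum α (n + 1) * (w (n + 1)) ^ 2 :=
    mul_nonneg (gSum_pos h1 _).le (sq_nonneg _)
  set D := gConv α w (n + 1)
  have hq : 0 ≤ α * (D / α - (w (n + 1) - w n)) ^ 2 := by positivity
  have hq' : α * (D / α - (w (n + 1) - w n)) ^ 2 =
      D ^ 2 / α - 2 * D * (w (n + 1) - w n) + α * (w (n + 1) - w n) ^ 2 := by
    field_simp; ring
  rw [hg] at e
  simp only [zero_add, Nat.add_sub_cancel] at e ⊢
  rw [hq'] at hq
  nlinarith

/-- The convolution with the Grünwald coefficients, tested with a weighted average of the last two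
time levels. -/
theorem gConv_mul_avg_ge {α σ β : ℝ} (h0 : 0 < α) (h1 : α < 1) (hβ : 0 ≤ β) (hσ : β / α ≤ σ)
    (w : ℕ → ℝ) (n : ℕ) (hn : 1 ≤ n) :
    (σ + β) / 2 * gConv α (fun m => w m ^ 2) n ≤ gConv α w n * (σ * w n + β * w (n - 1)) := by
  have hσ0 : 0 ≤ σ := (div_nonneg hβ h0.le).trans hσ
  -- Add `σ` times the first inequality to `β` times the second; the squared convolution is left
  -- with the favourable coefficient `σ - β/α ≥ 0`.
  have a1 := mul_le_mul_of_nonneg_left (gConv_sq_le_self h0 h1 w n) hσ0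
  have a2 := mul_le_mul_of_nonneg_left (gConv_sq_le_pred h0 h1 w n hn) hβ
  have a3 := mul_le_mul_of_nonneg_right hσ (sq_nonneg (gConv α w n))
  have e : β * (gConv α w n ^ 2 / α) = β / α * gConv α w n ^ 2 := by ring
  nlinarith

theorem formEval_sum {ι : Type*} (s : Finset ι) (c : ι → ℝ) (w : ι → ℕ → ℝ) (x : ℕ ⊕ ℕ) :
    formEval (fun j => ∑ k ∈ s, c k * w k j) x = ∑ k ∈ s, c k * formEval (w k) x := by
  rcases x with x | x
  · simp [formEval]
  · simp [formEval, mul_add, Finset.sum_add_distrib]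

theorem formEval_lin (c d : ℝ) (p q : ℕ → ℝ) (x : ℕ ⊕ ℕ) :
    formEval (fun j => c * p j + d * q j) x = c * formEval p x + d * formEval q x := by
  rcases x with x | x
  · simp [formEval]
  · simp only [formEval, Sum.elim_inr]; ring

theorem compactForm_gConv_ge {α σ β h : ℝ} (h0 : 0 < α) (h1 : α < 1) (hβ : 0 ≤ β)
    (hσ : β / α ≤ σ) (hh : 0 ≤ h) (M : ℕ) (w : ℕ → ℕ → ℝ) (n : ℕ) (hn : 1 ≤ n) :
    (σ + β) / 2 * gConv α (fun m => compactForm h M (w m) (w m)) n ≤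
      compactForm h M (fun j => gConv α (fun m => w m j) n)
        (fun j => σ * w n j + β * w (n - 1) j) := by
  have e1 : (σ + β) / 2 * gConv α (fun m => compactForm h M (w m) (w m)) n =
      ∑ x ∈ formIdx M, formWeight h x * ((σ + β) / 2 * gConv α (fun m => formEval (w m) x ^ 2) n) := by
    simp only [gConv, compactForm, Finset.mul_sum]
    rw [Finset.sum_comm]
    refine Finset.sum_congr rfl fun x _ => Finset.sum_congr rfl fun k _ => ?_
    ring
  rw [e1]
  refine Finset.sum_le_sum fun x _ => mul_le_mul_of_nonneg_left ?_ (formWeight_nonneg hh x)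
  have e2 : formEval (fun j => gConv α (fun m => w m j) n) x
      = gConv α (fun m => formEval (w m) x) n := by
    simp only [gConv]
    exact formEval_sum _ _ _ x
  rw [e2, formEval_lin]
  exact gConv_mul_avg_ge h0 h1 hβ hσ (fun m => formEval (w m) x) n hn

/-- A discrete fractional comparison principle. -/
theorem le_of_gConv_le {α Q : ℝ} (h0 : 0 < α) (h1 : α < 1) (hQ : 0 ≤ Q) (E : ℕ → ℝ) (n : ℕ)
    (hE0 : E 0 = 0) (hE : ∀ m, 1 ≤ m → m ≤ n → gConv α E m ≤ Q) :
    ∀ m ≤ n, E m ≤ Real.Gamma (1 - α) * (n : ℝ) ^ α * Q := by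
  have hG : 0 < Real.Gamma (1 - α) := Real.Gamma_pos_of_pos (by linarith)
  set B := Real.Gamma (1 - α) * (n : ℝ) ^ α * Q with hB
  have hB0 : 0 ≤ B := by positivity
  intro m
  induction m using Nat.strong_induction_on with
  | _ m ih =>
    intro hm
    rcases Nat.eq_zero_or_pos m with h | h
    · rw [h, hE0]; exact hB0
    · obtain ⟨m, rfl⟩ : ∃ l, m = l + 1 := ⟨m - 1, by omega⟩
      have hc := hE (m + 1) (by omega) hm
      -- The term `k = 0` is `E (m + 1)`, and `k = m + 1` drops because `E 0 = 0`. The remaining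
      -- coefficients are nonpositive and sum to `gSum α m - 1`, so replacing the earlier values by
      -- `B` is harmless.
      rw [gConv, Finset.sum_range_succ', Finset.sum_range_succ] at hc
      simp only [gCoeff_zero, one_mul, Nat.sub_zero, Nat.sub_self, hE0, mul_zero, add_zero] at hc
      have hs : ∑ k ∈ Finset.range m, gCoeff α (k + 1) * B ≤
          ∑ k ∈ Finset.range m, gCoeff α (k + 1) * E (m + 1 - (k + 1)) :=
        Finset.sum_le_sum fun k _ => mul_le_mul_of_nonpos_left (ih _ (by omega) (by omega))
          (gCoeff_succ_nonpos h0 h1 k)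
      have hS : ∑ k ∈ Finset.range m, gCoeff α (k + 1) = gSum α m - 1 := by
        rw [gSum, Finset.sum_range_succ', gCoeff_zero]; ring
      rw [← Finset.sum_mul, hS] at hs
      have hn0 : 0 < (n : ℝ) := by
        have : 0 < n := by omega
        exact_mod_cast this
      have hle : (m : ℝ) + 1 ≤ n := by exact_mod_cast hm
      have hmpos : 0 < (m : ℝ) + 1 - α := by
        have : (0 : ℝ) ≤ m := by positivity
        linarith
      have hg : (n : ℝ) ^ (-α) ≤ Real.Gamma (1 - α) * gSum α m :=
        (Real.rpow_le_rpow_of_nonpos hmpos (by linarith) (by linarith)).trans (le_gSum h0 h1 m)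
      have hQB : Q ≤ B * gSum α m := by
        have e : Q = (n : ℝ) ^ (-α) * ((n : ℝ) ^ α * Q) := by
          rw [← mul_assoc, ← Real.rpow_add hn0]; simp
        calc Q = (n : ℝ) ^ (-α) * ((n : ℝ) ^ α * Q) := e
          _ ≤ (Real.Gamma (1 - α) * gSum α m) * ((n : ℝ) ^ α * Q) := by gcongr
          _ = _ := by rw [hB]; ring
      linarith

theorem compactForm_smul (h : ℝ) (M : ℕ) (c d : ℝ) (p q : ℕ → ℝ) :
    compactForm h M (fun j => c * p j) (fun j => d * q j) = c * d * compactForm h M p q := by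
  have e : ∀ (c : ℝ) (p : ℕ → ℝ) (x : ℕ ⊕ ℕ),
      formEval (fun j => c * p j) x = c * formEval p x := fun c p x => by
    rcases x with x | x
    · simp [formEval]
    · simp only [formEval, Sum.elim_inr]; ring
  simp only [compactForm, e, Finset.mul_sum]
  refine Finset.sum_congr rfl fun x _ => ?_
  ring

theorem compactForm_eq_zero {h : ℝ} {M : ℕ} {p : ℕ → ℝ} (hp : ∀ i ≤ M, p i = 0) (q : ℕ → ℝ) :
    compactForm h M p q = 0 := by
  rw [compactForm_eq, Finset.sum_eq_zero, Finset.sum_eq_zero]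
  · simp
  · intro i hi
    have := Finset.mem_range.1 hi
    rw [hp i (by omega), hp (i + 1) (by omega)]; simp
  · intro i hi
    have := Finset.mem_Ico.1 hi
    rw [hp i (by omega)]; simp

/-! ### Stability of the scheme, under the step condition and on finitely many levels. -/

section Stability

variable {α lam τ h r C T : ℝ} {M N : ℕ}

/-- The energy inequality for one time level. -/
theorem gConv_compactForm_le (h0 : 0 < α) (h1 : α < 1) (hτ : 0 < τ) (hh : 0 < h) (hM : 1 ≤ M)
    (hcond : 0 ≤ 2 - α - Real.exp (lam * τ)) (hC : 0 < C)
    (hP : ∀ v : ℕ → ℝ, v 0 = 0 → v M = 0 →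
      C * gridNorm h M v ^ 2 ≤ -gridInner h M (deltaX h v) v)
    (e : ℕ → ℕ → ℝ) {n : ℕ} (hn : 1 ≤ n) (he0 : ∀ m ≤ n, e m 0 = 0) (heM : ∀ m ≤ n, e m M = 0)
    (hR : ∀ i ∈ Finset.Ico 1 M, |schemeLHS α lam τ h M e n i| ≤ r) :
    gConv α (fun m => compactForm h M (fun j => Real.exp (lam * (m * τ)) * e m j)
        (fun j => Real.exp (lam * (m * τ)) * e m j)) n ≤
      Real.exp (2 * lam * (n * τ) - α * lam * τ / 2) * τ ^ α * (h * M * r ^ 2 / C) := by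
  -- The exponential weight turns `deltaT` into a plain Grünwald convolution, at the price of the
  -- factor `e^{lam τ}` at the earlier level of the average.
  set w : ℕ → ℕ → ℝ := fun m j => Real.exp (lam * (m * τ)) * e m j with hw
  have hwe : ∀ m j, e m j = Real.exp (-lam * (m * τ)) * w m j := fun m j => by
    rw [hw]; simp only
    rw [← mul_assoc, ← Real.exp_add]; simp
  set σ := 1 - α / 2 with hσ
  set β := α / 2 * Real.exp (lam * τ) with hβ
  have hσ2 : 1 / 2 ≤ σ := by rw [hσ]; linarith
  have hβ0 : 0 ≤ β := by positivity
  -- This is the step condition: `β/α = e^{lam τ}/2` and `σ = (2 - α)/2`.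
  have hσβ : β / α ≤ σ := by
    rw [hβ, hσ, div_le_iff₀ h0]; nlinarith
  have hform := compactForm_gConv_ge h0 h1 hβ0 hσβ hh.le M w n hn
  set z : ℕ → ℝ := fun j => σ * w n j + β * w (n - 1) j with hz
  set X := Real.exp (-lam * (n * τ)) with hX
  set a := Real.exp (α * lam * τ / 2) with ha
  have hy : ∀ i, avgT α (fun m => e m i) n = X * z i := fun i => by
    have hm : (((n - 1 : ℕ) : ℝ)) * τ = n * τ - τ := by
      rw [Nat.cast_sub hn]; push_cast; ring
    have hX' : Real.exp (-lam * (n * τ - τ)) = X * Real.exp (lam * τ) := by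
      rw [hX, ← Real.exp_add]; congr 1; ring
    simp only [avgT, hz]
    rw [hwe n i, hwe (n - 1) i, hm, hX', hβ]
    ring
  have hD : ∀ j, deltaT α lam τ (fun m => e m j) n =
      X * a * (τ ^ α)⁻¹ * gConv α (fun m => w m j) n := fun j => by
    rw [deltaT_eq α lam τ (fun m => e m j) (fun m => w m j) n (fun m _ => hwe m j), gConv]
    ring
  have hE := energy_identity (α := α) (lam := lam) (τ := τ) (h := h) hM e he0 heM
  have z0 : avgT α (fun m => e m 0) n = 0 := by
    simp [avgT, he0 n le_rfl, he0 (n - 1) (Nat.sub_le _ _)]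
  have z1 : avgT α (fun m => e m M) n = 0 := by
    simp [avgT, heM n le_rfl, heM (n - 1) (Nat.sub_le _ _)]
  have hPy := hP (fun i => avgT α (fun m => e m i) n) z0 z1
  -- Young's inequality with parameter `C`, so that the quadratic term is exactly what `hPy`
  -- absorbs.
  have hRy := gridInner_le_of_abs_le hh.le hC hR (fun i => avgT α (fun m => e m i) n)
  simp only [hD] at hE
  have hsc : compactForm h M (fun j => X * a * (τ ^ α)⁻¹ * gConv α (fun m => w m j) n)
      (fun i => avgT α (fun m => e m i) n) =
      X * a * (τ ^ α)⁻¹ * X * compactForm h M (fun j => gConv α (fun m => w m j) n) z := by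
    simp only [hy]
    exact compactForm_smul _ _ _ _ _ _
  rw [hsc] at hE
  set G := gConv α (fun m => compactForm h M (w m) (w m)) n with hG
  have hX0 : 0 < X := Real.exp_pos _
  have ha0 : 0 < a := Real.exp_pos _
  have hτα : 0 < τ ^ α := by positivity
  have hc : 0 ≤ X * a * (τ ^ α)⁻¹ * X := by positivity
  have k1 := mul_le_mul_of_nonneg_left hform hc
  have k2 : X * a * (τ ^ α)⁻¹ * X * ((σ + β) / 2 * G) ≤ h * M * r ^ 2 / (4 * C) := by linarith
  have hrhs : 0 ≤ h * M * r ^ 2 / C := by positivity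
  have hexp : Real.exp (2 * lam * (n * τ) - α * lam * τ / 2) * (X * X * a) = 1 := by
    rw [hX, ha, ← Real.exp_add, ← Real.exp_add, ← Real.exp_add, Real.exp_eq_one_iff]; ring
  have k3 : (σ + β) / 2 * G ≤ Real.exp (2 * lam * (n * τ) - α * lam * τ / 2) * τ ^ α *
      (h * M * r ^ 2 / (4 * C)) := by
    have hf : 0 ≤ Real.exp (2 * lam * (n * τ) - α * lam * τ / 2) * τ ^ α := by positivity
    have := mul_le_mul_of_nonneg_left k2 hf
    refine le_trans (le_of_eq ?_) this
    calc (σ + β) / 2 * G = 1 * (τ ^ α * (τ ^ α)⁻¹) * ((σ + β) / 2 * G) := by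
          rw [mul_inv_cancel₀ hτα.ne']; ring
      _ = _ := by rw [← hexp]; ring
  have e4 : h * M * r ^ 2 / (4 * C) = 1 / 4 * (h * M * r ^ 2 / C) := by field_simp
  rw [e4] at k3
  set P := Real.exp (2 * lam * (n * τ) - α * lam * τ / 2) * τ ^ α with hPdef
  have hP0 : 0 ≤ P * (h * M * r ^ 2 / C) := by positivity
  -- For `G ≥ 0`, `(σ + β)/2 ≥ 1/4` cancels the `1/4` on the right; for `G < 0` the right side is
  -- nonnegative.
  by_cases hG0 : 0 ≤ G
  · nlinarith
  · linarith

/-- Stability of the compact scheme. -/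
theorem gridNorm_sq_le_of_schemeLHS_le (h0 : 0 < α) (h1 : α < 1) (hτ : 0 < τ) (hh : 0 < h)
    (hM : 1 ≤ M) (hNT : N * τ = T)
    (hcond : 0 ≤ 2 - α - Real.exp (lam * τ)) (hC : 0 < C)
    (hP : ∀ v : ℕ → ℝ, v 0 = 0 → v M = 0 →
      C * gridNorm h M v ^ 2 ≤ -gridInner h M (deltaX h v) v)
    (e : ℕ → ℕ → ℝ) (hinit : ∀ i ≤ M, e 0 i = 0) (he0 : ∀ m ≤ N, e m 0 = 0)
    (heM : ∀ m ≤ N, e m M = 0)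
    (hR : ∀ n ∈ Finset.Icc 1 N, ∀ i ∈ Finset.Ico 1 M, |schemeLHS α lam τ h M e n i| ≤ r) :
    ∀ n ∈ Finset.Icc 1 N, gridNorm h M (e n) ^ 2 ≤
      3 * Real.Gamma (1 - α) * Real.exp (2 * |lam| * T) * T ^ α * (h * M) / C * r ^ 2 := by
  intro n hn
  rw [Finset.mem_Icc] at hn
  have hG : 0 < Real.Gamma (1 - α) := Real.Gamma_pos_of_pos (by linarith)
  set w : ℕ → ℕ → ℝ := fun m j => Real.exp (lam * (m * τ)) * e m j with hw
  set S := h * M * r ^ 2 / C with hS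
  have hS0 : 0 ≤ S := by positivity
  -- One bound for all levels `m ≤ n`: the first exponential is undone when passing from `w` back to
  -- `e`, and the second covers the case of negative `lam`.
  set Q := Real.exp (2 * lam * (n * τ)) * Real.exp (2 * |lam| * T) * τ ^ α * S with hQ
  have hE := le_of_gConv_le (Q := Q) h0 h1 (by positivity)
    (fun m => compactForm h M (w m) (w m)) n
    (compactForm_eq_zero (fun i hi => by simp [hw, hinit i hi]) _)
    (fun m hm1 hmn => by
      refine (gConv_compactForm_le h0 h1 hτ hh hM hcond hC hP e hm1
        (fun k hk => he0 k (by omega)) (fun k hk => heM k (by omega))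
        (hR m (Finset.mem_Icc.2 ⟨hm1, by omega⟩))).trans ?_
      have hexp : Real.exp (2 * lam * (m * τ) - α * lam * τ / 2) ≤
          Real.exp (2 * lam * (n * τ)) * Real.exp (2 * |lam| * T) := by
        rw [← Real.exp_add]
        apply Real.exp_le_exp.2
        have b1 : (1 : ℝ) ≤ m := by exact_mod_cast hm1
        have b2 : (m : ℝ) ≤ n := by exact_mod_cast hmn
        have b3 : (n : ℝ) ≤ N := by exact_mod_cast hn.2
        have b4 : (n : ℝ) * τ ≤ T := by rw [← hNT]; gcongr
        have c0 : 0 ≤ (2 * ((n : ℝ) - m) + α / 2) * τ := by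
          apply mul_nonneg _ hτ.le; linarith
        have c1 : -lam * ((2 * ((n : ℝ) - m) + α / 2) * τ) ≤
            |lam| * ((2 * ((n : ℝ) - m) + α / 2) * τ) :=
          mul_le_mul_of_nonneg_right (neg_le_abs lam) c0
        have c2 : (2 * ((n : ℝ) - m) + α / 2) * τ ≤ 2 * T := by nlinarith
        have c3 := mul_le_mul_of_nonneg_left c2 (abs_nonneg lam)
        linarith
      rw [hQ]
      gcongr) n le_rfl
  have hX : gridNorm h M (e n) ^ 2 = Real.exp (-(2 * lam * (n * τ))) * gridNorm h M (w n) ^ 2 := by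
    rw [gridNorm_sq hh.le, gridNorm_sq hh.le, Finset.mul_sum, Finset.mul_sum, Finset.mul_sum]
    refine Finset.sum_congr rfl fun i _ => ?_
    have : Real.exp (-(2 * lam * (n * τ))) * (Real.exp (lam * (n * τ))) ^ 2 = 1 := by
      rw [pow_two, ← Real.exp_add, ← Real.exp_add, Real.exp_eq_one_iff]; ring
    simp only [hw]
    calc h * e n i ^ 2 = 1 * (h * e n i ^ 2) := by ring
      _ = _ := by rw [← this]; ring
  have hexp1 : Real.exp (-(2 * lam * (n * τ))) * Real.exp (2 * lam * (n * τ)) = 1 := by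
    rw [← Real.exp_add]; simp
  have hnT : (n : ℝ) ^ α * τ ^ α ≤ T ^ α := by
    rw [← Real.mul_rpow (by positivity) hτ.le, ← hNT]
    have : (n : ℝ) ≤ N := by exact_mod_cast hn.2
    gcongr
  rw [hX]
  calc Real.exp (-(2 * lam * (n * τ))) * gridNorm h M (w n) ^ 2
      ≤ Real.exp (-(2 * lam * (n * τ))) * (3 / 2 * (Real.Gamma (1 - α) * (n : ℝ) ^ α * Q)) := by
        gcongr
        exact (gridNorm_sq_le_compactForm hh.le M _).trans (by gcongr)
    _ = (Real.exp (-(2 * lam * (n * τ))) * Real.exp (2 * lam * (n * τ))) *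
        (3 / 2 * Real.Gamma (1 - α) * Real.exp (2 * |lam| * T) * ((n : ℝ) ^ α * τ ^ α) * S) := by
        rw [hQ]; ring
    _ ≤ 3 * Real.Gamma (1 - α) * Real.exp (2 * |lam| * T) * T ^ α * S := by
        rw [hexp1, one_mul]
        gcongr
        norm_num
    _ = _ := by rw [hS]; ring

theorem abs_mul_le_young {η : ℝ} (hη : 0 < η) (c x y : ℝ) :
    -(c * (x * y)) ≤ |c| / 2 * (η * y ^ 2 + x ^ 2 / η) := by
  have h1 : |x * y| ≤ (η * y ^ 2 + x ^ 2 / η) / 2 := by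
    have h2 : 0 ≤ (η * |y| - |x|) ^ 2 / η := by positivity
    have h3 : (η * |y| - |x|) ^ 2 / η = η * |y| ^ 2 - 2 * (|x| * |y|) + |x| ^ 2 / η := by
      field_simp; ring
    rw [h3, sq_abs, sq_abs, ← abs_mul] at h2
    linarith
  calc -(c * (x * y)) ≤ |c * (x * y)| := neg_le_abs _
    _ = |c| * |x * y| := abs_mul _ _
    _ ≤ |c| * ((η * y ^ 2 + x ^ 2 / η) / 2) := by gcongr
    _ = _ := by ring

/-- Young's inequality in each functional; it lets the earlier time levels be treated as
perturbations of a leading multiple of the test function. -/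
theorem compactForm_perturb_ge {ι : Type*} (s : Finset ι) {h η : ℝ} (hh : 0 ≤ h) (hη : 0 < η)
    (M : ℕ) (c : ℝ) (d : ι → ℝ) (y : ℕ → ℝ) (p : ι → ℕ → ℝ) :
    c * compactForm h M y y - ∑ k ∈ s, |d k| / 2 * (η * compactForm h M y y
        + compactForm h M (p k) (p k) / η) ≤
      compactForm h M (fun j => c * y j + ∑ k ∈ s, d k * p k j) y := by
  have e : c * compactForm h M y y - ∑ k ∈ s, |d k| / 2 * (η * compactForm h M y y
        + compactForm h M (p k) (p k) / η) = ∑ x ∈ formIdx M, formWeight h x *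
        (c * formEval y x ^ 2 - ∑ k ∈ s, |d k| / 2 * (η * formEval y x ^ 2
          + formEval (p k) x ^ 2 / η)) := by
    have e1 : ∑ k ∈ s, |d k| / 2 * (η * compactForm h M y y + compactForm h M (p k) (p k) / η)
        = ∑ x ∈ formIdx M, ∑ k ∈ s, formWeight h x * (|d k| / 2 * (η * formEval y x ^ 2
          + formEval (p k) x ^ 2 / η)) := by
      rw [Finset.sum_comm]
      refine Finset.sum_congr rfl fun k _ => ?_
      simp only [compactForm, Finset.mul_sum, Finset.sum_div, ← Finset.sum_add_distrib]
      refine Finset.sum_congr rfl fun x _ => ?_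
      ring
    rw [e1, compactForm, Finset.mul_sum, ← Finset.sum_sub_distrib]
    refine Finset.sum_congr rfl fun x _ => ?_
    rw [← Finset.mul_sum]
    ring
  rw [e]
  refine Finset.sum_le_sum fun x _ => mul_le_mul_of_nonneg_left ?_ (formWeight_nonneg hh x)
  have e2 : formEval (fun j => c * y j + ∑ k ∈ s, d k * p k j) x =
      c * formEval y x + ∑ k ∈ s, d k * formEval (p k) x := by
    have := formEval_lin c 1 y (fun j => ∑ k ∈ s, d k * p k j) x
    simp only [one_mul] at this
    rw [this, formEval_sum]
  rw [e2, add_mul, Finset.sum_mul]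
  have : ∑ k ∈ s, -(d k * formEval (p k) x * formEval y x) ≤
      ∑ k ∈ s, |d k| / 2 * (η * formEval y x ^ 2 + formEval (p k) x ^ 2 / η) :=
    Finset.sum_le_sum fun k _ => by
      have := abs_mul_le_young hη (d k) (formEval (p k) x) (formEval y x)
      rwa [← mul_assoc] at this
  rw [Finset.sum_neg_distrib] at this
  linarith

theorem compactForm_add_le {h : ℝ} (hh : 0 ≤ h) (M : ℕ) (a b : ℝ) (p q : ℕ → ℝ) :
    compactForm h M (fun j => a * p j + b * q j) (fun j => a * p j + b * q j) ≤
      2 * a ^ 2 * compactForm h M p p + 2 * b ^ 2 * compactForm h M q q := by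
  simp only [compactForm, Finset.mul_sum, ← Finset.sum_add_distrib]
  refine Finset.sum_le_sum fun x _ => ?_
  rw [formEval_lin]
  have := mul_nonneg (formWeight_nonneg hh x) (sq_nonneg (a * formEval p x - b * formEval q x))
  linarith

/-- Stability on a fixed number of time levels, without restriction on the time step. -/
theorem exists_compactForm_le (h1 : α < 1) (lam : ℝ) (hτ : 0 < τ) (n : ℕ) :
    ∃ K : ℝ, 0 ≤ K ∧ ∀ (h r : ℝ) (M : ℕ) (e : ℕ → ℕ → ℝ), 0 < h → 1 ≤ M →
      (∀ i ≤ M, e 0 i = 0) → (∀ m ≤ n, e m 0 = 0) → (∀ m ≤ n, e m M = 0) →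
      (∀ m ∈ Finset.Icc 1 n, ∀ i ∈ Finset.Ico 1 M, |schemeLHS α lam τ h M e m i| ≤ r) →
      ∀ m ≤ n, compactForm h M (e m) (e m) ≤ K * (h * M * r ^ 2) := by
  induction n with
  | zero =>
    refine ⟨0, le_rfl, fun h r M e hh hM hinit _ _ _ m hm => ?_⟩
    obtain rfl : m = 0 := by omega
    rw [compactForm_eq_zero hinit]; simp
  | succ n ih =>
    obtain ⟨K, hK, ih⟩ := ih
    set σ := 1 - α / 2 with hσ
    have hσ2 : 0 < σ := by rw [hσ]; linarith
    set c := (τ ^ α)⁻¹ * gCoeffSubst α lam τ 0 / σ with hc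
    have hc0 : 0 < c := by
      have : 0 < gCoeffSubst α lam τ 0 := by
        rw [gCoeffSubst, gCoeff_zero, mul_one]; exact Real.exp_pos _
      positivity
    -- `c` makes `c y`, with `y` the time average, carry all of the newest level in `deltaT`; the
    -- correction at `k = 0` removes the part `c α/2` of level `n` that `c y` brings along.
    set d : ℕ → ℝ := fun k => (τ ^ α)⁻¹ * gCoeffSubst α lam τ (k + 1)
      - if k = 0 then c * (α / 2) else 0 with hd
    set D := ∑ k ∈ Finset.range (n + 1), |d k| with hD
    have hD0 : 0 ≤ D := Finset.sum_nonneg fun k _ => abs_nonneg _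
    -- Chosen so that the absorbed terms, with coefficients `3η/2` and `Dη/2`, use up exactly half
    -- of `c`.
    set η := c / (3 + D) with hη
    have hη0 : 0 < η := by positivity
    have hηc : η * (3 + D) = c := by rw [hη]; field_simp
    set K₁ := 2 / c * (1 / (4 * η) + D / 2 * (K / η)) with hK₁
    have hK₁0 : 0 ≤ K₁ := by positivity
    set K₂ := 2 * (1 / σ) ^ 2 * K₁ + 2 * (-(α / 2) / σ) ^ 2 * K with hK₂
    have hK₂0 : 0 ≤ K₂ := by positivity
    refine ⟨K + K₂, by positivity, fun h r M e hh hM hinit he0 heM hR m hm => ?_⟩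
    have hprev := ih h r M e hh hM hinit (fun m hm => he0 m (by omega))
      (fun m hm => heM m (by omega)) fun m hm => hR m
        (Finset.mem_Icc.2 ⟨(Finset.mem_Icc.1 hm).1, (Finset.mem_Icc.1 hm).2.trans (by omega)⟩)
    have hS0 : 0 ≤ h * M * r ^ 2 := by positivity
    rcases Nat.lt_or_ge n m with hmn | hmn
    swap
    · refine (hprev m hmn).trans ?_
      gcongr
      linarith
    obtain rfl : m = n + 1 := by omega
    set y : ℕ → ℝ := fun i => avgT α (fun m => e m i) (n + 1) with hy
    have hyi : ∀ i, y i = σ * e (n + 1) i + α / 2 * e n i := fun i => by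
      simp only [hy, avgT, Nat.add_sub_cancel, hσ]
    have y0 : y 0 = 0 := by rw [hyi, he0 _ le_rfl, he0 n (by omega)]; simp
    have yM : y M = 0 := by rw [hyi, heM _ le_rfl, heM n (by omega)]; simp
    have hE := energy_identity (α := α) (lam := lam) (τ := τ) (h := h) hM e he0 heM
    have hdelta : (fun j => deltaT α lam τ (fun m => e m j) (n + 1)) = fun j => c * y j +
        ∑ k ∈ Finset.range (n + 1), d k * e (n - k) j := by
      ext j
      have e1 : ∑ k ∈ Finset.range (n + 1), d k * e (n - k) j =
          (τ ^ α)⁻¹ * ∑ k ∈ Finset.range (n + 1), gCoeffSubst α lam τ (k + 1) * e (n - k) j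
            - c * (α / 2) * e n j := by
        simp only [hd, sub_mul, Finset.sum_sub_distrib, ite_mul, zero_mul]
        rw [Finset.sum_ite_eq' (Finset.range (n + 1)) 0]
        simp [Finset.mul_sum, mul_assoc]
      rw [e1, deltaT, Finset.sum_range_succ', hyi]
      have e2 : c * σ = (τ ^ α)⁻¹ * gCoeffSubst α lam τ 0 := by rw [hc]; field_simp
      simp only [Nat.add_sub_add_right, Nat.sub_zero]
      linear_combination -(e (n + 1) j) * e2
    rw [hdelta] at hE
    have hpert := compactForm_perturb_ge (Finset.range (n + 1)) hh.le hη0 M c d y fun k => e (n - k)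
    have hneg : 0 ≤ -gridInner h M (deltaX h y) y := by
      rw [neg_gridInner_deltaX hM y y0 yM]
      exact mul_nonneg hh.le (div_nonneg (Finset.sum_nonneg fun _ _ => sq_nonneg _) (sq_nonneg _))
    have hRy := gridInner_le_of_abs_le hh.le hη0
      (hR (n + 1) (Finset.mem_Icc.2 ⟨by omega, le_rfl⟩)) y
    have hny := gridNorm_sq_le_compactForm hh.le M y
    set A := compactForm h M y y with hA
    have hA0 : 0 ≤ A := compactForm_self_nonneg hh.le M y
    have hsum : ∑ k ∈ Finset.range (n + 1), |d k| / 2 * (η * A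
        + compactForm h M (e (n - k)) (e (n - k)) / η) ≤
        D / 2 * (η * A + K * (h * M * r ^ 2) / η) := by
      rw [hD, Finset.sum_div, Finset.sum_mul]
      refine Finset.sum_le_sum fun k _ => ?_
      have := hprev (n - k) (Nat.sub_le _ _)
      gcongr
    have hmain : c / 2 * A ≤ (1 / (4 * η) + D / 2 * (K / η)) * (h * M * r ^ 2) := by
      have k1 : η * gridNorm h M y ^ 2 ≤ η * (3 / 2 * A) := by gcongr
      have k2 : h * M * r ^ 2 / (4 * η) = 1 / (4 * η) * (h * M * r ^ 2) := by ring
      have k3 : D / 2 * (η * A + K * (h * M * r ^ 2) / η) =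
        D / 2 * (η * A) + D / 2 * (K / η) * (h * M * r ^ 2) := by ring
      have k4 : η * (3 / 2 * A) + D / 2 * (η * A) = c / 2 * A := by rw [← hηc]; ring
      linarith
    have hAle : A ≤ K₁ * (h * M * r ^ 2) := by
      have := mul_le_mul_of_nonneg_left hmain (by positivity : 0 ≤ 2 / c)
      calc A = 2 / c * (c / 2 * A) := by field_simp
        _ ≤ _ := this
        _ = _ := by rw [hK₁]; ring
    have hen : e (n + 1) = fun j => 1 / σ * y j + -(α / 2) / σ * e n j := by
      ext j
      rw [hyi]; field_simp; ring
    have hadd := compactForm_add_le hh.le M (1 / σ) (-(α / 2) / σ) y (e n)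
    rw [← hen] at hadd
    refine hadd.trans ?_
    have hn := hprev n le_rfl
    calc _ ≤ 2 * (1 / σ) ^ 2 * (K₁ * (h * M * r ^ 2))
          + 2 * (-(α / 2) / σ) ^ 2 * (K * (h * M * r ^ 2)) := by gcongr
      _ = K₂ * (h * M * r ^ 2) := by rw [hK₂]; ring
      _ ≤ _ := by gcongr; linarith

end Stability

/-! ### From truncation error and stability to convergence. -/

section Convergence

variable {α lam a b T : ℝ} {F φ u : ℝ → ℝ → ℝ} {M N : ℕ} {U : ℕ → ℕ → ℝ}

theorem deltaT_sub (τ : ℝ) (v w : ℕ → ℝ) (n : ℕ) :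
    deltaT α lam τ (fun m => v m - w m) n = deltaT α lam τ v n - deltaT α lam τ w n := by
  simp only [deltaT, mul_sub, Finset.sum_sub_distrib]

theorem schemeLHS_sub (τ h : ℝ) (V W : ℕ → ℕ → ℝ) {n i : ℕ} (hi : i ∈ Finset.Ico 1 M) :
    schemeLHS α lam τ h M (fun m j => V m j - W m j) n i =
      schemeLHS α lam τ h M V n i - schemeLHS α lam τ h M W n i := by
  simp only [schemeLHS, deltaT_sub, avgX, if_pos (Finset.mem_Ico.1 hi), avgT, deltaX]
  ring

/-- The initial condition is assumed only for `a < x < b`; continuity in `x` adds the corners. -/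
theorem eq_zero_at_initial_time (hab : a < b) (hT : 0 < T) (hu : ClassC 6 3 a b T u)
    (hsol : IsSolution α lam a b T F φ u) : ∀ x ∈ Icc a b, u x 0 = 0 := by
  have hc := (hu.contDiff_x 0 ⟨le_rfl, hT.le⟩).continuousOn
  rw [← closure_Ioo hab.ne] at hc ⊢
  intro x hx
  have h1 := le_on_closure (fun y hy => (hsol.init y hy).le) hc continuousOn_const hx
  have h2 := le_on_closure (fun y hy => (hsol.init y hy).ge) continuousOn_const hc hx
  exact le_antisymm h1 h2

/-- The error grid function satisfies the homogeneous conditions, and its residual in the scheme is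
the truncation error. -/
theorem error_properties (hab : a < b) (hT : 0 < T) (hu : ClassC 6 3 a b T u)
    (hsol : IsSolution α lam a b T F φ u) (hM : 1 ≤ M) (hN : 1 ≤ N)
    (hU : IsSchemeSolution α lam a b T F φ M N U) (e : ℕ → ℕ → ℝ)
    (he : e = fun n i => onGrid a ((b - a) / M) (T / N) u n i - U n i) :
    (∀ i ≤ M, e 0 i = 0) ∧ (∀ n ≤ N, e n 0 = 0) ∧ (∀ n ≤ N, e n M = 0) ∧
    ∀ n ∈ Finset.Icc 1 N, ∀ i ∈ Finset.Ico 1 M,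
      schemeLHS α lam (T / N) ((b - a) / M) M e n i = truncErr α lam a b T F u M N n i := by
  have hM' : (0 : ℝ) < M := by exact_mod_cast hM
  have hN' : (0 : ℝ) < N := by exact_mod_cast hN
  have hL : 0 < b - a := by linarith
  have hinit : ∀ i ≤ M, e 0 i = 0 := fun i hi => by
    have h1 : (i : ℝ) * ((b - a) / M) ≤ b - a := by
      have : (i : ℝ) ≤ M := by exact_mod_cast hi
      calc (i : ℝ) * ((b - a) / M) ≤ M * ((b - a) / M) := by gcongr
        _ = b - a := by field_simp
    have h2 : 0 ≤ (i : ℝ) * ((b - a) / M) := by positivity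
    simp only [he, onGrid, hU.init i hi, Nat.cast_zero, zero_mul, sub_zero]
    exact eq_zero_at_initial_time hab hT hu hsol _ ⟨by linarith, by linarith⟩
  have htime : ∀ n : ℕ, 1 ≤ n → n ≤ N → (n : ℝ) * (T / N) ∈ Ioc 0 T := fun n hn hnN => by
    have hn' : (0 : ℝ) < n := by exact_mod_cast hn
    have : (n : ℝ) ≤ N := by exact_mod_cast hnN
    refine ⟨by positivity, ?_⟩
    calc (n : ℝ) * (T / N) ≤ N * (T / N) := by gcongr
      _ = T := by field_simp
  refine ⟨hinit, fun n hn => ?_, fun n hn => ?_, fun n hn i hi => ?_⟩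
  · rcases Nat.eq_zero_or_pos n with h | h
    · rw [h]; exact hinit 0 (by omega)
    · simp only [he, onGrid, hU.left n (Finset.mem_Icc.2 ⟨h, hn⟩), Nat.cast_zero, zero_mul, add_zero]
      rw [hsol.left _ (htime n h hn), sub_self]
  · rcases Nat.eq_zero_or_pos n with h | h
    · rw [h]; exact hinit M le_rfl
    · have e1 : a + (M : ℝ) * ((b - a) / M) = b := by field_simp; ring
      simp only [he, onGrid, hU.right n (Finset.mem_Icc.2 ⟨h, hn⟩), e1]
      rw [hsol.right _ (htime n h hn), sub_self]
  · rw [he, schemeLHS_sub _ _ _ _ hi, hU.eqn n hn i hi, truncErr]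

theorem gridNorm_le_of_sq_le {h κ c ρ : ℝ} (hκ : 0 ≤ κ) (hc : 0 ≤ c) (hρ : 0 ≤ ρ) {v : ℕ → ℝ}
    (hv : gridNorm h M v ^ 2 ≤ κ * (c * ρ) ^ 2) : gridNorm h M v ≤ Real.sqrt κ * c * ρ := by
  refine abs_le_of_sq_le_sq' ?_ (by positivity) |>.2
  rw [mul_assoc, mul_pow, Real.sq_sqrt hκ]
  exact hv

theorem errorBound_of_truncBound (h0 : 0 < α) (h1 : α < 1) (hab : a < b) (hT : 0 < T)
    (hu : ClassC 6 3 a b T u) (hsol : IsSolution α lam a b T F φ u) {c : ℝ} (hc : 0 ≤ c)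
    (hM : 1 ≤ M) (hN : 1 ≤ N) (hcond : 0 ≤ 2 - α - Real.exp (lam * (T / N)))
    (htr : TruncBound α lam a b T F u M N c) {C : ℝ} (hC : 0 < C) (hmesh : IsMeshConst a b C) :
    ErrorBound α lam a b T F φ u M N C c := by
  intro U hU
  have hM' : (0 : ℝ) < M := by exact_mod_cast hM
  have hN' : (0 : ℝ) < N := by exact_mod_cast hN
  have hL : 0 < b - a := by linarith
  have hG : 0 < Real.Gamma (1 - α) := Real.Gamma_pos_of_pos (by linarith)
  obtain ⟨e0, el, er, eR⟩ := error_properties hab hT hu hsol hM hN hU _ rfl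
  intro n hn
  have hst := gridNorm_sq_le_of_schemeLHS_le (T := T)
    (r := c * ((T / N) ^ 2 + ((b - a) / M) ^ 4)) h0 h1 (by positivity) (by positivity) hM
    (by field_simp) hcond hC (hmesh M hM) _ e0 el er
    (fun n hn i hi => by rw [eR n hn i hi]; exact htr n hn i hi) n hn
  rw [show (b - a) / (M : ℝ) * M = b - a by field_simp] at hst
  exact gridNorm_le_of_sq_le (by positivity) hc (by positivity) hst

/-- As `N → ∞` the exponential tends to `1`, and `1 < 2 - α`. -/
theorem exists_condition_of_le (h1 : α < 1) (lam T : ℝ) :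
    ∃ N₀ : ℕ, ∀ N : ℕ, N₀ ≤ N → 0 ≤ 2 - α - Real.exp (lam * (T / N)) := by
  have hl : Filter.Tendsto (fun N : ℕ => Real.exp (lam * (T / N))) Filter.atTop (nhds 1) := by
    have h2 : Filter.Tendsto (fun N : ℕ => lam * (T / (N : ℝ))) Filter.atTop (nhds 0) := by
      have := (tendsto_const_div_atTop_nhds_zero_nat T).const_mul lam
      simpa using this
    have := (Real.continuous_exp.tendsto 0).comp h2
    rwa [Real.exp_zero] at this
  obtain ⟨N₀, hN₀⟩ := Filter.eventually_atTop.1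
    (hl.eventually (ge_mem_nhds (by linarith : (1 : ℝ) < 2 - α)))
  exact ⟨N₀, fun N hN => by linarith [hN₀ N hN]⟩

theorem exists_truncBound_and_errorBound (h0 : 0 < α) (h1 : α < 1) (hab : a < b) (hT : 0 < T)
    (hF : ContinuousOn (fun z : ℝ × ℝ => F z.1 z.2) (Icc a b ×ˢ Icc 0 T))
    (hu : ClassC 6 3 a b T u) (hsol : IsSolution α lam a b T F φ u)
    (hext : ∀ x ∈ Ioo a b, MemFourierClass (2 + α) (zeroExt (u x))) :
    ∃ c₁ : ℝ, 0 < c₁ ∧ ∀ M N : ℕ, 1 ≤ M → 1 ≤ N → TruncBound α lam a b T F u M N c₁ ∧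
      ∀ C : ℝ, 0 < C → IsMeshConst a b C → ErrorBound α lam a b T F φ u M N C c₁ := by
  have hL : 0 < b - a := by linarith
  have hG : 0 < Real.Gamma (1 - α) := Real.Gamma_pos_of_pos (by linarith)
  obtain ⟨c, hc, htr⟩ := exists_truncBound h0 h1 hab hT hF hu hsol hext
  obtain ⟨N₀, hN₀⟩ := exists_condition_of_le h1 lam T
  have hK' : ∀ N : ℕ, ∃ K : ℝ, 0 ≤ K ∧ (1 ≤ N → ∀ (h r : ℝ) (M : ℕ) (e : ℕ → ℕ → ℝ), 0 < h →
      1 ≤ M → (∀ i ≤ M, e 0 i = 0) → (∀ m ≤ N, e m 0 = 0) → (∀ m ≤ N, e m M = 0) →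
      (∀ m ∈ Finset.Icc 1 N, ∀ i ∈ Finset.Ico 1 M, |schemeLHS α lam (T / N) h M e m i| ≤ r) →
      ∀ m ≤ N, compactForm h M (e m) (e m) ≤ K * (h * M * r ^ 2)) := fun N => by
    rcases Nat.eq_zero_or_pos N with hN | hN
    · exact ⟨0, le_rfl, fun h => by omega⟩
    · have hN' : (0 : ℝ) < N := by exact_mod_cast hN
      obtain ⟨K, hK, h⟩ := exists_compactForm_le h1 lam (div_pos hT hN') N
      exact ⟨K, hK, fun _ => h⟩
  choose K hK0 hK using hK'
  -- A common bound for the stability constants of the finitely many `N` that may violate the step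
  -- condition.
  set S := ∑ N ∈ Finset.range N₀, K N with hS
  have hS0 : 0 ≤ S := Finset.sum_nonneg fun N _ => hK0 N
  set A := 3 * Real.Gamma (1 - α) * Real.exp (2 * |lam| * T) * T ^ α * (b - a) with hA
  have hA0 : 0 < A := by positivity
  -- A lower bound for `A / C` over all admissible `C`, by `IsMeshConst.le`.
  set κ := A * (b - a) ^ 2 / 8 with hκ
  have hκ0 : 0 < κ := by positivity
  -- The enlargement ensures both `c ≤ c₁` and `3/2 * S * (b - a) * c² ≤ κ * c₁²`, the latter needed
  -- for `N < N₀`.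
  set c₁ := c * (1 + Real.sqrt (3 / 2 * S * (b - a) / κ)) with hc₁
  have hsq : 0 ≤ Real.sqrt (3 / 2 * S * (b - a) / κ) := Real.sqrt_nonneg _
  have hcc : c ≤ c₁ := by rw [hc₁]; nlinarith
  have hc₁0 : 0 < c₁ := hc.trans_le hcc
  refine ⟨c₁, hc₁0, fun M N hM hN => ?_⟩
  have hM' : (0 : ℝ) < M := by exact_mod_cast hM
  have hN' : (0 : ℝ) < N := by exact_mod_cast hN
  have hρ : 0 ≤ (T / (N : ℝ)) ^ 2 + ((b - a) / M) ^ 4 := by positivity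
  have htr₁ : TruncBound α lam a b T F u M N c₁ := fun n hn i hi =>
    (htr M N hM hN n hn i hi).trans (by gcongr)
  refine ⟨htr₁, fun C hC hmesh => ?_⟩
  rcases le_or_gt N₀ N with hNN | hNN
  · exact errorBound_of_truncBound h0 h1 hab hT hu hsol hc₁0.le hM hN (hN₀ N hNN) htr₁ hC hmesh
  · intro U hU n hn
    obtain ⟨e0, el, er, eR⟩ := error_properties hab hT hu hsol hM hN hU _ rfl
    have hcr := hK N hN ((b - a) / M) (c * ((T / N) ^ 2 + ((b - a) / M) ^ 4)) M _ (by positivity)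
      hM e0 el er (fun n hn i hi => by rw [eR n hn i hi]; exact htr M N hM hN n hn i hi) n
      (Finset.mem_Icc.1 hn).2
    rw [show (b - a) / (M : ℝ) * M = b - a by field_simp] at hcr
    have hKS : K N ≤ S := Finset.single_le_sum (fun N _ => hK0 N) (Finset.mem_range.2 hNN)
    have hCκ : κ ≤ A / C := by
      have h2 := hmesh.le hab
      rw [le_div_iff₀ (by positivity)] at h2
      rw [hκ, le_div_iff₀ hC]
      nlinarith
    refine gridNorm_le_of_sq_le (by positivity) hc₁0.le hρ ?_
    set ρ := (T / (N : ℝ)) ^ 2 + ((b - a) / M) ^ 4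
    have hsqr : 3 / 2 * S * (b - a) * c ^ 2 ≤ κ * c₁ ^ 2 := by
      have e1 : Real.sqrt (3 / 2 * S * (b - a) / κ) ^ 2 = 3 / 2 * S * (b - a) / κ :=
        Real.sq_sqrt (by positivity)
      calc 3 / 2 * S * (b - a) * c ^ 2 = κ * (c * Real.sqrt (3 / 2 * S * (b - a) / κ)) ^ 2 := by
            rw [mul_pow, e1]; field_simp
        _ ≤ κ * c₁ ^ 2 := by
            rw [hc₁]
            gcongr
            linarith
    refine (gridNorm_sq_le_compactForm (by positivity) M _).trans ?_
    calc _ ≤ 3 / 2 * (K N * ((b - a) * (c * ρ) ^ 2)) := by gcongr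
      _ ≤ 3 / 2 * (S * ((b - a) * (c * ρ) ^ 2)) := by gcongr
      _ = (3 / 2 * S * (b - a) * c ^ 2) * ρ ^ 2 := by ring
      _ ≤ (κ * c₁ ^ 2) * ρ ^ 2 := by gcongr
      _ ≤ (A / C * c₁ ^ 2) * ρ ^ 2 := by gcongr
      _ = _ := by ring

end Convergence

end TFSDE

end

theorem mainTheorem7 (α lam a b T : ℝ) (hα₀ : 0 < α) (hα₁ : α < 1) (hab : a < b) (hT : 0 < T)
    (F φ u : ℝ → ℝ → ℝ)
    (hF : ContinuousOn (fun z : ℝ × ℝ => F z.1 z.2) (Set.Icc a b ×ˢ Set.Icc 0 T))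
    (hu : TFSDE.ClassC 6 3 a b T u)
    (hsol : TFSDE.IsSolution α lam a b T F φ u)
    (hext : ∀ x ∈ Set.Ioo a b, TFSDE.MemFourierClass (2 + α) (TFSDE.zeroExt (u x))) :
    (∃ C : ℝ, 0 < C ∧ TFSDE.IsMeshConst a b C) ∧
    (∃ c₁ : ℝ, 0 < c₁ ∧ ∀ M N : ℕ, 1 ≤ M → 1 ≤ N →
      TFSDE.TruncBound α lam a b T F u M N c₁ ∧
      ∀ C : ℝ, 0 < C → TFSDE.IsMeshConst a b C →
        TFSDE.ErrorBound α lam a b T F φ u M N C c₁) ∧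
    (∀ (c₁ : ℝ) (M N : ℕ), 0 ≤ c₁ → 1 ≤ M → 1 ≤ N →
      0 ≤ 2 - α - Real.exp (lam * (T / N)) →
      TFSDE.TruncBound α lam a b T F u M N c₁ →
      ∀ C : ℝ, 0 < C → TFSDE.IsMeshConst a b C →
        TFSDE.ErrorBound α lam a b T F φ u M N C c₁) := by
  refine ⟨⟨1 / (b - a) ^ 2, ?_, TFSDE.isMeshConst_inv_sq hab⟩,
    TFSDE.exists_truncBound_and_errorBound hα₀ hα₁ hab hT hF hu hsol hext,
    fun c₁ M N hc hM hN hcond htr C hC hmesh =>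
      TFSDE.errorBound_of_truncBound hα₀ hα₁ hab hT hu hsol hc hM hN hcond htr hC hmesh⟩
  have : 0 < b - a := by linarith
  positivity
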